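/- Let $\mathbb H$ be the upper half-plane, $e(x)=e^{2\pi i x}$ and $q=e(\tau)$. A meromorphic modular form of weight $k\in\mathbb Z$ is a quotient $f=f_1/f_2$ of holomorphic modular forms for $\mathrm{SL}_2(\mathbb Z)$, i.e. $f_i\in M_{k_i}$, $f_2\not\equiv0$, $k=k_1-k_2$. Let $f$ be such a form, regular at the cusp: $f(\tau)=O(1)$ as $\operatorname{Im}\tau\to\infty$. Write $f(\tau)=\sum_{n\ge 0}c_f(n)q^n$ for $\operatorname{Im}\tau$ large. **The regularized L-integral.** For $\Lambda$ large and $\epsilon>0$ let $\gamma(\Lambda,+\epsilon)$ (resp. $\gamma(\Lambda,-\epsilon)$) be any contour in $\mathbb H$ from $i/\Lambda$ to $i\Lambda$ that stays within distance $\epsilon$ of the imaginary axis in $\operatorname{Re}\tau\ge0$ (resp. $\operatorname{Re}\tau\le 0$), avoids the poles of $f$ on the axis, and passes between the axis and every pole of $f$ off the axis. Define $$L_f^*(s)^{\rm reg}=\lim_{\epsilon\to0^+}\lim_{\Lambda\to\infty}\frac12\sum_{\pm}\int_{\gamma(\Lambda,\pm\epsilon)}\Big(\frac{\tau}{i}\Big)^s\big(f(\tau)-c_f(0)\big)\frac{d\tau}{\tau}$$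 for $\operatorname{Re}s>\max(0,k)$ (for all $s\in\mathbb C$ if $c_f(0)=0$ or $k=0$), and by analytic continuation for all other $s\neq0,k$. **Notation for the explicit formula.** For a pole $p\in\mathbb H$ of $f$ let $r_{f,p}(n)$ be the coefficient of $(\tau-p)^n$ in the Laurent expansion of $f$ at $p$, and for $m\ge1$ put $r^*_{f,p}(m)=\frac{(-2\pi i)^m}{(m-1)!}\,r_{f,p}(-m)$. For $N\ge0$ let $\mathrm{Li}_{-N}(x)$ be the rational function equal to $\sum_{n\ge1}n^Nx^n$ for $|x|<1$. For $B>0$ let $V_B=\{\tau:-\frac12\le\operatorname{Re}\tau<\frac12,\ \operatorname{Im}\tau\ge B\}$ and $$P_Bf(\tau)=\sum_{p\in V_B}\sum_{m\ge1}r^*_{f,p}(m)\,\mathrm{Li}_{1-m}(e(\tau-p)),\qquad R_Bf=f-P_Bf=\sum_n c_{Rf}(n|B)q^n ,$$ where $p$ runs over the (finitely many) poles of $f$ in $V_B$ and the Fourier expansion is for $\operatorname{Im}\tau$ large. Let $\Gamma(s,x)=\int_x^\infty t^{s-1}e^{-t}\,dt$, and for $A>0$ let $$I_N(s,-ip\,|A)=\lim_{\epsilon\to0^+}\lim_{\Lambda\to\infty}\frac12\sum_\pm\int\Big(\frac{\tau}{i}\Big)^s\mathrm{Li}_{-N}(e(\tau-p))\frac{d\tau}{\tau},$$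 the integrals being over contours from $iA$ to $i\Lambda$ that pass on either side of the imaginary axis as above, with the poles $p+\mathbb Z$ in place of those of $f$. Call $B>0$ admissible if $B<\operatorname{Im}p$ for every pole $p$ of $f$ with $\operatorname{Im}p\ge\sqrt3/2$, and $B\ne\operatorname{Im}p$ for every pole $p$ of $f$. **Theorem.** (1) The limits defining $L_f^*(s)^{\rm reg}$ exist, do not depend on the choice of the contours, and $L_f^*(s)^{\rm reg}$ continues to a holomorphic function on $\mathbb C\setminus\{0,k\}$ (on $\mathbb C$ if $c_f(0)=0$ or $k=0$). For every $B>0$ the function $$L_f^*(s)^{\rm reg}+c_f(0)\Big(\frac{B^s}{s}+\frac{i^kB^{s-k}}{k-s}\Big)$$ extends to an entire function of $s$. (2) For every admissible $B$, every $s\ne0,k$ (and for all $s\in\mathbb C$ if $c_f(0)=0$ or $k=0$, the first term below being then read as $0$), $$L_f^*(s)^{\rm reg}=-c_f(0)\Big(\frac{B^s}{s}+\frac{i^kB^{s-k}}{k-s}\Big)+\sum_{n\ne0}c_{Rf}(n|B)\Big(\frac{\Gamma(s,2\pi nB)}{(2\pi n)^s}+i^k\frac{\Gamma(k-s,2\pi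 n/B)}{(2\pi n)^{k-s}}\Big)$$ $$\qquad+\sum_{p\in V_B}\sum_{m\ge1}r^*_{f,p}(m)\Big(I_{m-1}(s,-ip\,|B)+i^kI_{m-1}(k-s,-ip\,|1/B)\Big).$$ Here $c_{Rf}(n|B)=0$ for $n<0$, the sum over $n$ converges absolutely and the integrals $I_{m-1}$ exist for every $s\in\mathbb C$, and the sum of the last two groups of terms is an entire function of $s$. (3) $L_f^*(s)^{\rm reg}=i^kL_f^*(k-s)^{\rm reg}$ for all $s\ne0,k$ (for all $s\in\mathbb C$ if $c_f(0)=0$ or $k=0$). -/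

import Mathlib

open Complex Filter Topology MeasureTheory Set
open scoped UpperHalfPlane MatrixGroups

noncomputable section

namespace MeroL

/-! ### Meromorphic modular forms and their Fourier and Laurent coefficients -/

/-- A meromorphic modular form of weight `k`: a quotient of two level-one holomorphic modular
forms. As usual for meromorphic functions, removable singularities are removed: `f` is in
normal form on the upper half-plane, that is, holomorphic away from its poles. The values of
`f` outside the upper half-plane play no role. -/
def IsMeromorphicModularForm (k : ℤ) (f : ℂ → ℂ) : Prop :=
  MeromorphicNFOn f {τ : ℂ | 0 < τ.im} ∧
    ∃ (k₁ k₂ : ℤ) (f₁ : ModularForm 𝒮ℒ k₁) (f₂ : ModularForm 𝒮ℒ k₂),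
      f₂ ≠ 0 ∧ k = k₁ - k₂ ∧ ∀ τ : ℍ, f₂ τ ≠ 0 → f (τ : ℂ) = f₁ τ / f₂ τ

/-- `f` is regular at the cusp: `f(τ) = O(1)` as `Im τ → ∞`. -/
def IsRegularAtCusp (f : ℂ → ℂ) : Prop :=
  ∃ C T : ℝ, ∀ τ : ℂ, T < τ.im → ‖f τ‖ ≤ C

/-- The poles of `f` in the upper half-plane. -/
def poles (f : ℂ → ℂ) : Set ℂ := {τ | 0 < τ.im ∧ meromorphicOrderAt f τ < 0}

/-- The order of the pole of `f` at `p` (zero if there is no pole). -/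
def poleOrder (f : ℂ → ℂ) (p : ℂ) : ℕ := (-(meromorphicOrderAt f p).untop₀).toNat

/-- `e(x) = exp(2πix)`. -/
def e (x : ℂ) : ℂ := Complex.exp (2 * Real.pi * I * x)

/-- `g(τ) = ∑ c(n) qⁿ`, `q = e(τ)`, for all `τ` of sufficiently large imaginary part. -/
def IsFourierExpansion (g : ℂ → ℂ) (c : ℤ → ℂ) : Prop :=
  ∃ T : ℝ, ∀ τ : ℂ, T < τ.im → HasSum (fun n : ℤ => c n * e (n * τ)) (g τ)

open scoped Classical in
/-- The Fourier coefficients `c_g(n)` of `g` at the cusp (they are unique when they exist). -/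
def fourierCoeff (g : ℂ → ℂ) : ℤ → ℂ :=
  if h : ∃ c, IsFourierExpansion g c then h.choose else 0

/-- The coefficient of `(τ - p)ⁿ` in the Laurent expansion of `f` at `p`, as
`(2πi)⁻¹ ∮ f(τ) (τ - p)^(-n-1) dτ` over small circles around `p`. -/
def laurentCoeff (f : ℂ → ℂ) (p : ℂ) (n : ℤ) : ℂ :=
  limUnder (𝓝[>] (0 : ℝ)) fun ρ : ℝ =>
    (2 * Real.pi * I)⁻¹ * ∮ τ in C(p, ρ), f τ * (τ - p) ^ (-n - 1)

/-- `r*_{f,p}(m) = (-2πi)^m / (m-1)! · r_{f,p}(-m)` for `m ≥ 1`. -/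
def rStar (f : ℂ → ℂ) (p : ℂ) (m : ℕ) : ℂ :=
  (-2 * Real.pi * I) ^ m / ((m - 1).factorial : ℂ) * laurentCoeff f p (-(m : ℤ))

/-! ### Polylogarithms of order `-N` and pole subtraction -/

/-- The polylogarithm `Li_{-N}`, `N ≥ 0`, as a rational function on `ℂ \ {1}`: `Li₀(x) = x/(1-x)`
and `Li_{-(N+1)} = x d/dx Li_{-N}`. On the unit disc it is `∑_{n ≥ 1} n^N xⁿ`. -/
def polylogNeg : ℕ → ℂ → ℂ
  | 0 => fun x => x / (1 - x)
  | N + 1 => fun x => x * deriv (polylogNeg N) x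

/-- The poles of `f` in `V_B`: `-1/2 ≤ Re τ < 1/2`, `Im τ ≥ B`. -/
def polesAbove (f : ℂ → ℂ) (B : ℝ) : Set ℂ :=
  {p | p ∈ poles f ∧ -(1 / 2) ≤ p.re ∧ p.re < 1 / 2 ∧ B ≤ p.im}

/-- The polar part `P_B f`. -/
def polarPart (f : ℂ → ℂ) (B : ℝ) (τ : ℂ) : ℂ :=
  ∑ᶠ p ∈ polesAbove f B, ∑ m ∈ Finset.Icc 1 (poleOrder f p),
    rStar f p m * polylogNeg (m - 1) (e (τ - p))

/-- The pole-subtracted form `R_B f = f - P_B f`. -/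
def regularized (f : ℂ → ℂ) (B : ℝ) (τ : ℂ) : ℂ := f τ - polarPart f B τ

/-- `c_{Rf}(n|B)`: the Fourier coefficients of `R_B f`. -/
def coeffR (f : ℂ → ℂ) (B : ℝ) : ℤ → ℂ := fourierCoeff (regularized f B)

/-- The upper incomplete gamma function `Γ(s,x) = ∫_x^∞ t^(s-1) e^(-t) dt`, for `x > 0`. -/
def upperGamma (s : ℂ) (x : ℝ) : ℂ :=
  ∫ t in Ioi x, (t : ℂ) ^ (s - 1) * Complex.exp (-t)

/-! ### Contours passing on one side of the on-axis poles -/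

/-- Let `P` be a set of poles and `σ = 1` (right) or `σ = -1` (left). A piecewise differentiable
curve `γ : [0,1] → ℍ` with integrable derivative, from `a` to `b`, is an `ε`-contour on the side
`σ` if it stays on that closed side of the imaginary axis, within distance `ε` of the axis,
avoids `P` (so it passes the poles on the axis on the side `σ`), and passes between the axis and
every pole off the axis: it does not meet the horizontal ray that goes from such a pole, on the
side `σ`, away from the axis. -/
structure IsSideContour (P : Set ℂ) (σ ε : ℝ) (a b : ℂ) (γ : ℝ → ℂ) : Prop where
  source : γ 0 = a
  target : γ 1 = b
  cont : ContinuousOn γ (Icc 0 1)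
  piecewise : ∃ S : Finset ℝ, ∀ u ∈ Ioo (0 : ℝ) 1, u ∉ S → DifferentiableAt ℝ γ u
  integrable : IntervalIntegrable (deriv γ) volume 0 1
  upper : ∀ u ∈ Icc (0 : ℝ) 1, 0 < (γ u).im
  side : ∀ u ∈ Icc (0 : ℝ) 1, 0 ≤ σ * (γ u).re
  close : ∀ u ∈ Icc (0 : ℝ) 1, σ * (γ u).re ≤ ε
  avoids : ∀ u ∈ Icc (0 : ℝ) 1, γ u ∉ P
  between : ∀ u ∈ Icc (0 : ℝ) 1, ∀ p ∈ P, p.im = (γ u).im → 0 < σ * p.re →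
    σ * (γ u).re < σ * p.re

/-- The contour integral `∫_γ g(τ) dτ`. -/
def contourIntegral (g : ℂ → ℂ) (γ : ℝ → ℂ) : ℂ := ∫ u in (0 : ℝ)..1, g (γ u) * deriv γ u

/-- `v` is the iterated limit, first `Λ → ∞` and then `ε → 0+`, of the average of the integrals
of `g` from `a(Λ)` to `iΛ` over a contour on the left and a contour on the right. For every `ε`
and all large `Λ`, contours on both sides exist and the average does not depend on their
choice. -/
def HasRegIntegral (P : Set ℂ) (g : ℂ → ℂ) (a : ℝ → ℂ) (v : ℂ) : Prop :=
  ∃ l : ℝ → ℂ, Tendsto l (𝓝[>] 0) (𝓝 v) ∧ ∀ ε : ℝ, 0 < ε →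
    ∃ V : ℝ → ℂ, Tendsto V atTop (𝓝 (l ε)) ∧ ∀ᶠ Λ : ℝ in atTop,
      (∃ γ, IsSideContour P 1 ε (a Λ) (I * Λ) γ) ∧
      (∃ γ, IsSideContour P (-1) ε (a Λ) (I * Λ) γ) ∧
      ∀ γR γL : ℝ → ℂ, IsSideContour P 1 ε (a Λ) (I * Λ) γR →
        IsSideContour P (-1) ε (a Λ) (I * Λ) γL →
        (1 / 2) * (contourIntegral g γR + contourIntegral g γL) = V Λ

open scoped Classical in
/-- The value of the regularized integral (zero if it does not exist). -/
def regIntegral (P : Set ℂ) (g : ℂ → ℂ) (a : ℝ → ℂ) : ℂ :=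
  if h : ∃ v, HasRegIntegral P g a v then h.choose else 0

/-- The integrand of `(τ/i)^s h(τ) dτ/τ`. -/
def mellinIntegrand (s : ℂ) (h : ℂ → ℂ) (τ : ℂ) : ℂ := (τ / I) ^ s * h τ / τ

/-- The poles `p + ℤ` of `τ ↦ Li_{-N}(e(τ - p))`. -/
def translates (p : ℂ) : Set ℂ := {τ | ∃ n : ℤ, τ = p + n}

/-- `v` is the regularized integral of `(τ/i)^s Li_{-N}(e(τ - p)) dτ/τ` from `iA` to `i∞`. -/
def HasPolylogIntegral (N : ℕ) (s p : ℂ) (A : ℝ) (v : ℂ) : Prop :=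
  HasRegIntegral (translates p) (mellinIntegrand s fun τ => polylogNeg N (e (τ - p)))
    (fun _ => I * A) v

/-- `I_N(s, -ip | A)`: the value of that integral. -/
def polylogIntegral (N : ℕ) (s p : ℂ) (A : ℝ) : ℂ :=
  regIntegral (translates p) (mellinIntegrand s fun τ => polylogNeg N (e (τ - p)))
    (fun _ => I * A)

/-! ### The regularized L-integral -/

/-- Where the contour integral converges: everywhere if `c_f(0) = 0` or `k = 0`, and otherwise
for `Re s > max(0, k)`. -/
def convergenceRegion (f : ℂ → ℂ) (k : ℤ) : Set ℂ :=
  {s | fourierCoeff f 0 = 0 ∨ k = 0 ∨ (0 < s.re ∧ (k : ℝ) < s.re)}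

/-- The possible poles in `s`: none if `c_f(0) = 0` or `k = 0`, and otherwise `0` and `k`. -/
def exceptional (f : ℂ → ℂ) (k : ℤ) : Set ℂ :=
  {s | fourierCoeff f 0 ≠ 0 ∧ k ≠ 0 ∧ (s = 0 ∨ s = k)}

/-- `L` is the regularized L-integral of `f`: the limit of the averaged contour integrals from
`i/Λ` to `iΛ` of `(τ/i)^s (f(τ) - c_f(0)) dτ/τ` where it converges, continued analytically to all
`s` except the possible poles `0` and `k`. -/
structure IsRegLIntegral (f : ℂ → ℂ) (k : ℤ) (L : ℂ → ℂ) : Prop where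
  analytic : DifferentiableOn ℂ L (exceptional f k)ᶜ
  limit : ∀ s ∈ convergenceRegion f k,
    HasRegIntegral (poles f) (mellinIntegrand s fun τ => f τ - fourierCoeff f 0)
      (fun Λ => I / Λ) (L s)

open scoped Classical in
/-- `L_f^*(s)^reg` (unique off the exceptional set, by analytic continuation). -/
def regL (f : ℂ → ℂ) (k : ℤ) : ℂ → ℂ :=
  if h : ∃ L, IsRegLIntegral f k L then h.choose else 0

/-- `-c_f(0) (B^s/s + i^k B^(s-k)/(k-s))`. (For `k = 0` the two terms cancel; with `x/0 = 0` this
expression then vanishes at `s = 0` too, as it should.) -/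
def polarTerm (f : ℂ → ℂ) (k : ℤ) (B : ℝ) (s : ℂ) : ℂ :=
  -fourierCoeff f 0 *
    ((B : ℂ) ^ s / s + I ^ k * (B : ℂ) ^ (s - (k : ℂ)) / ((k : ℂ) - s))

/-- The `n`-th term of the sum of incomplete gamma functions. -/
def gammaTerm (f : ℂ → ℂ) (k : ℤ) (B : ℝ) (s : ℂ) (n : ℤ) : ℂ :=
  coeffR f B n *
    (upperGamma s (2 * Real.pi * n * B) / (2 * Real.pi * n : ℂ) ^ s
      + I ^ k * (upperGamma ((k : ℂ) - s) (2 * Real.pi * n / B)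
          / (2 * Real.pi * n : ℂ) ^ ((k : ℂ) - s)))

/-- The sum of the polylogarithm integrals over the poles in `V_B`. -/
def polylogPart (f : ℂ → ℂ) (k : ℤ) (B : ℝ) (s : ℂ) : ℂ :=
  ∑ᶠ p ∈ polesAbove f B, ∑ m ∈ Finset.Icc 1 (poleOrder f p),
    rStar f p m * (polylogIntegral (m - 1) s p B
      + I ^ k * polylogIntegral (m - 1) ((k : ℂ) - s) p (1 / B))

/-- The part of the explicit expression that is regular in `s`. -/
def regularPart (f : ℂ → ℂ) (k : ℤ) (B : ℝ) (s : ℂ) : ℂ :=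
  (∑' n : {n : ℤ // n ≠ 0}, gammaTerm f k B s n) + polylogPart f k B s

/-- Admissible heights `B > 0`: `B` lies below every pole of `f` whose imaginary part is at least
`√3/2`, and no pole of `f` has imaginary part `B`. -/
def IsAdmissible (f : ℂ → ℂ) (B : ℝ) : Prop :=
  0 < B ∧ (∀ p ∈ poles f, √3 / 2 ≤ p.im → B < p.im) ∧ ∀ p ∈ poles f, p.im ≠ B

end MeroL

end

noncomputable section

namespace MeroL

/-! ### Primitives on horizontally convex domains -/

/-! The integrals do not depend on the contours; the rest is Riemann's argument for the functional
equation. A contour on one side of the axis lives in a horizontal strip slit along a horizontal ray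
from each relevant pole. The slit strip retracts horizontally onto a vertical line close to the
axis, so the integrand has a primitive there and the contour can be replaced by three sides of a
thin rectangle (`IsSideContour.contourIntegral_eq`). The average over the two sides is therefore a
quantity `axisIntegral` that depends only on the endpoints (`average_contourIntegral`), and the
limit in `ε` is that of a constant. Since `τ ↦ -1/τ` exchanges the two sides of the axis, the
average is compatible with inversion (`axisIntegral_inv`).

Cut the path from `i/Λ` to `iΛ` at `iB` and invert the lower half. Modularity of `f` turns it into
an integral from `i/B` to `iΛ` with `k - s` in place of `s`, while the constant `c_f(0)` contributes
power integrals that converge to `polarTerm`. What remains are two integrals up to `i∞` of `f -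
c_f(0)`, which decays exponentially, so they are entire in `s`. Their combination `splitL` gives
existence and continuation, and the identity theorem makes it independent of `B`. Replacing `(B, s)`
by `(1/B, k - s)` exchanges the two integrals, which is the functional equation for even `k`; for
odd `k` the form vanishes.

For the explicit formula, `Li_{1-m}(e(τ - p))` has at `p` a pure pole of order `m`, so `P_B f`
cancels the principal parts of `f` at all translates of the poles in `V_B`. Low poles are images of
high ones, so an admissible `B` leaves no pole at heights between some `y₀ < min(B, 1/B)` and `B`.
Hence `R_B f` extends holomorphically to `Im τ > y₀`, and its `q`-series can be integrated term by
term from both `iB` and `i/B`. This gives the incomplete gamma functions, and `P_B f` gives the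
integrals `I_N`. -/

theorem hasDerivAt_boxPrimitive {W : Set ℂ} (hW : IsOpen W) {x₀ y₀ y₁ c : ℝ} {g : ℂ → ℂ}
    (hg : DifferentiableOn ℂ g W) (hstrip : ∀ z ∈ W, z.im ∈ Ioo y₀ y₁)
    (hline : ∀ y ∈ Ioo y₀ y₁, (x₀ + y * I : ℂ) ∈ W)
    (hconv : ∀ z ∈ W, ∀ x ∈ uIcc x₀ z.re, (x + z.im * I : ℂ) ∈ W)
    (hc : c ∈ Ioo y₀ y₁) {z₀ : ℂ} (hz₀ : z₀ ∈ W) :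
    HasDerivAt (fun z : ℂ => (I * ∫ y in c..z.im, g (x₀ + y * I))
      + ∫ x in x₀..z.re, g (x + z.im * I)) (g z₀) z₀ := by
  obtain ⟨r, hr, hball⟩ := Metric.isOpen_iff.1 hW z₀ hz₀
  have hgb : DifferentiableOn ℂ g (Metric.ball z₀ r) := hg.mono hball
  have hder := hgb.isConservativeOn.hasDerivAt_wedgeIntegral hgb.continuousOn
    (Metric.mem_ball_self hr)
  have hvert : ∀ a ∈ Ioo y₀ y₁, ∀ b ∈ Ioo y₀ y₁,
      IntervalIntegrable (fun y : ℝ => g (x₀ + y * I)) volume a b := by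
    intro a ha b hb
    refine (hg.continuousOn.comp (by fun_prop) ?_).intervalIntegrable
    intro y hy
    exact hline y ((ordConnected_Ioo.uIcc_subset ha hb) hy)
  have hhor : ∀ z ∈ W, ∀ x ∈ uIcc x₀ z.re, ∀ x' ∈ uIcc x₀ z.re,
      IntervalIntegrable (fun x : ℝ => g (x + z.im * I)) volume x x' := by
    intro z hz x hx x' hx'
    refine (hg.continuousOn.comp (by fun_prop) ?_).intervalIntegrable
    intro t ht
    exact hconv z hz t (uIcc_subset_uIcc hx hx' ht)
  have hmem : ∀ z ∈ Metric.ball z₀ r, ∀ t ∈ uIcc z₀.im z.im,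
      (z.re + t * I : ℂ) ∈ Metric.ball z₀ r := by
    intro z hz t ht
    rw [Metric.mem_ball] at hz ⊢
    refine lt_of_le_of_lt ?_ hz
    rw [Complex.dist_eq_re_im, Complex.dist_eq_re_im]
    apply Real.sqrt_le_sqrt
    have : (t - z₀.im) ^ 2 ≤ (z.im - z₀.im) ^ 2 := by
      rw [mem_uIcc] at ht
      rcases ht with ht | ht <;> nlinarith
    simpa using this
  -- Near `z₀` the global candidate is the local wedge primitive plus a constant: the discrepancy is
  -- an integral over the boundary of a rectangle, which vanishes.
  refine (hder.add_const ((I * ∫ y in c..z₀.im, g (x₀ + y * I))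
      + ∫ x in x₀..z₀.re, g (x + z₀.im * I))).congr_of_eventuallyEq ?_
  filter_upwards [Metric.ball_mem_nhds z₀ hr] with z hz
  have hzW := hball hz
  -- The rectangle lies in `W`: its edge through `z` is in the ball, and horizontal convexity fills
  -- in the rest up to the line `re = x₀`.
  have hrect := integral_boundary_rect_eq_zero_of_differentiableOn g (x₀ + z₀.im * I) z (by
    refine hg.mono ?_
    intro w hw
    have h1 : w.re ∈ uIcc x₀ z.re := by simpa using hw.1
    have h2 : w.im ∈ uIcc z₀.im z.im := by simpa using hw.2
    have := hconv _ (hball (hmem z hz w.im h2)) w.re (by simpa using h1)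
    simpa [Complex.re_add_im] using this)
  have hz' : (z.re + z₀.im * I : ℂ) ∈ W := hball (hmem z hz _ left_mem_uIcc)
  have e1 := intervalIntegral.integral_add_adjacent_intervals
    (hvert c hc z₀.im (hstrip _ hz₀)) (hvert z₀.im (hstrip _ hz₀) z.im (hstrip _ hzW))
  have hgi : IntervalIntegrable (fun x : ℝ => g (x + z₀.im * I)) volume x₀ z.re := by
    have := hhor _ hz' x₀ left_mem_uIcc z.re (by simp)
    simpa using this
  have e2 := intervalIntegral.integral_add_adjacent_intervals
    (hhor z₀ hz₀ x₀ left_mem_uIcc z₀.re right_mem_uIcc)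
    ((hhor z₀ hz₀ x₀ left_mem_uIcc z₀.re right_mem_uIcc).symm.trans hgi)
  simp only [wedgeIntegral, smul_eq_mul]
  simp only [add_re, ofReal_re, mul_re, I_re, mul_zero, ofReal_im, I_im, mul_one, sub_self,
    add_zero, add_im, mul_im, zero_add, smul_eq_mul] at hrect
  linear_combination (-I) * e1 + (-1 : ℂ) * hrect - e2

/-- The integral from `ia` to `ib` along three sides of the rectangle with the opposite side on
the imaginary axis and width `x₀`. -/
def sideBox (x₀ : ℝ) (g : ℂ → ℂ) (a b : ℝ) : ℂ :=
  (∫ x in (0 : ℝ)..x₀, g (x + a * I)) + (I * ∫ y in a..b, g (x₀ + y * I))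
    - ∫ x in (0 : ℝ)..x₀, g (x + b * I)

/-- The fundamental theorem of calculus, off the finitely many corners of `γ`, for the primitive
based on the line `re = x₀`. The endpoints on the axis supply the two horizontal sides. -/
theorem contourIntegral_eq_sideBox {W : Set ℂ} (hW : IsOpen W) {x₀ y₀ y₁ : ℝ} {g : ℂ → ℂ}
    (hg : DifferentiableOn ℂ g W) (hstrip : ∀ z ∈ W, z.im ∈ Ioo y₀ y₁)
    (hline : ∀ y ∈ Ioo y₀ y₁, (x₀ + y * I : ℂ) ∈ W)
    (hconv : ∀ z ∈ W, ∀ x ∈ uIcc x₀ z.re, (x + z.im * I : ℂ) ∈ W)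
    {γ : ℝ → ℂ} {a b : ℝ} (h0 : γ 0 = a * I) (h1 : γ 1 = b * I)
    (hγ : ContinuousOn γ (Icc 0 1))
    (hpw : ∃ S : Finset ℝ, ∀ u ∈ Ioo (0 : ℝ) 1, u ∉ S → DifferentiableAt ℝ γ u)
    (hint : IntervalIntegrable (deriv γ) volume 0 1)
    (hmem : ∀ u ∈ Icc (0 : ℝ) 1, γ u ∈ W) :
    contourIntegral g γ = sideBox x₀ g a b := by
  obtain ⟨S, hS⟩ := hpw
  have ha : (a * I : ℂ) ∈ W := h0 ▸ hmem 0 (by simp)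
  have hb : (b * I : ℂ) ∈ W := h1 ▸ hmem 1 (by simp)
  have haI : a ∈ Ioo y₀ y₁ := by simpa using hstrip _ ha
  have hbI : b ∈ Ioo y₀ y₁ := by simpa using hstrip _ hb
  set G : ℂ → ℂ := fun z : ℂ => (I * ∫ y in a..z.im, g (x₀ + y * I))
      + ∫ x in x₀..z.re, g (x + z.im * I) with hG
  have hGd : ∀ z ∈ W, HasDerivAt G (g z) z := fun z hz =>
    hasDerivAt_boxPrimitive hW hg hstrip hline hconv haI hz
  have hGc : ContinuousOn G W := fun z hz => (hGd z hz).continuousAt.continuousWithinAt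
  have key := integral_eq_of_hasDerivAt_off_countable (fun u => G (γ u))
    (fun u => g (γ u) * deriv γ u) (a := 0) (b := 1) (s := (S : Set ℝ)) S.countable_toSet
    (by
      rw [uIcc_of_le zero_le_one]
      exact hGc.comp hγ hmem)
    (by
      intro u hu
      simp only [zero_le_one, inf_of_le_left, sup_of_le_right] at hu
      have hd := (hS u hu.1 (by simpa using hu.2)).hasDerivAt
      have := (hGd (γ u) (hmem u (Ioo_subset_Icc_self hu.1))).scomp u hd
      simpa [mul_comm, Function.comp_def] using! this)
    (by
      refine hint.continuousOn_mul ?_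
      rw [uIcc_of_le zero_le_one]
      exact hg.continuousOn.comp hγ hmem)
  rw [contourIntegral, key, h0, h1]
  simp only [hG, sideBox]
  simp only [mul_im, ofReal_re, I_im, mul_one, ofReal_im, I_re, mul_zero, add_zero, mul_re,
    sub_self, intervalIntegral.integral_same]
  rw [intervalIntegral.integral_symm 0 x₀, intervalIntegral.integral_symm 0 x₀]
  ring

/-! ### Locally finite pole sets and widths free of poles off the axis -/

/-- `P` meets every compact box in the upper half-plane in a finite set. -/
def LocFin (P : Set ℂ) : Prop :=
  ∀ X y₀ y₁ : ℝ, 0 < y₀ → {p ∈ P | |p.re| ≤ X ∧ y₀ ≤ p.im ∧ p.im ≤ y₁}.Finite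

/-- No pole off the axis with height between `a` and `b` is within `δ` of the axis, and the
endpoints `ia`, `ib` are not poles. -/
structure Clear (P : Set ℂ) (a b δ : ℝ) : Prop where
  pos : 0 < δ
  left_pos : 0 < a
  right_pos : 0 < b
  left_notMem : (a * I : ℂ) ∉ P
  right_notMem : (b * I : ℂ) ∉ P
  gap : ∀ p ∈ P, p.im ∈ uIcc a b → p.re = 0 ∨ δ < |p.re|

theorem Clear.mono {P Q : Set ℂ} {a b δ : ℝ} (h : Clear Q a b δ) (hPQ : P ⊆ Q) : Clear P a b δ :=
  ⟨h.pos, h.left_pos, h.right_pos, fun h' => h.left_notMem (hPQ h'),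
    fun h' => h.right_notMem (hPQ h'), fun p hp => h.gap p (hPQ hp)⟩

theorem Clear.anti {P : Set ℂ} {a b δ δ' : ℝ} (h : Clear P a b δ) (h0 : 0 < δ') (hd : δ' ≤ δ) :
    Clear P a b δ' :=
  ⟨h0, h.left_pos, h.right_pos, h.left_notMem, h.right_notMem,
    fun p hp hi => (h.gap p hp hi).imp_right hd.trans_lt⟩

theorem Clear.sub {P : Set ℂ} {a b c d δ : ℝ} (h : Clear P a b δ) (hc : c ∈ uIcc a b)
    (hd : d ∈ uIcc a b) (hcP : (c * I : ℂ) ∉ P) (hdP : (d * I : ℂ) ∉ P) : Clear P c d δ := by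
  have hpos : ∀ x ∈ uIcc a b, 0 < x := by
    intro x hx
    exact lt_of_lt_of_le (lt_min h.left_pos h.right_pos) hx.1
  exact ⟨h.pos, hpos c hc, hpos d hd, hcP, hdP,
    fun p hp hi => h.gap p hp (uIcc_subset_uIcc hc hd hi)⟩

/-- Only finitely many poles at these heights satisfy `|re| ≤ 1`; the cap `1/2` takes care of the
others. -/
theorem LocFin.exists_gap {P : Set ℂ} (hP : LocFin P) {y₀ : ℝ} (y₁ : ℝ) (h : 0 < y₀) :
    ∃ δ > 0, ∀ p ∈ P, p.im ∈ Icc y₀ y₁ → p.re = 0 ∨ δ < |p.re| := by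
  have hfin := hP 1 y₀ y₁ h
  set F := {p ∈ P | |p.re| ≤ 1 ∧ y₀ ≤ p.im ∧ p.im ≤ y₁} with hF
  have hfin' : (F \ {p | p.re = 0}).Finite := hfin.sdiff
  obtain ⟨δ, hδ, hδF⟩ : ∃ δ > 0, ∀ p ∈ F \ {p | p.re = 0}, δ < |p.re| := by
    have : ∀ᶠ δ : ℝ in 𝓝[>] 0, ∀ p ∈ F \ {p | p.re = 0}, δ < |p.re| := by
      rw [hfin'.eventually_all]
      intro p hp
      exact mem_nhdsWithin_of_mem_nhds (Iio_mem_nhds (abs_pos.2 hp.2))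
    obtain ⟨δ, h1, h2⟩ := (this.and self_mem_nhdsWithin).exists
    exact ⟨δ, h2, h1⟩
  refine ⟨min δ (1 / 2), by positivity, fun p hp hi => ?_⟩
  by_cases h0 : p.re = 0
  · exact Or.inl h0
  right
  by_cases h1 : |p.re| ≤ 1
  · exact (min_le_left _ _).trans_lt (hδF p ⟨⟨hp, h1, hi.1, hi.2⟩, h0⟩)
  · exact (min_le_right _ _).trans_lt (by linarith)

theorem LocFin.exists_clear {P : Set ℂ} (hP : LocFin P) {a b : ℝ} (ha : 0 < a) (hb : 0 < b)
    (haP : (a * I : ℂ) ∉ P) (hbP : (b * I : ℂ) ∉ P) : ∃ δ, Clear P a b δ := by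
  obtain ⟨δ, hδ, h⟩ := hP.exists_gap (max a b) (lt_min ha hb)
  exact ⟨δ, hδ, ha, hb, haP, hbP, fun p hp hi => h p hp hi⟩

/-- Holomorphic at each point of the upper half-plane outside `P`. -/
def HolOff (P : Set ℂ) (g : ℂ → ℂ) : Prop := ∀ τ : ℂ, 0 < τ.im → τ ∉ P → DifferentiableAt ℂ g τ

theorem HolOff.mono {P Q : Set ℂ} {g : ℂ → ℂ} (hg : HolOff P g) (h : P ⊆ Q) : HolOff Q g :=
  fun τ hτ hQ => hg τ hτ fun hP => hQ (h hP)

theorem Clear.notMem {P : Set ℂ} {a b δ : ℝ} (h : Clear P a b δ) {x y : ℝ}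
    (hy : y ∈ uIcc a b) (hx : |x| ≤ δ) (h0 : x ≠ 0) : (x + y * I : ℂ) ∉ P := by
  intro hp
  rcases h.gap _ hp (by simpa using hy) with h1 | h1
  · exact h0 (by simpa using h1)
  · simp at h1; linarith

/-- Cauchy's theorem on the rectangle between the two outer edges, which stays off the axis because
`x` and `x'` have the same sign. -/
theorem Clear.sideBox_eq {P : Set ℂ} {g : ℂ → ℂ} (hg : HolOff P g) {a b δ x x' : ℝ}
    (h : Clear P a b δ) (hx : |x| ≤ δ) (hx' : |x'| ≤ δ) (hxx : 0 < x * x') :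
    sideBox x g a b = sideBox x' g a b := by
  have hpos : ∀ y ∈ uIcc a b, 0 < y := fun y hy =>
    lt_of_lt_of_le (lt_min h.left_pos h.right_pos) hy.1
  have hseg : ∀ t ∈ uIcc x x', |t| ≤ δ ∧ t ≠ 0 := by
    intro t ht
    rw [mem_uIcc] at ht
    rw [abs_le] at hx hx' ⊢
    refine ⟨by rcases ht with ht | ht <;> constructor <;> linarith [ht.1, ht.2], ?_⟩
    rintro rfl
    rcases ht with ht | ht <;> nlinarith [ht.1, ht.2]
  have hrect := integral_boundary_rect_eq_zero_of_differentiableOn g (x + a * I) (x' + b * I) (by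
    intro w hw
    have h1 : w.re ∈ uIcc x x' := by simpa using hw.1
    have h2 : w.im ∈ uIcc a b := by simpa using hw.2
    refine (hg w (hpos _ h2) ?_).differentiableWithinAt
    have := h.notMem h2 (hseg _ h1).1 (hseg _ h1).2
    simpa [re_add_im] using this)
  have hh : ∀ c, c ∈ uIcc a b → (c * I : ℂ) ∉ P → ∀ t, |t| ≤ δ →
      IntervalIntegrable (fun x : ℝ => g (x + c * I)) volume 0 t := by
    intro c hc hcP t ht
    refine ContinuousOn.intervalIntegrable ?_
    intro s hs
    have hst : |s| ≤ δ := by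
      rw [mem_uIcc] at hs
      rw [abs_le] at ht ⊢
      have := h.pos
      rcases hs with hs | hs <;> constructor <;> linarith [hs.1, hs.2]
    have : (s + c * I : ℂ) ∉ P := by
      by_cases h0 : s = 0
      · simpa [h0] using hcP
      · exact h.notMem hc hst h0
    refine ContinuousAt.continuousWithinAt ?_
    have := (hg _ (by simpa using hpos c hc) this).continuousAt
    exact this.comp (f := fun s : ℝ => (s + c * I : ℂ)) (by fun_prop)
  have ea := intervalIntegral.integral_interval_sub_left
    (hh a left_mem_uIcc h.left_notMem x' hx') (hh a left_mem_uIcc h.left_notMem x hx)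
  have eb := intervalIntegral.integral_interval_sub_left
    (hh b right_mem_uIcc h.right_notMem x' hx') (hh b right_mem_uIcc h.right_notMem x hx)
  simp only [add_re, ofReal_re, mul_re, I_re, mul_zero, ofReal_im, I_im, mul_one, sub_self,
    add_zero, add_im, mul_im, zero_add, smul_eq_mul] at hrect
  simp only [sideBox]
  linear_combination (-1 : ℂ) * ea + eb - hrect

/-- The average of the integrals over the two boxes of width `δ`. -/
def avgBox (δ : ℝ) (g : ℂ → ℂ) (a b : ℝ) : ℂ := (1 / 2) * (sideBox δ g a b + sideBox (-δ) g a b)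

open scoped Classical in
/-- The averaged integral of `g` from `ia` to `ib` past the poles on the axis. -/
def axisIntegral (P : Set ℂ) (g : ℂ → ℂ) (a b : ℝ) : ℂ :=
  if h : ∃ δ, Clear P a b δ then avgBox h.choose g a b else 0

theorem Clear.avgBox_eq {P : Set ℂ} {g : ℂ → ℂ} (hg : HolOff P g) {a b δ δ' : ℝ}
    (h : Clear P a b δ) (h' : Clear P a b δ') : avgBox δ g a b = avgBox δ' g a b := by
  wlog hle : δ' ≤ δ generalizing δ δ'
  · exact (this h' h (le_of_not_ge hle)).symm
  have h0 := h.pos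
  have h0' := h'.pos
  rw [avgBox, avgBox, h.sideBox_eq hg (x := δ) (x' := δ') (by rw [abs_of_pos h0])
    (by rwa [abs_of_pos h0']) (by positivity),
    h.sideBox_eq hg (x := -δ) (x' := -δ') (by rw [abs_neg, abs_of_pos h0])
    (by rwa [abs_neg, abs_of_pos h0']) (by nlinarith)]

theorem Clear.axisIntegral_eq {P : Set ℂ} {g : ℂ → ℂ} (hg : HolOff P g) {a b δ : ℝ}
    (h : Clear P a b δ) : axisIntegral P g a b = avgBox δ g a b := by
  have hex : ∃ δ, Clear P a b δ := ⟨δ, h⟩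
  rw [axisIntegral, dif_pos hex]
  exact hex.choose_spec.avgBox_eq hg h

/-! ### Contour integrals past the poles on the axis -/

/-- A curve no wider than the gap passes between the axis and the off-axis poles automatically,
since all of them at its heights are farther than `δ`. -/
theorem IsSideContour.of_gap {P : Set ℂ} {σ ε δ y₀ y₁ : ℝ} {a b : ℂ} {γ : ℝ → ℂ}
    (hσ : σ = 1 ∨ σ = -1) (hy : 0 < y₀) (hδε : δ ≤ ε)
    (hgap : ∀ p ∈ P, p.im ∈ Icc y₀ y₁ → p.re = 0 ∨ δ < |p.re|)
    (h0 : γ 0 = a) (h1 : γ 1 = b) (hd : ∀ u ∈ Icc (0 : ℝ) 1, DifferentiableAt ℝ γ u)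
    (hint : IntervalIntegrable (deriv γ) volume 0 1)
    (him : ∀ u ∈ Icc (0 : ℝ) 1, (γ u).im ∈ Icc y₀ y₁)
    (hre : ∀ u ∈ Icc (0 : ℝ) 1, 0 ≤ σ * (γ u).re ∧ σ * (γ u).re ≤ δ)
    (hav : ∀ u ∈ Icc (0 : ℝ) 1, γ u ∉ P) : IsSideContour P σ ε a b γ where
  source := h0
  target := h1
  cont := fun u hu => (hd u hu).continuousAt.continuousWithinAt
  piecewise := ⟨∅, fun u hu _ => hd u (Ioo_subset_Icc_self hu)⟩
  integrable := hint
  upper := fun u hu => hy.trans_le (him u hu).1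
  side := fun u hu => (hre u hu).1
  close := fun u hu => (hre u hu).2.trans hδε
  avoids := hav
  between := by
    intro u hu p hp hpi hpos
    rcases hgap p hp (hpi ▸ him u hu) with h | h
    · simp [h] at hpos
    · refine (hre u hu).2.trans_lt (h.trans_eq ?_)
      rcases hσ with rfl | rfl
      · rw [abs_of_pos (by linarith)]; ring
      · rw [abs_of_neg (by linarith)]; ring

/-- A smooth curve from `ia` to `ib` that bulges out of the axis to the side `σ`. -/
def bump (σ δ a b u : ℝ) : ℂ :=
  ((σ * δ * (u * (1 - u)) : ℝ) : ℂ) + (((1 - u) * a + u * b : ℝ) : ℂ) * I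

theorem bump_re (σ δ a b u : ℝ) : (bump σ δ a b u).re = σ * δ * (u * (1 - u)) := by
  simp only [bump, add_re, ofReal_re, mul_re, I_re, ofReal_im, I_im]; ring

theorem bump_im (σ δ a b u : ℝ) : (bump σ δ a b u).im = (1 - u) * a + u * b := by
  simp only [bump, add_im, ofReal_im, mul_im, I_re, ofReal_re, I_im]; ring

theorem bump_zero (σ δ a b : ℝ) : bump σ δ a b 0 = a * I := by simp [bump]

theorem bump_one (σ δ a b : ℝ) : bump σ δ a b 1 = b * I := by simp [bump]

theorem hasDerivAt_bump (σ δ a b u : ℝ) : HasDerivAt (bump σ δ a b)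
    (((σ * δ * (1 - 2 * u) : ℝ) : ℂ) + ((b - a : ℝ) : ℂ) * I) u := by
  have h1 : HasDerivAt (fun u : ℝ => σ * δ * (u * (1 - u))) (σ * δ * (1 - 2 * u)) u := by
    have := ((hasDerivAt_id u).mul ((hasDerivAt_id u).const_sub 1)).const_mul (σ * δ)
    refine this.congr_deriv ?_
    simp only [id]; ring
  have h2 : HasDerivAt (fun u : ℝ => (1 - u) * a + u * b) (b - a) u := by
    have := (((hasDerivAt_id u).const_sub 1).mul_const a).add ((hasDerivAt_id u).mul_const b)
    refine this.congr_deriv ?_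
    simp; ring
  exact h1.ofReal_comp.add (h2.ofReal_comp.mul_const I)

theorem bump_im_mem (σ δ a b : ℝ) {u : ℝ} (hu : u ∈ Icc (0 : ℝ) 1) :
    (bump σ δ a b u).im ∈ uIcc a b := by
  rw [bump_im, mem_uIcc]
  obtain ⟨h0, h1⟩ := hu
  rcases le_total a b with h | h
  · left; constructor <;> nlinarith
  · right; constructor <;> nlinarith

theorem bump_re_mem {σ δ : ℝ} (hσ : σ = 1 ∨ σ = -1) (hδ : 0 < δ) (a b : ℝ) {u : ℝ}
    (hu : u ∈ Icc (0 : ℝ) 1) :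
    0 ≤ σ * (bump σ δ a b u).re ∧ σ * (bump σ δ a b u).re ≤ δ := by
  have hσ2 : σ * σ = 1 := by rcases hσ with rfl | rfl <;> norm_num
  obtain ⟨h0, h1⟩ := hu
  have h2 : σ * (bump σ δ a b u).re = δ * (u * (1 - u)) := by
    rw [bump_re]; linear_combination (δ * (u * (1 - u))) * hσ2
  have h3 : 0 ≤ u * (1 - u) := mul_nonneg h0 (by linarith)
  rw [h2]
  constructor
  · positivity
  · exact mul_le_of_le_one_right hδ.le (by nlinarith)

theorem bump_abs_re {σ δ : ℝ} (hσ : σ = 1 ∨ σ = -1) (hδ : 0 < δ) (a b : ℝ) {u : ℝ}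
    (hu : u ∈ Icc (0 : ℝ) 1) : |(bump σ δ a b u).re| ≤ δ := by
  have := bump_re_mem hσ hδ a b hu
  rw [abs_le]
  rcases hσ with rfl | rfl <;> constructor <;> linarith

theorem Clear.bump_notMem {P : Set ℂ} {a b δ σ : ℝ} (h : Clear P a b δ) (hσ : σ = 1 ∨ σ = -1)
    {u : ℝ} (hu : u ∈ Icc (0 : ℝ) 1) : bump σ δ a b u ∉ P := by
  have hδ := h.pos
  have hσ0 : σ ≠ 0 := by rcases hσ with rfl | rfl <;> norm_num
  by_cases h0 : (bump σ δ a b u).re = 0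
  · rw [bump_re] at h0
    have : u = 0 ∨ u = 1 := by
      rcases mul_eq_zero.1 h0 with h0 | h0
      · exact absurd h0 (by positivity)
      · rcases mul_eq_zero.1 h0 with h0 | h0
        · exact Or.inl h0
        · right; linarith
    rcases this with rfl | rfl
    · rw [bump_zero]; exact h.left_notMem
    · rw [bump_one]; exact h.right_notMem
  · have := h.notMem (bump_im_mem σ δ a b hu) (bump_abs_re hσ hδ a b hu) h0
    rwa [re_add_im] at this

theorem Clear.isSideContour_bump {P : Set ℂ} {a b δ σ ε : ℝ} (h : Clear P a b δ)
    (hσ : σ = 1 ∨ σ = -1) (hε : δ ≤ ε) :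
    IsSideContour P σ ε (a * I) (b * I) (bump σ δ a b) := by
  have hd : deriv (bump σ δ a b) = fun u : ℝ =>
      ((σ * δ * (1 - 2 * u) : ℝ) : ℂ) + ((b - a : ℝ) : ℂ) * I :=
    funext fun u => (hasDerivAt_bump σ δ a b u).deriv
  refine IsSideContour.of_gap hσ (lt_min h.left_pos h.right_pos) hε h.gap (bump_zero ..)
    (bump_one ..) (fun u _ => (hasDerivAt_bump σ δ a b u).differentiableAt) ?_
    (fun u hu => bump_im_mem σ δ a b hu) (fun u hu => bump_re_mem hσ h.pos a b hu)
    (fun u hu => h.bump_notMem hσ hu)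
  rw [hd]
  exact (by fun_prop : Continuous _).intervalIntegrable _ _

/-- Slit the strip along a ray from each pole, away from the axis at poles strictly on the side `σ`
and in the opposite direction at all others. The line `re = σδ` runs between the two kinds of slits,
so the slit strip is horizontally convex towards it, and the contour conditions say exactly that `γ`
avoids the slits. -/
theorem IsSideContour.contourIntegral_eq {P : Set ℂ} (hP : LocFin P) {g : ℂ → ℂ}
    (hg : HolOff P g) {σ ε a b y₀ y₁ δ : ℝ} {γ : ℝ → ℂ} (hσ : σ = 1 ∨ σ = -1)
    (h : IsSideContour P σ ε (a * I) (b * I) γ) (hy : 0 < y₀)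
    (him : ∀ u ∈ Icc (0 : ℝ) 1, (γ u).im ∈ Ioo y₀ y₁) (hδ : 0 < δ)
    (hgap : ∀ p ∈ P, p.im ∈ Icc y₀ y₁ → p.re = 0 ∨ δ < |p.re|) :
    contourIntegral g γ = sideBox (σ * δ) g a b := by
  -- Both the contour and the line `re = σδ` fit in `|re| < X`. Restricting to this box leaves
  -- finitely many slits, so that their union is closed.
  set X := max ε δ + 1 with hX
  have hXε : ε < X := by rw [hX]; linarith [le_max_left ε δ]
  have hXδ : δ < X := by rw [hX]; linarith [le_max_right ε δ]
  set F := {p ∈ P | |p.re| ≤ X ∧ y₀ ≤ p.im ∧ p.im ≤ y₁} with hF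
  have hFfin : F.Finite := hP X y₀ y₁ hy
  let ray : ℂ → Set ℂ := fun p => {z | z.im = p.im ∧
    ((0 < σ * p.re ∧ σ * p.re ≤ σ * z.re) ∨ (σ * p.re ≤ 0 ∧ σ * z.re ≤ σ * p.re))}
  have hray : ∀ p, IsClosed (ray p) := by
    intro p
    have h₁ : IsClosed {z : ℂ | 0 < σ * p.re ∧ σ * p.re ≤ σ * z.re} := by
      by_cases hp : 0 < σ * p.re
      · simp only [hp, true_and]
        exact isClosed_le (by fun_prop) (by fun_prop)
      · simp [hp]
    have h₂ : IsClosed {z : ℂ | σ * p.re ≤ 0 ∧ σ * z.re ≤ σ * p.re} := by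
      by_cases hp : σ * p.re ≤ 0
      · simp only [hp, true_and]
        exact isClosed_le (by fun_prop) (by fun_prop)
      · simp [hp]
    exact (isClosed_eq continuous_im continuous_const).inter (h₁.union h₂)
  let W : Set ℂ := {z | |z.re| < X ∧ z.im ∈ Ioo y₀ y₁} \ ⋃ p ∈ F, ray p
  have hWmem : ∀ z, z ∈ W ↔ (|z.re| < X ∧ z.im ∈ Ioo y₀ y₁) ∧ ∀ p ∈ F, z ∉ ray p := by
    intro z; simp [W]
  have hW : IsOpen W := by
    refine IsOpen.sdiff ?_ (hFfin.isClosed_biUnion fun p _ => hray p)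
    exact (isOpen_lt (continuous_abs.comp continuous_re) continuous_const).inter
      (isOpen_Ioo.preimage continuous_im)
  have hgapF : ∀ p ∈ F, p.re = 0 ∨ δ < |p.re| := fun p hp => hgap p hp.1 hp.2.2
  refine contourIntegral_eq_sideBox hW (y₀ := y₀) (y₁ := y₁) ?_ ?_ ?_ ?_ h.source h.target h.cont
    h.piecewise h.integrable ?_
  · intro z hz
    obtain ⟨⟨h1, h2⟩, h3⟩ := (hWmem z).1 hz
    refine (hg z (hy.trans h2.1) fun hzP => ?_).differentiableWithinAt
    refine h3 z ⟨hzP, h1.le, h2.1.le, h2.2.le⟩ ⟨rfl, ?_⟩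
    rcases lt_or_ge 0 (σ * z.re) with h | h
    · exact Or.inl ⟨h, le_rfl⟩
    · exact Or.inr ⟨h, le_rfl⟩
  · exact fun z hz => ((hWmem z).1 hz).1.2
  · intro y hy'
    rw [hWmem]
    refine ⟨⟨?_, by simpa using hy'⟩, ?_⟩
    · have : |σ * δ| = δ := by
        rcases hσ with rfl | rfl <;> simp [abs_of_pos hδ]
      simpa [this] using hXδ
    · rintro p hp ⟨-, h2⟩
      have := hgapF p hp
      simp only [add_re, ofReal_re, mul_re, I_re, mul_zero, ofReal_im, I_im, mul_one, sub_self,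
        add_zero] at h2
      rcases hσ with rfl | rfl
      · rcases h2 with h2 | h2
        · rw [abs_of_pos (by linarith)] at this
          rcases this with h | h <;> linarith
        · linarith
      · rcases h2 with h2 | h2
        · rw [abs_of_neg (by linarith)] at this
          rcases this with h | h <;> linarith
        · linarith
  · intro z hz x hx
    obtain ⟨⟨h1, h2⟩, h3⟩ := (hWmem z).1 hz
    rw [hWmem]
    have hb : |σ * δ| < X := by
      have : |σ * δ| = δ := by
        rcases hσ with rfl | rfl <;> simp [abs_of_pos hδ]
      rwa [this]
    refine ⟨⟨?_, by simpa using h2⟩, ?_⟩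
    · rw [mem_uIcc] at hx
      rw [abs_lt] at h1 hb
      simp only [add_re, ofReal_re, mul_re, I_re, mul_zero, ofReal_im, I_im, mul_one, sub_self,
        add_zero]
      rw [abs_lt]
      rcases hx with hx | hx <;> constructor <;> linarith [hx.1, hx.2]
    · rintro p hp ⟨h4, h5⟩
      have h6 := h3 p hp
      simp only [add_re, ofReal_re, mul_re, I_re, mul_zero, ofReal_im, I_im, mul_one, sub_self,
        add_zero, add_im, mul_im, zero_add] at h4 h5
      have h7 : ¬ ((0 < σ * p.re ∧ σ * p.re ≤ σ * z.re) ∨ (σ * p.re ≤ 0 ∧ σ * z.re ≤ σ * p.re)) :=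
        fun h => h6 ⟨h4, h⟩
      have := hgapF p hp
      rw [mem_uIcc] at hx
      push Not at h7
      rcases h5 with h5 | h5
      · have h8 := h7.1 h5.1
        have h9 : δ < σ * p.re := by
          rcases this with h9 | h9
          · simp [h9] at h5
          · rcases hσ with rfl | rfl
            · rw [abs_of_pos (by linarith)] at h9; linarith
            · rw [abs_of_neg (by linarith)] at h9; linarith
        rcases hσ with rfl | rfl <;> rcases hx with hx | hx <;> linarith [hx.1, hx.2]
      · have h8 := h7.2 h5.1
        rcases hσ with rfl | rfl <;> rcases hx with hx | hx <;> linarith [hx.1, hx.2]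
  · intro u hu
    rw [hWmem]
    have h1 := h.side u hu
    have h2 := h.close u hu
    refine ⟨⟨?_, him u hu⟩, ?_⟩
    · rw [abs_lt]
      rcases hσ with rfl | rfl <;> constructor <;> linarith
    · rintro p hp ⟨h4, h5⟩
      rcases h5 with h5 | h5
      · exact absurd (h.between u hu p hp.1 h4.symm h5.1) (not_lt.2 h5.2)
      -- A slit of the second kind can meet the closed side `σ` only at its tip `p`, and then `γ`
      -- would run through the pole.
      · have h6 : σ * (γ u).re = σ * p.re := le_antisymm h5.2 (h5.1.trans h1)
        have h7 : (γ u).re = p.re := by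
          rcases hσ with rfl | rfl <;> linarith
        exact h.avoids u hu ((Complex.ext h7 h4 : γ u = p) ▸ hp.1)

theorem IsSideContour.exists_range {P : Set ℂ} {σ ε : ℝ} {a b : ℂ} {γ : ℝ → ℂ}
    (h : IsSideContour P σ ε a b γ) :
    ∃ y₀ y₁ : ℝ, 0 < y₀ ∧ ∀ u ∈ Icc (0 : ℝ) 1, (γ u).im ∈ Ioo y₀ y₁ := by
  have hc : ContinuousOn (fun u => (γ u).im) (Icc 0 1) := continuous_im.comp_continuousOn h.cont
  obtain ⟨u₀, hu₀, hmin⟩ := isCompact_Icc.exists_isMinOn (nonempty_Icc.2 zero_le_one) hc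
  obtain ⟨u₁, hu₁, hmax⟩ := isCompact_Icc.exists_isMaxOn (nonempty_Icc.2 zero_le_one) hc
  have := h.upper u₀ hu₀
  refine ⟨(γ u₀).im / 2, (γ u₁).im + 1, by linarith, fun u hu => ⟨?_, ?_⟩⟩
  · exact lt_of_lt_of_le (by linarith) (hmin hu)
  · exact lt_of_le_of_lt (hmax hu) (by linarith)

/-- The contours may leave the range of heights between `a` and `b`, so `δ` is chosen for all
heights they reach; the boxes of that width still compute `axisIntegral`, which is independent of
the width. -/
theorem average_contourIntegral {P : Set ℂ} (hP : LocFin P) {g : ℂ → ℂ} (hg : HolOff P g)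
    {a b ε ε' : ℝ} {γR γL : ℝ → ℂ}
    (hR : IsSideContour P 1 ε (a * I) (b * I) γR) (hL : IsSideContour P (-1) ε' (a * I) (b * I) γL) :
    (1 / 2) * (contourIntegral g γR + contourIntegral g γL) = axisIntegral P g a b := by
  obtain ⟨r₀, r₁, hr₀, hr⟩ := hR.exists_range
  obtain ⟨l₀, l₁, hl₀, hl⟩ := hL.exists_range
  have hm : 0 < min r₀ l₀ := lt_min hr₀ hl₀
  obtain ⟨δ, hδ, hgap⟩ := hP.exists_gap (max r₁ l₁) hm
  have hR' : ∀ u ∈ Icc (0 : ℝ) 1, (γR u).im ∈ Ioo (min r₀ l₀) (max r₁ l₁) := fun u hu =>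
    ⟨(min_le_left _ _).trans_lt (hr u hu).1, (hr u hu).2.trans_le (le_max_left _ _)⟩
  have hL' : ∀ u ∈ Icc (0 : ℝ) 1, (γL u).im ∈ Ioo (min r₀ l₀) (max r₁ l₁) := fun u hu =>
    ⟨(min_le_right _ _).trans_lt (hl u hu).1, (hl u hu).2.trans_le (le_max_right _ _)⟩
  have ha : a ∈ Ioo (min r₀ l₀) (max r₁ l₁) := by
    have := hR' 0 (by simp)
    rw [hR.source] at this
    simpa using this
  have hb : b ∈ Ioo (min r₀ l₀) (max r₁ l₁) := by
    have := hR' 1 (by simp)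
    rw [hR.target] at this
    simpa using this
  have hclear : Clear P a b δ := by
    refine ⟨hδ, hm.trans ha.1, hm.trans hb.1, ?_, ?_, fun p hp hi => hgap p hp ?_⟩
    · have := hR.avoids 0 (by simp); rwa [hR.source] at this
    · have := hR.avoids 1 (by simp); rwa [hR.target] at this
    · exact Ioo_subset_Icc_self (ordConnected_Ioo.uIcc_subset ha hb hi)
  rw [hclear.axisIntegral_eq hg, avgBox,
    hR.contourIntegral_eq hP hg (Or.inl rfl) hm hR' hδ hgap,
    hL.contourIntegral_eq hP hg (Or.inr rfl) hm hL' hδ hgap]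
  simp

/-- By contour independence the inner limit is the same for every `ε`, and bumps of width at most
`ε` provide the required contours. -/
theorem hasRegIntegral_of_tendsto {P : Set ℂ} (hP : LocFin P) {g : ℂ → ℂ} (hg : HolOff P g)
    {a : ℝ → ℂ} {α : ℝ → ℝ} (hα : ∀ᶠ Λ in atTop, a Λ = α Λ * I ∧ 0 < α Λ ∧ (α Λ * I : ℂ) ∉ P)
    (hend : ∀ᶠ Λ : ℝ in atTop, (Λ * I : ℂ) ∉ P) {v : ℂ}
    (hv : Tendsto (fun Λ => axisIntegral P g (α Λ) Λ) atTop (𝓝 v)) :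
    HasRegIntegral P g a v := by
  refine ⟨fun _ => v, tendsto_const_nhds, fun ε hε => ⟨_, hv, ?_⟩⟩
  filter_upwards [hα, hend, eventually_gt_atTop 0] with Λ ⟨h1, h2, h3⟩ h4 h5
  rw [h1, mul_comm I]
  obtain ⟨δ, hδ⟩ := hP.exists_clear h2 h5 h3 h4
  have hδ' : Clear P (α Λ) Λ (min δ ε) := hδ.anti (lt_min hδ.pos hε) (min_le_left _ _)
  exact ⟨⟨_, hδ'.isSideContour_bump (Or.inl rfl) (min_le_right _ _)⟩,
    ⟨_, hδ'.isSideContour_bump (Or.inr rfl) (min_le_right _ _)⟩,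
    fun γR γL hR hL => average_contourIntegral hP hg hR hL⟩

/-- Existence of contours is part of `HasRegIntegral`, so both candidates can be evaluated on a
common pair. -/
theorem HasRegIntegral.unique {P : Set ℂ} {g : ℂ → ℂ} {a : ℝ → ℂ} {v w : ℂ}
    (hv : HasRegIntegral P g a v) (hw : HasRegIntegral P g a w) : v = w := by
  obtain ⟨l, hl, h⟩ := hv
  obtain ⟨l', hl', h'⟩ := hw
  refine tendsto_nhds_unique (hl.congr' ?_) hl'
  filter_upwards [self_mem_nhdsWithin] with ε hε
  obtain ⟨V, hV, hV2⟩ := h ε hε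
  obtain ⟨V', hV', hV2'⟩ := h' ε hε
  refine tendsto_nhds_unique (hV.congr' ?_) hV'
  filter_upwards [hV2, hV2'] with Λ ⟨⟨γR, hR⟩, ⟨γL, hL⟩, h1⟩ ⟨_, _, h2⟩
  rw [← h1 γR γL hR hL, h2 γR γL hR hL]

theorem HasRegIntegral.regIntegral_eq {P : Set ℂ} {g : ℂ → ℂ} {a : ℝ → ℂ} {v : ℂ}
    (hv : HasRegIntegral P g a v) : regIntegral P g a = v := by
  have hex : ∃ v, HasRegIntegral P g a v := ⟨v, hv⟩
  rw [regIntegral, dif_pos hex]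
  exact hex.choose_spec.unique hv

/-! ### Calculus of the averaged integrals -/

theorem Clear.pos_of_mem {P : Set ℂ} {a b δ : ℝ} (h : Clear P a b δ) {y : ℝ}
    (hy : y ∈ uIcc a b) : 0 < y := lt_of_lt_of_le (lt_min h.left_pos h.right_pos) hy.1

/-- The points of the three sides over which `sideBox x₀ g a b` integrates. -/
def boxPath (x₀ a b : ℝ) : Set ℂ :=
  {z | (z.re ∈ uIcc 0 x₀ ∧ (z.im = a ∨ z.im = b)) ∨ (z.re = x₀ ∧ z.im ∈ uIcc a b)}

theorem Clear.boxPath_notMem {P : Set ℂ} {a b δ x₀ : ℝ} (h : Clear P a b δ) (hx : |x₀| = δ)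
    {z : ℂ} (hz : z ∈ boxPath x₀ a b) : 0 < z.im ∧ z ∉ P := by
  have hx0 : x₀ ≠ 0 := by
    rintro rfl
    have := h.pos
    simp at hx
    linarith
  rcases hz with ⟨h1, h2⟩ | ⟨h1, h2⟩
  · have him : z.im ∈ uIcc a b := by rcases h2 with h2 | h2 <;> simp [h2]
    refine ⟨h.pos_of_mem him, ?_⟩
    by_cases h0 : z.re = 0
    · have hz' : z = z.im * I := by
        rw [← re_add_im z, h0]; simp
      rcases h2 with h2 | h2
      · rw [hz', h2]; exact h.left_notMem
      · rw [hz', h2]; exact h.right_notMem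
    · have := h.notMem him (x := z.re) ?_ h0
      · rwa [re_add_im] at this
      · rw [← hx]
        have := abs_sub_left_of_mem_uIcc h1
        simpa using this
  · refine ⟨h.pos_of_mem h2, ?_⟩
    have := h.notMem h2 (x := z.re) (by rw [h1, hx]) (by rwa [h1])
    rwa [re_add_im] at this

theorem boxPath_left {x₀ a b x : ℝ} (hx : x ∈ uIcc 0 x₀) : (x + a * I : ℂ) ∈ boxPath x₀ a b := by
  left; simpa using hx

theorem boxPath_right {x₀ a b x : ℝ} (hx : x ∈ uIcc 0 x₀) : (x + b * I : ℂ) ∈ boxPath x₀ a b := by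
  left; simpa using hx

theorem boxPath_vert {x₀ a b y : ℝ} (hy : y ∈ uIcc a b) : (x₀ + y * I : ℂ) ∈ boxPath x₀ a b := by
  right; simpa using hy

theorem sideBox_congr {x₀ a b : ℝ} {g g' : ℂ → ℂ} (h : ∀ z ∈ boxPath x₀ a b, g z = g' z) :
    sideBox x₀ g a b = sideBox x₀ g' a b := by
  rw [sideBox, sideBox,
    intervalIntegral.integral_congr (g := fun x : ℝ => g' (x + a * I))
      (fun x hx => h _ (boxPath_left hx)),
    intervalIntegral.integral_congr (g := fun x : ℝ => g' (x + b * I))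
      (fun x hx => h _ (boxPath_right hx)),
    intervalIntegral.integral_congr (g := fun y : ℝ => g' (x₀ + y * I))
      (fun x hx => h _ (boxPath_vert hx))]

theorem intervalIntegrable_sides {x₀ a b : ℝ} {g : ℂ → ℂ}
    (hg : ContinuousOn g (boxPath x₀ a b)) :
    IntervalIntegrable (fun x : ℝ => g (x + a * I)) volume 0 x₀ ∧
    IntervalIntegrable (fun x : ℝ => g (x + b * I)) volume 0 x₀ ∧
    IntervalIntegrable (fun y : ℝ => g (x₀ + y * I)) volume a b :=
  ⟨(hg.comp (by fun_prop) fun _ hx => boxPath_left hx).intervalIntegrable,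
    (hg.comp (by fun_prop) fun _ hx => boxPath_right hx).intervalIntegrable,
    (hg.comp (by fun_prop) fun _ hx => boxPath_vert hx).intervalIntegrable⟩

theorem sideBox_add {x₀ a b : ℝ} {g g' : ℂ → ℂ} (hg : ContinuousOn g (boxPath x₀ a b))
    (hg' : ContinuousOn g' (boxPath x₀ a b)) :
    sideBox x₀ (fun z => g z + g' z) a b = sideBox x₀ g a b + sideBox x₀ g' a b := by
  obtain ⟨h1, h2, h3⟩ := intervalIntegrable_sides hg
  obtain ⟨h1', h2', h3'⟩ := intervalIntegrable_sides hg'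
  rw [sideBox, intervalIntegral.integral_add h1 h1', intervalIntegral.integral_add h2 h2',
    intervalIntegral.integral_add h3 h3', sideBox, sideBox]
  ring

theorem sideBox_const_mul (c : ℂ) (x₀ a b : ℝ) (g : ℂ → ℂ) :
    sideBox x₀ (fun z => c * g z) a b = c * sideBox x₀ g a b := by
  simp only [sideBox, intervalIntegral.integral_const_mul]
  ring

theorem sideBox_swap (x₀ a b : ℝ) (g : ℂ → ℂ) : sideBox x₀ g b a = - sideBox x₀ g a b := by
  rw [sideBox, sideBox, intervalIntegral.integral_symm a b]
  ring

theorem HolOff.continuousOn {P : Set ℂ} {g : ℂ → ℂ} (hg : HolOff P g) {a b δ x₀ : ℝ}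
    (h : Clear P a b δ) (hx : |x₀| = δ) : ContinuousOn g (boxPath x₀ a b) := fun z hz =>
  (hg z (h.boxPath_notMem hx hz).1 (h.boxPath_notMem hx hz).2).continuousAt.continuousWithinAt

theorem Clear.abs_pos {P : Set ℂ} {a b δ : ℝ} (h : Clear P a b δ) : |δ| = δ :=
  _root_.abs_of_pos h.pos

theorem Clear.abs_neg {P : Set ℂ} {a b δ : ℝ} (h : Clear P a b δ) : |(-δ)| = δ := by
  rw [_root_.abs_neg, h.abs_pos]

theorem HolOff.add {P : Set ℂ} {g g' : ℂ → ℂ} (hg : HolOff P g) (hg' : HolOff P g') :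
    HolOff P fun z => g z + g' z := fun τ h1 h2 => (hg τ h1 h2).add (hg' τ h1 h2)

theorem HolOff.sub {P : Set ℂ} {g g' : ℂ → ℂ} (hg : HolOff P g) (hg' : HolOff P g') :
    HolOff P fun z => g z - g' z := fun τ h1 h2 => (hg τ h1 h2).sub (hg' τ h1 h2)

theorem HolOff.const_mul {P : Set ℂ} {g : ℂ → ℂ} (hg : HolOff P g) (c : ℂ) :
    HolOff P fun z => c * g z := fun τ h1 h2 => (hg τ h1 h2).const_mul c

theorem HolOff.sum {P : Set ℂ} {ι : Type*} {S : Finset ι} {g : ι → ℂ → ℂ}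
    (hg : ∀ i ∈ S, HolOff P (g i)) : HolOff P fun z => ∑ i ∈ S, g i z := fun τ h1 h2 =>
  DifferentiableAt.fun_sum fun i hi => hg i hi τ h1 h2

theorem holOff_const (P : Set ℂ) (c : ℂ) : HolOff P fun _ => c := fun _ _ _ =>
  differentiableAt_const c

/-- Endpoints `ia`, `ib` of an averaged integral: points of the upper half-plane outside the locally
finite set `P`. -/
structure Endpoints (P : Set ℂ) (a b : ℝ) : Prop where
  locFin : LocFin P
  left_pos : 0 < a
  right_pos : 0 < b
  left_notMem : (a * I : ℂ) ∉ P
  right_notMem : (b * I : ℂ) ∉ P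

theorem Endpoints.exists_clear {P : Set ℂ} {a b : ℝ} (h : Endpoints P a b) : ∃ δ, Clear P a b δ :=
  h.locFin.exists_clear h.left_pos h.right_pos h.left_notMem h.right_notMem

theorem Endpoints.symm {P : Set ℂ} {a b : ℝ} (h : Endpoints P a b) : Endpoints P b a :=
  ⟨h.1, h.3, h.2, h.5, h.4⟩

theorem Endpoints.trans {P : Set ℂ} {a b c : ℝ} (h : Endpoints P a b) (h' : Endpoints P b c) :
    Endpoints P a c :=
  ⟨h.1, h.2, h'.3, h.4, h'.5⟩

section Calculus

variable {P Q : Set ℂ} {g g' : ℂ → ℂ} {a b c : ℝ}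

/-- The chosen width depends only on `P`, `a` and `b`, hence is the same on both sides; no
holomorphy is needed. -/
theorem axisIntegral_congr (hab : Endpoints P a b)
    (h : ∀ τ : ℂ, 0 < τ.im → τ ∉ P → g τ = g' τ) : axisIntegral P g a b = axisIntegral P g' a b := by
  have hex := hab.exists_clear
  have hδ := hex.choose_spec
  rw [axisIntegral, axisIntegral, dif_pos hex, dif_pos hex, avgBox, avgBox,
    sideBox_congr fun z hz => h z (hδ.boxPath_notMem hδ.abs_pos hz).1
      (hδ.boxPath_notMem hδ.abs_pos hz).2,
    sideBox_congr fun z hz => h z (hδ.boxPath_notMem hδ.abs_neg hz).1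
      (hδ.boxPath_notMem hδ.abs_neg hz).2]

theorem axisIntegral_add (hab : Endpoints P a b) (hg : HolOff P g) (hg' : HolOff P g') :
    axisIntegral P (fun z => g z + g' z) a b = axisIntegral P g a b + axisIntegral P g' a b := by
  obtain ⟨δ, h⟩ := hab.exists_clear
  rw [h.axisIntegral_eq (hg.add hg'), h.axisIntegral_eq hg, h.axisIntegral_eq hg', avgBox, avgBox,
    avgBox, sideBox_add (hg.continuousOn h h.abs_pos) (hg'.continuousOn h h.abs_pos),
    sideBox_add (hg.continuousOn h h.abs_neg) (hg'.continuousOn h h.abs_neg)]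
  ring

theorem axisIntegral_const_mul (v : ℂ) (P : Set ℂ) (g : ℂ → ℂ) (a b : ℝ) :
    axisIntegral P (fun z => v * g z) a b = v * axisIntegral P g a b := by
  by_cases h : ∃ δ, Clear P a b δ
  · simp only [axisIntegral, dif_pos h, avgBox, sideBox_const_mul]
    ring
  · simp only [axisIntegral, dif_neg h, mul_zero]

theorem axisIntegral_sub (hab : Endpoints P a b) (hg : HolOff P g) (hg' : HolOff P g') :
    axisIntegral P (fun z => g z - g' z) a b = axisIntegral P g a b - axisIntegral P g' a b := by
  have := axisIntegral_add hab hg (hg'.const_mul (-1))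
  rw [axisIntegral_const_mul] at this
  simpa [← sub_eq_add_neg] using this

theorem axisIntegral_sum (hab : Endpoints P a b) {ι : Type*} (S : Finset ι) {g : ι → ℂ → ℂ}
    (hg : ∀ i ∈ S, HolOff P (g i)) :
    axisIntegral P (fun z => ∑ i ∈ S, g i z) a b = ∑ i ∈ S, axisIntegral P (g i) a b := by
  classical
  induction S using Finset.induction_on with
  | empty =>
    have := axisIntegral_const_mul 0 P (fun _ => 0) a b
    simpa using this
  | insert i S hi ih =>
    simp only [Finset.sum_insert hi]
    rw [axisIntegral_add hab (hg i (Finset.mem_insert_self i S))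
      (HolOff.sum fun j hj => hg j (Finset.mem_insert_of_mem hj)),
      ih fun j hj => hg j (Finset.mem_insert_of_mem hj)]

theorem axisIntegral_swap (hab : Endpoints P a b) (hg : HolOff P g) :
    axisIntegral P g b a = - axisIntegral P g a b := by
  obtain ⟨δ, h⟩ := hab.exists_clear
  have h' : Clear P b a δ := h.sub right_mem_uIcc left_mem_uIcc h.right_notMem h.left_notMem
  rw [h.axisIntegral_eq hg, h'.axisIntegral_eq hg, avgBox, avgBox, sideBox_swap _ a b,
    sideBox_swap _ a b]
  ring

theorem axisIntegral_trans (hab : Endpoints P a b) (hbc : Endpoints P b c) (hg : HolOff P g) :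
    axisIntegral P g a b + axisIntegral P g b c = axisIntegral P g a c := by
  obtain ⟨δ, hδ, hgap⟩ := hab.locFin.exists_gap (max a (max b c))
    (lt_min hab.left_pos (lt_min hab.right_pos hbc.right_pos))
  have hclear : ∀ x y : ℝ, Endpoints P x y → x ∈ Icc (min a (min b c)) (max a (max b c)) →
      y ∈ Icc (min a (min b c)) (max a (max b c)) → Clear P x y δ := fun x y hxy hx hy =>
    ⟨hδ, hxy.left_pos, hxy.right_pos, hxy.left_notMem, hxy.right_notMem,
      fun p hp hi => hgap p hp (ordConnected_Icc.uIcc_subset hx hy hi)⟩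
  have ha : a ∈ Icc (min a (min b c)) (max a (max b c)) := by simp
  have hb : b ∈ Icc (min a (min b c)) (max a (max b c)) := by simp
  have hc : c ∈ Icc (min a (min b c)) (max a (max b c)) := by simp
  have h1 := hclear a b hab ha hb
  have h2 := hclear b c hbc hb hc
  have h3 := hclear a c (hab.trans hbc) ha hc
  have key : ∀ x, |x| = δ → sideBox x g a b + sideBox x g b c = sideBox x g a c := by
    intro x hx
    have e := intervalIntegral.integral_add_adjacent_intervals
      (intervalIntegrable_sides (hg.continuousOn h1 hx)).2.2
      (intervalIntegrable_sides (hg.continuousOn h2 hx)).2.2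
    simp only [sideBox]
    linear_combination I * e
  rw [h1.axisIntegral_eq hg, h2.axisIntegral_eq hg, h3.axisIntegral_eq hg, avgBox, avgBox, avgBox,
    ← key δ h1.abs_pos, ← key (-δ) h1.abs_neg]
  ring

theorem axisIntegral_mono (hab : Endpoints Q a b) (hPQ : P ⊆ Q) (hg : HolOff P g) :
    axisIntegral P g a b = axisIntegral Q g a b := by
  obtain ⟨δ, h⟩ := hab.exists_clear
  rw [h.axisIntegral_eq (hg.mono hPQ), (h.mono hPQ).axisIntegral_eq hg]

/-- If the singularities met above `y₀` are removable, both boxes collapse onto the axis by Cauchy's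
theorem for the extension `g'`. -/
theorem axisIntegral_eq_intervalIntegral (hab : Endpoints P a b) (hg : HolOff P g) {y₀ : ℝ}
    (ha : y₀ < a) (hb : y₀ < b) (hg' : ∀ τ : ℂ, y₀ < τ.im → DifferentiableAt ℂ g' τ)
    (h : ∀ τ : ℂ, 0 < τ.im → y₀ < τ.im → τ ∉ P → g τ = g' τ) :
    axisIntegral P g a b = I * ∫ y in a..b, g' (y * I) := by
  obtain ⟨δ, hδ⟩ := hab.exists_clear
  have hy : ∀ y ∈ uIcc a b, y₀ < y := fun y hy => (lt_min ha hb).trans_le hy.1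
  have key : ∀ x, |x| = δ → sideBox x g a b = I * ∫ y in a..b, g' (y * I) := by
    intro x hx
    rw [sideBox_congr (g' := g')]
    · have hrect := integral_boundary_rect_eq_zero_of_differentiableOn g' (a * I) (x + b * I) (by
        intro w hw
        have h2 : w.im ∈ uIcc a b := by simpa using hw.2
        exact (hg' w (hy _ h2)).differentiableWithinAt)
      simp only [add_re, ofReal_re, mul_re, I_re, mul_zero, ofReal_im, I_im, mul_one, sub_self,
        add_zero, add_im, mul_im, zero_add, smul_eq_mul, ofReal_zero] at hrect
      rw [sideBox]
      linear_combination hrect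
    · intro z hz
      obtain ⟨h1, h2⟩ := hδ.boxPath_notMem hx hz
      refine h z h1 ?_ h2
      rcases hz with ⟨_, h3 | h3⟩ | ⟨_, h3⟩
      · rwa [h3]
      · rwa [h3]
      · exact hy _ h3
  rw [hδ.axisIntegral_eq hg, avgBox, key _ hδ.abs_pos, key _ hδ.abs_neg]
  ring

end Calculus

/-! ### The inversion `τ ↦ -1/τ` -/

theorem neg_inv_im (z : ℂ) : (-z⁻¹).im = z.im / normSq z := by
  rw [neg_im, inv_im]; ring

theorem neg_inv_re (z : ℂ) : (-z⁻¹).re = -z.re / normSq z := by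
  rw [neg_re, inv_re]; ring

theorem neg_inv_mul_I (a : ℝ) : -((a : ℂ) * I)⁻¹ = (a⁻¹ : ℝ) * I := by
  rw [mul_inv, inv_I]; push_cast; ring

theorem HolOff.comp_neg_inv {P : Set ℂ} (hinv : ∀ p : ℂ, 0 < p.im → -p⁻¹ ∈ P → p ∈ P) {g : ℂ → ℂ}
    (hg : HolOff P g) : HolOff P fun w => g (-w⁻¹) * (w ^ 2)⁻¹ := by
  intro τ hτ hP
  have h0 : τ ≠ 0 := by rintro rfl; simp at hτ
  have h1 : 0 < (-τ⁻¹).im := by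
    rw [neg_inv_im]; exact div_pos hτ (normSq_pos.2 h0)
  have h2 := hg _ h1 fun h => hP (hinv τ hτ h)
  have h3 : DifferentiableAt ℂ (fun w : ℂ => -w⁻¹) τ := (differentiableAt_inv h0).neg
  exact (DifferentiableAt.comp (f := fun w : ℂ => -w⁻¹) τ h2 h3).mul
    (DifferentiableAt.inv (by fun_prop) (by positivity))

/-- Inversion maps a bump on the side `σ` to a contour on the side `-σ`, so the two terms of the
average change places. The factor `(w ^ 2)⁻¹` is the derivative of `-w⁻¹`. -/
theorem axisIntegral_inv {P : Set ℂ} (hinv : ∀ p : ℂ, 0 < p.im → -p⁻¹ ∈ P → p ∈ P) {g : ℂ → ℂ}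
    (hg : HolOff P g) {a b : ℝ} (hab : Endpoints P a b) :
    axisIntegral P g a⁻¹ b⁻¹ = axisIntegral P (fun w => g (-w⁻¹) * (w ^ 2)⁻¹) a b := by
  have ha := hab.left_pos
  have hb := hab.right_pos
  set m := min a b with hm
  set M := max a b with hM
  have hm0 : 0 < m := lt_min ha hb
  have hM0 : 0 < M := lt_max_of_lt_left ha
  obtain ⟨δ₁, h₁⟩ := hab.exists_clear
  obtain ⟨δ₂, hδ₂, hgap⟩ := hab.locFin.exists_gap (y₀ := m / (M ^ 2 + 1)) (m⁻¹) (by positivity)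
  -- At heights at least `m` inversion multiplies real parts by at most `m⁻²`, so the image has
  -- width at most `δ₂`. The bound `δ ≤ 1` gives `|w|² ≤ M² + 1`, which keeps the image above height
  -- `m / (M² + 1)`.
  set δ := min (min δ₁ (δ₂ * m ^ 2)) 1 with hδ
  have hδ0 : 0 < δ := lt_min (lt_min h₁.pos (by positivity)) one_pos
  have hδ1 : δ ≤ 1 := min_le_right _ _
  have hδ2 : δ ≤ δ₂ * m ^ 2 := (min_le_left _ _).trans (min_le_right _ _)
  have h : Clear P a b δ := h₁.anti hδ0 ((min_le_left _ _).trans (min_le_left _ _))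
  have key : ∀ σ : ℝ, σ = 1 ∨ σ = -1 →
      IsSideContour P (-σ) δ₂ ((a⁻¹ : ℝ) * I) ((b⁻¹ : ℝ) * I) (fun u => -(bump σ δ a b u)⁻¹) ∧
      contourIntegral g (fun u => -(bump σ δ a b u)⁻¹) =
        contourIntegral (fun w => g (-w⁻¹) * (w ^ 2)⁻¹) (bump σ δ a b) := by
    intro σ hσ
    have himm : ∀ u ∈ Icc (0 : ℝ) 1, m ≤ (bump σ δ a b u).im ∧ (bump σ δ a b u).im ≤ M :=
      fun u hu => bump_im_mem σ δ a b hu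
    have hpos : ∀ u ∈ Icc (0 : ℝ) 1, 0 < (bump σ δ a b u).im := fun u hu =>
      hm0.trans_le (himm u hu).1
    have hne : ∀ u ∈ Icc (0 : ℝ) 1, bump σ δ a b u ≠ 0 := fun u hu h0 => by
      have := hpos u hu
      rw [h0] at this
      simp at this
    have hd : ∀ u ∈ Icc (0 : ℝ) 1, HasDerivAt (fun u => -(bump σ δ a b u)⁻¹)
        ((((σ * δ * (1 - 2 * u) : ℝ) : ℂ) + ((b - a : ℝ) : ℂ) * I) / (bump σ δ a b u) ^ 2) u := by
      intro u hu
      have := ((hasDerivAt_bump σ δ a b u).fun_inv (hne u hu)).neg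
      refine this.congr_deriv ?_
      ring
    have hns : ∀ u ∈ Icc (0 : ℝ) 1, m ^ 2 ≤ normSq (bump σ δ a b u) ∧
        (bump σ δ a b u).im ^ 2 ≤ normSq (bump σ δ a b u) ∧
        normSq (bump σ δ a b u) ≤ M ^ 2 + 1 := by
      intro u hu
      have h1 := himm u hu
      have h2 := bump_abs_re hσ hδ0 a b hu
      rw [normSq_apply]
      have h3 : (bump σ δ a b u).re ^ 2 ≤ 1 := by
        rw [← sq_abs]
        nlinarith [_root_.abs_nonneg (bump σ δ a b u).re]
      refine ⟨?_, ?_, ?_⟩ <;> nlinarith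
    refine ⟨IsSideContour.of_gap (y₀ := m / (M ^ 2 + 1)) (y₁ := m⁻¹) (δ := δ₂) ?_ (by positivity)
      le_rfl hgap ?_ ?_ (fun u hu => (hd u hu).differentiableAt) ?_ ?_ ?_ ?_, ?_⟩
    · rcases hσ with rfl | rfl <;> simp
    · simp only [bump_zero]; exact neg_inv_mul_I a
    · simp only [bump_one]; exact neg_inv_mul_I b
    · refine ContinuousOn.intervalIntegrable ?_
      rw [uIcc_of_le zero_le_one]
      refine ContinuousOn.congr (f := fun u : ℝ =>
        (((σ * δ * (1 - 2 * u) : ℝ) : ℂ) + ((b - a : ℝ) : ℂ) * I) / (bump σ δ a b u) ^ 2) ?_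
        fun u hu => (hd u hu).deriv
      refine ContinuousOn.div (by fun_prop) (ContinuousOn.pow (fun u _ =>
        (hasDerivAt_bump σ δ a b u).continuousAt.continuousWithinAt) 2) fun u hu => ?_
      exact pow_ne_zero 2 (hne u hu)
    · intro u hu
      obtain ⟨n1, n2, n3⟩ := hns u hu
      have h1 := himm u hu
      have hn : 0 < normSq (bump σ δ a b u) := normSq_pos.2 (hne u hu)
      rw [neg_inv_im]
      constructor
      · exact div_le_div₀ (hpos u hu).le h1.1 hn n3
      · rw [div_le_iff₀ hn]
        rw [inv_mul_eq_div, le_div_iff₀ hm0]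
        nlinarith [hpos u hu]
    · intro u hu
      obtain ⟨n1, n2, n3⟩ := hns u hu
      have hn : 0 < normSq (bump σ δ a b u) := normSq_pos.2 (hne u hu)
      obtain ⟨r1, r2⟩ := bump_re_mem hσ hδ0 a b hu
      rw [neg_inv_re, show -σ * (-(bump σ δ a b u).re / normSq (bump σ δ a b u))
        = σ * (bump σ δ a b u).re / normSq (bump σ δ a b u) by ring]
      refine ⟨by positivity, ?_⟩
      rw [div_le_iff₀ hn]
      calc _ ≤ δ := r2
        _ ≤ δ₂ * m ^ 2 := hδ2
        _ ≤ _ := by gcongr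
    · intro u hu hP
      exact h.bump_notMem hσ hu (hinv _ (hpos u hu) hP)
    · rw [contourIntegral, contourIntegral]
      refine intervalIntegral.integral_congr fun u hu => ?_
      rw [uIcc_of_le zero_le_one] at hu
      rw [(hd u hu).deriv, (hasDerivAt_bump σ δ a b u).deriv]
      ring
  obtain ⟨hR, hRi⟩ := key (-1) (Or.inr rfl)
  obtain ⟨hL, hLi⟩ := key 1 (Or.inl rfl)
  rw [neg_neg] at hR
  rw [← average_contourIntegral hab.locFin hg hR hL,
    ← average_contourIntegral hab.locFin (hg.comp_neg_inv hinv)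
      (h.isSideContour_bump (Or.inl rfl) le_rfl) (h.isSideContour_bump (Or.inr rfl) le_rfl),
    hRi, hLi, add_comm]

/-! ### Mellin integrands -/

theorem div_I_mem_slitPlane {τ : ℂ} (hτ : 0 < τ.im) : τ / I ∈ slitPlane := by
  left
  simpa [div_I] using hτ

theorem differentiableAt_mellinIntegrand (s : ℂ) {h : ℂ → ℂ} {τ : ℂ} (hτ : 0 < τ.im)
    (hh : DifferentiableAt ℂ h τ) : DifferentiableAt ℂ (mellinIntegrand s h) τ := by
  have h0 : τ ≠ 0 := by rintro rfl; simp at hτ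
  exact (((differentiableAt_id.div_const I).cpow_const (div_I_mem_slitPlane hτ)).mul hh).div
    differentiableAt_id h0

theorem HolOff.mellinIntegrand {P : Set ℂ} {h : ℂ → ℂ} (hh : HolOff P h) (s : ℂ) :
    HolOff P (mellinIntegrand s h) := fun τ h1 h2 =>
  differentiableAt_mellinIntegrand s h1 (hh τ h1 h2)

theorem mellinIntegrand_mul_I (s : ℂ) (h : ℂ → ℂ) {t : ℝ} (ht : 0 < t) :
    MeroL.mellinIntegrand s h (t * I) = I⁻¹ * ((t : ℂ) ^ (s - 1) * h (t * I)) := by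
  have h0 : (t : ℂ) ≠ 0 := by exact_mod_cast ht.ne'
  rw [MeroL.mellinIntegrand, mul_div_cancel_right₀ _ I_ne_zero, cpow_sub _ _ h0, cpow_one]
  field_simp

theorem I_mul_integral_mellinIntegrand (s : ℂ) (h : ℂ → ℂ) {a b : ℝ} (ha : 0 < a) (hb : 0 < b) :
    I * ∫ t in a..b, MeroL.mellinIntegrand s h (t * I) =
      ∫ t in a..b, (t : ℂ) ^ (s - 1) * h (t * I) := by
  rw [intervalIntegral.integral_congr
    (g := fun t : ℝ => I⁻¹ * ((t : ℂ) ^ (s - 1) * h (t * I)))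
    (fun t ht => mellinIntegrand_mul_I s h ((lt_min ha hb).trans_le ht.1)),
    intervalIntegral.integral_const_mul, ← mul_assoc, mul_inv_cancel₀ I_ne_zero, one_mul]

theorem neg_inv_div_I (w : ℂ) : -w⁻¹ / I = (w / I)⁻¹ := by
  rw [div_I, inv_div]
  rw [div_eq_mul_inv]; ring

/-- As `w/i` lies in the right half-plane, its principal powers respect inversion. Writing `w ^ k =
i ^ k (w/i) ^ k` turns the exponent `-s` into `k - s`; the minus sign is that of `dτ/τ = -dw/w` for
`τ = -1/w`. -/
theorem mellinIntegrand_neg_inv (s : ℂ) {h : ℂ → ℂ} {k : ℤ} {w : ℂ} (hw : 0 < w.im)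
    (hh : h (-w⁻¹) = w ^ k * h w) :
    MeroL.mellinIntegrand s h (-w⁻¹) * (w ^ 2)⁻¹ =
      -(I ^ k) * MeroL.mellinIntegrand ((k : ℂ) - s) h w := by
  have h0 : w ≠ 0 := by rintro rfl; simp at hw
  have h1 := div_I_mem_slitPlane hw
  have h2 : w / I ≠ 0 := slitPlane_ne_zero h1
  have h3 : w ^ k = I ^ k * (w / I) ^ k := by
    rw [← mul_zpow, mul_div_cancel₀ _ I_ne_zero]
  rw [MeroL.mellinIntegrand, MeroL.mellinIntegrand, hh, neg_inv_div_I,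
    inv_cpow _ _ (slitPlane_arg_ne_pi h1), cpow_sub _ _ h2, cpow_intCast, h3]
  have h4 : (w / I) ^ s ≠ 0 := fun h => h2 ((cpow_eq_zero_iff _ _).1 h).1
  field_simp

theorem axisIntegral_mellin_inv {P : Set ℂ} (hinv : ∀ p : ℂ, 0 < p.im → -p⁻¹ ∈ P → p ∈ P)
    {h : ℂ → ℂ} (hh : HolOff P h) {k : ℤ}
    (hk : ∀ w : ℂ, 0 < w.im → w ∉ P → h (-w⁻¹) = w ^ k * h w) (s : ℂ) {a b : ℝ}
    (hab : Endpoints P a b) :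
    axisIntegral P (MeroL.mellinIntegrand s h) a⁻¹ b⁻¹ =
      -(I ^ k) * axisIntegral P (MeroL.mellinIntegrand ((k : ℂ) - s) h) a b := by
  rw [axisIntegral_inv hinv (hh.mellinIntegrand s) hab, ← axisIntegral_const_mul]
  exact axisIntegral_congr hab fun τ h1 h2 => mellinIntegrand_neg_inv s h1 (hk τ h1 h2)

/-! ### Dependence on the parameter `s` -/

/-- Differentiation under the integral sign; the derivative in `s` is bounded on a compact ball
times the interval. -/
theorem differentiable_integral_cpow {φ ℓ : ℝ → ℂ} {a b : ℝ} (hφ : ContinuousOn φ (uIcc a b))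
    (hℓ : ContinuousOn ℓ (uIcc a b)) (hs : ∀ x ∈ uIcc a b, ℓ x ∈ slitPlane) :
    Differentiable ℂ fun s : ℂ => ∫ x in a..b, ℓ x ^ s * φ x := by
  intro s₀
  have hlog : ContinuousOn (fun x => log (ℓ x)) (uIcc a b) := hℓ.clog hs
  have hF : ∀ s : ℂ, ContinuousOn (fun x => ℓ x ^ s * φ x) (uIcc a b) := fun s =>
    (hℓ.cpow_const hs).mul hφ
  have hF' : ContinuousOn (fun q : ℂ × ℝ => ℓ q.2 ^ q.1 * log (ℓ q.2) * φ q.2)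
      (Metric.closedBall s₀ 1 ×ˢ uIcc a b) := by
    have h2 : ContinuousOn (fun q : ℂ × ℝ => ℓ q.2) (Metric.closedBall s₀ 1 ×ˢ uIcc a b) :=
      hℓ.comp continuousOn_snd fun q hq => hq.2
    refine ((h2.cpow continuousOn_fst fun q hq => hs _ hq.2).mul
      (h2.clog fun q hq => hs _ hq.2)).mul ?_
    exact hφ.comp continuousOn_snd fun q hq => hq.2
  obtain ⟨C, hC⟩ := ((isCompact_closedBall s₀ 1).prod isCompact_uIcc).exists_bound_of_continuousOn hF'
  have key := intervalIntegral.hasDerivAt_integral_of_dominated_loc_of_deriv_le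
    (μ := volume) (a := a) (b := b) (F := fun (s : ℂ) (x : ℝ) => ℓ x ^ s * φ x)
    (F' := fun (s : ℂ) (x : ℝ) => ℓ x ^ s * log (ℓ x) * φ x) (x₀ := s₀) (bound := fun _ => C)
    (s := Metric.ball s₀ 1) (Metric.ball_mem_nhds s₀ one_pos)
    (Eventually.of_forall fun s =>
      ((hF s).mono uIoc_subset_uIcc).aestronglyMeasurable measurableSet_uIoc)
    (hF s₀).intervalIntegrable
    ((hF'.comp (f := fun x : ℝ => (s₀, x)) (by fun_prop) fun x hx =>
      ⟨by simp, uIoc_subset_uIcc hx⟩).aestronglyMeasurable measurableSet_uIoc)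
    (Eventually.of_forall fun x hx s hs' =>
      hC (s, x) ⟨Metric.ball_subset_closedBall hs', uIoc_subset_uIcc hx⟩)
    intervalIntegrable_const
    (Eventually.of_forall fun x hx s _ => by
      have := (hasDerivAt_id s).const_cpow (c := ℓ x)
        (Or.inl (slitPlane_ne_zero (hs x (uIoc_subset_uIcc hx))))
      simpa using this.mul_const (φ x))
  exact key.2.differentiableAt

theorem differentiable_sideBox_mellin {h : ℂ → ℂ} {x₀ a b : ℝ}
    (hpos : ∀ z ∈ boxPath x₀ a b, 0 < z.im) (hh : ContinuousOn h (boxPath x₀ a b)) :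
    Differentiable ℂ fun s => sideBox x₀ (MeroL.mellinIntegrand s h) a b := by
  have hφ : ContinuousOn (fun z => h z / z) (boxPath x₀ a b) :=
    hh.div continuousOn_id fun z hz h0 => by
      have := hpos z hz
      rw [show z = 0 from h0] at this
      simp at this
  have main : ∀ (p : ℝ → ℂ) (u v : ℝ), Continuous p → (∀ x ∈ uIcc u v, p x ∈ boxPath x₀ a b) →
      Differentiable ℂ fun s => ∫ x in u..v, MeroL.mellinIntegrand s h (p x) := by
    intro p u v hp hmem
    have := differentiable_integral_cpow (φ := fun x => h (p x) / p x) (ℓ := fun x => p x / I)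
      (a := u) (b := v) (hφ.comp hp.continuousOn hmem) (by fun_prop)
      (fun x hx => div_I_mem_slitPlane (hpos _ (hmem x hx)))
    simpa only [MeroL.mellinIntegrand, mul_div_assoc] using this
  have h1 := main (fun x => x + a * I) 0 x₀ (by fun_prop) fun x hx => boxPath_left hx
  have h2 := main (fun x => x + b * I) 0 x₀ (by fun_prop) fun x hx => boxPath_right hx
  have h3 := main (fun y => x₀ + y * I) a b (by fun_prop) fun x hx => boxPath_vert hx
  exact (h1.add (h3.const_mul I)).sub h2

theorem differentiable_axisIntegral_mellin {P : Set ℂ} {h : ℂ → ℂ} (hh : HolOff P h) (a b : ℝ) :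
    Differentiable ℂ fun s => axisIntegral P (MeroL.mellinIntegrand s h) a b := by
  by_cases hex : ∃ δ, Clear P a b δ
  · simp only [axisIntegral, dif_pos hex, avgBox]
    have hδ := hex.choose_spec
    exact ((differentiable_sideBox_mellin (fun z hz => (hδ.boxPath_notMem hδ.abs_pos hz).1)
      (hh.continuousOn hδ hδ.abs_pos)).add
      (differentiable_sideBox_mellin (fun z hz => (hδ.boxPath_notMem hδ.abs_neg hz).1)
      (hh.continuousOn hδ hδ.abs_neg))).const_mul (1 / 2)
  · simp only [axisIntegral, dif_neg hex]
    exact differentiable_const 0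

/-! ### Integrals to `i∞` of functions of exponential decay -/

/-- Holomorphic off the locally finite set `P` of bounded height, and exponentially decaying. -/
structure Decaying (P : Set ℂ) (h : ℂ → ℂ) : Prop where
  locFin : LocFin P
  holOff : HolOff P h
  decay : ∃ T C : ℝ, 0 < T ∧ (∀ p ∈ P, p.im ≤ T) ∧
    ∀ τ : ℂ, T < τ.im → ‖h τ‖ ≤ C * Real.exp (-(2 * Real.pi) * τ.im)

/-- The averaged integral of `(τ/i)^s h(τ) dτ/τ` from `ia` to `i∞`. -/
def upperIntegral (P : Set ℂ) (h : ℂ → ℂ) (a : ℝ) (s : ℂ) : ℂ :=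
  limUnder atTop fun Λ : ℝ => axisIntegral P (mellinIntegrand s h) a Λ

/-- The truncation of `t ↦ h(it)` to `t > T` has a Mellin transform at every `s`, entire in `s`. -/
theorem mellin_truncated {h : ℂ → ℂ} {T C : ℝ} (hT : 0 < T)
    (hc : ∀ t : ℝ, T ≤ t → ContinuousAt h (t * I))
    (hd : ∀ t : ℝ, T ≤ t → ‖h (t * I)‖ ≤ C * Real.exp (-(2 * Real.pi) * t)) :
    (∀ s : ℂ, IntegrableOn (fun t : ℝ => (t : ℂ) ^ (s - 1) * h (t * I)) (Ioi T)) ∧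
    Differentiable ℂ fun s : ℂ => ∫ t in Ioi T, (t : ℂ) ^ (s - 1) * h (t * I) := by
  set F : ℝ → ℂ := (Ioi T).indicator fun t : ℝ => h (t * I) with hF
  have hcont : ContinuousOn (fun t : ℝ => h (t * I)) (Ici T) := fun t ht =>
    (ContinuousAt.comp (f := fun t : ℝ => (t * I : ℂ)) (hc t ht)
      (by fun_prop)).continuousWithinAt
  have hF0 : ∀ t, ¬ T < t → F t = 0 := fun t ht => indicator_of_notMem (by simpa using ht) _
  have hF1 : ∀ t, T < t → F t = h (t * I) := fun t ht => indicator_of_mem (mem_Ioi.2 ht) _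
  have hloc : LocallyIntegrableOn F (Ioi 0) := by
    refine LocallyIntegrable.locallyIntegrableOn ?_ _
    have h1 : LocallyIntegrableOn (fun t : ℝ => h (t * I)) (Ici T) :=
      hcont.locallyIntegrableOn measurableSet_Ici
    intro x
    have h2 : IntegrableOn (fun t : ℝ => h (t * I)) (Icc T (max T (x + 1))) :=
      (hcont.mono Icc_subset_Ici_self).integrableOn_compact isCompact_Icc
    refine ⟨Iio (x + 1), Iio_mem_nhds (by linarith), ?_⟩
    rw [hF, IntegrableOn, integrable_indicator_iff measurableSet_Ioi, IntegrableOn,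
      Measure.restrict_restrict measurableSet_Ioi]
    refine h2.mono_set ?_
    rintro t ⟨ht1, ht2⟩
    exact ⟨le_of_lt ht1, le_max_of_le_right (le_of_lt ht2)⟩
  have htop : F =O[atTop] fun t : ℝ => Real.exp (-(2 * Real.pi) * t) := by
    refine Asymptotics.IsBigO.of_bound C ?_
    filter_upwards [eventually_gt_atTop T] with t ht
    rw [hF1 t ht, Real.norm_of_nonneg (Real.exp_pos _).le]
    exact hd t ht.le
  -- The truncation vanishes near `0`, so every exponent is allowed there and the Mellin transform
  -- has no abscissa of convergence.
  have hbot : ∀ b : ℝ, F =O[𝓝[>] 0] fun t : ℝ => t ^ (-b) := by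
    intro b
    refine Asymptotics.IsBigO.of_bound 0 ?_
    filter_upwards [mem_nhdsWithin_of_mem_nhds (Iio_mem_nhds hT)] with t ht
    rw [hF0 t (not_lt.2 (le_of_lt ht))]
    simp
  have hpi : 0 < 2 * Real.pi := by positivity
  have heq : ∀ s : ℂ, (fun t : ℝ => (t : ℂ) ^ (s - 1) • F t)
      = (Ioi T).indicator fun t : ℝ => (t : ℂ) ^ (s - 1) * h (t * I) := by
    intro s
    ext t
    by_cases ht : T < t
    · rw [hF1 t ht, indicator_of_mem (mem_Ioi.2 ht), smul_eq_mul]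
    · rw [hF0 t ht, indicator_of_notMem (by simpa using ht), smul_zero]
  have hsub : Ioi 0 ∩ Ioi T = Ioi T := inter_eq_right.2 (Ioi_subset_Ioi hT.le)
  refine ⟨fun s => ?_, fun s => ?_⟩
  · have := mellinConvergent_of_isBigO_rpow_exp hpi hloc htop (hbot (s.re - 1)) (by linarith)
    rw [MellinConvergent, heq, IntegrableOn, integrable_indicator_iff measurableSet_Ioi,
      IntegrableOn, Measure.restrict_restrict measurableSet_Ioi, inter_comm, hsub] at this
    exact this
  · have := mellin_differentiableAt_of_isBigO_rpow_exp hpi hloc htop (hbot (s.re - 1))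
      (by linarith)
    have hm : mellin F = fun s : ℂ => ∫ t in Ioi T, (t : ℂ) ^ (s - 1) * h (t * I) := by
      ext s
      rw [mellin, heq, setIntegral_indicator measurableSet_Ioi, hsub]
    rwa [hm] at this

/-- Cut at a height above all of `P`: below it is an averaged integral between fixed endpoints,
above it an ordinary truncated Mellin integral. Both are entire in `s`, and the same formula proves
convergence. -/
theorem Decaying.exists_formula {P : Set ℂ} {h : ℂ → ℂ} (hh : Decaying P h) {a : ℝ} (ha : 0 < a)
    (haP : (a * I : ℂ) ∉ P) :
    ∃ T, 0 < T ∧ ∃ R : ℂ → ℂ, Differentiable ℂ R ∧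
      (∀ T' : ℝ, T ≤ T' → (T' * I : ℂ) ∉ P) ∧ ∀ s : ℂ,
      Tendsto (fun Λ : ℝ => axisIntegral P (mellinIntegrand s h) a Λ) atTop
        (𝓝 (axisIntegral P (mellinIntegrand s h) a T + R s)) := by
  obtain ⟨T, C, hT, hPT, hd⟩ := hh.decay
  have hnot : ∀ T' : ℝ, T + 1 ≤ T' → (T' * I : ℂ) ∉ P := by
    intro T' hT' hP
    have := hPT _ hP
    simp at this
    linarith
  have hdiff : ∀ τ : ℂ, T < τ.im → DifferentiableAt ℂ h τ := fun τ hτ =>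
    hh.holOff τ (hT.trans hτ) fun hP => absurd (hPT τ hP) (not_le.2 hτ)
  obtain ⟨hint, hent⟩ := mellin_truncated (h := h) (T := T + 1) (C := C) (by linarith)
    (fun t ht => (hdiff _ (by simp; linarith)).continuousAt)
    (fun t ht => by simpa using hd (t * I) (by simp; linarith))
  refine ⟨T + 1, by linarith, _, hent, hnot, fun s => ?_⟩
  have hlim := intervalIntegral_tendsto_integral_Ioi (T + 1) (hint s) tendsto_id
  refine (hlim.const_add (axisIntegral P (mellinIntegrand s h) a (T + 1))).congr' ?_
  filter_upwards [eventually_ge_atTop (T + 1)] with Λ hΛ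
  have e1 : Endpoints P a (T + 1) := ⟨hh.locFin, ha, by linarith, haP, by
    simpa using hnot (T + 1) le_rfl⟩
  have e2 : Endpoints P (T + 1) Λ := ⟨hh.locFin, by linarith, by linarith, by
    simpa using hnot (T + 1) le_rfl, hnot Λ hΛ⟩
  have hm := hh.holOff.mellinIntegrand s
  rw [← axisIntegral_trans e1 e2 hm]
  congr 1
  rw [axisIntegral_eq_intervalIntegral (g' := mellinIntegrand s h) (y₀ := T) e2 hm (by linarith)
    (by linarith) (fun τ hτ => differentiableAt_mellinIntegrand s (hT.trans hτ) (hdiff τ hτ))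
    (fun _ _ _ _ => rfl), I_mul_integral_mellinIntegrand s h (by linarith) (by linarith), id]

theorem Decaying.tendsto {P : Set ℂ} {h : ℂ → ℂ} (hh : Decaying P h) {a : ℝ} (ha : 0 < a)
    (haP : (a * I : ℂ) ∉ P) (s : ℂ) :
    Tendsto (fun Λ : ℝ => axisIntegral P (mellinIntegrand s h) a Λ) atTop
      (𝓝 (upperIntegral P h a s)) := by
  obtain ⟨T, hT, R, -, -, hR⟩ := hh.exists_formula ha haP
  rw [upperIntegral, (hR s).limUnder_eq]
  exact hR s

theorem Decaying.differentiable_upperIntegral {P : Set ℂ} {h : ℂ → ℂ} (hh : Decaying P h) {a : ℝ}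
    (ha : 0 < a) (haP : (a * I : ℂ) ∉ P) : Differentiable ℂ (upperIntegral P h a) := by
  obtain ⟨T, hT, R, hRd, -, hR⟩ := hh.exists_formula ha haP
  have : upperIntegral P h a = fun s => axisIntegral P (mellinIntegrand s h) a T + R s :=
    funext fun s => (hR s).limUnder_eq
  rw [this]
  exact (differentiable_axisIntegral_mellin hh.holOff a T).add hRd

theorem Decaying.eventually_notMem {P : Set ℂ} {h : ℂ → ℂ} (hh : Decaying P h) :
    ∀ᶠ Λ : ℝ in atTop, (Λ * I : ℂ) ∉ P := by
  obtain ⟨T, -, -, hPT, -⟩ := hh.decay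
  filter_upwards [eventually_gt_atTop T] with Λ hΛ hP
  have := hPT _ hP
  simp at this
  linarith

theorem Decaying.eventually_endpoints {P : Set ℂ} {h : ℂ → ℂ} (hh : Decaying P h) {a : ℝ}
    (ha : 0 < a) (haP : (a * I : ℂ) ∉ P) : ∀ᶠ Λ : ℝ in atTop, Endpoints P a Λ := by
  filter_upwards [hh.eventually_notMem, eventually_gt_atTop 0] with Λ h1 h2
  exact ⟨hh.locFin, ha, h2, haP, h1⟩

theorem Decaying.hasRegIntegral {P : Set ℂ} {h : ℂ → ℂ} (hh : Decaying P h) {a : ℝ} (ha : 0 < a)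
    (haP : (a * I : ℂ) ∉ P) (s : ℂ) :
    HasRegIntegral P (mellinIntegrand s h) (fun _ => I * a) (upperIntegral P h a s) :=
  hasRegIntegral_of_tendsto hh.locFin (hh.holOff.mellinIntegrand s) (α := fun _ => a)
    (Eventually.of_forall fun _ => ⟨mul_comm _ _, ha, haP⟩) hh.eventually_notMem
    (hh.tendsto ha haP s)

/-! ### Meromorphic modular forms: poles and the transformation law -/

theorem isOpen_im_pos : IsOpen {τ : ℂ | 0 < τ.im} := isOpen_lt continuous_const continuous_im

section Meromorphic

variable {f : ℂ → ℂ}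

theorem analyticAt_of_notMem_poles (hf : MeromorphicNFOn f {τ : ℂ | 0 < τ.im}) {τ : ℂ}
    (hτ : 0 < τ.im) (hP : τ ∉ poles f) : AnalyticAt ℂ f τ :=
  (hf hτ).meromorphicOrderAt_nonneg_iff_analyticAt.1 (not_lt.1 fun h => hP ⟨hτ, h⟩)

theorem holOff_poles (hf : MeromorphicNFOn f {τ : ℂ | 0 < τ.im}) : HolOff (poles f) f :=
  fun _ h1 h2 => (analyticAt_of_notMem_poles hf h1 h2).differentiableAt

theorem eventually_notMem_poles (hf : MeromorphicNFOn f {τ : ℂ | 0 < τ.im}) {z : ℂ}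
    (hz : 0 < z.im) : ∀ᶠ τ in 𝓝[≠] z, τ ∉ poles f := by
  filter_upwards [(hf hz).meromorphicAt.eventually_analyticAt] with τ hτ hP
  exact absurd hP.2 (not_lt.2 hτ.meromorphicOrderAt_nonneg)

theorem isCompact_box (X y₀ y₁ : ℝ) :
    IsCompact {p : ℂ | |p.re| ≤ X ∧ y₀ ≤ p.im ∧ p.im ≤ y₁} := by
  have := (isCompact_Icc (a := -X) (b := X)).reProdIm (isCompact_Icc (a := y₀) (b := y₁))
  convert! this using 1
  ext p
  simp [mem_reProdIm, abs_le]

/-- Infinitely many poles in a compact box would accumulate in the upper half-plane, where the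
singularities of `f` are isolated. -/
theorem locFin_poles (hf : MeromorphicNFOn f {τ : ℂ | 0 < τ.im}) : LocFin (poles f) := by
  intro X y₀ y₁ hy
  by_contra hinf
  obtain ⟨z, hz, hacc⟩ := Set.Infinite.exists_accPt_of_subset_isCompact hinf
    (isCompact_box X y₀ y₁) fun p hp => hp.2
  rw [accPt_iff_frequently_nhdsNE] at hacc
  refine hacc ?_
  filter_upwards [eventually_notMem_poles hf (hy.trans_le hz.2.1)] with τ h1 h2
  exact h1 h2.1

/-- At a pole `|f|` tends to infinity, which contradicts the bound near the cusp. -/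
theorem exists_im_le_of_mem_poles (hf : MeromorphicNFOn f {τ : ℂ | 0 < τ.im})
    (hcusp : IsRegularAtCusp f) : ∃ T > 0, ∃ C, (∀ p ∈ poles f, p.im ≤ T) ∧
      ∀ τ : ℂ, T < τ.im → ‖f τ‖ ≤ C := by
  obtain ⟨C, T, hCT⟩ := hcusp
  refine ⟨max T 1, by positivity, C, fun p hp => ?_, fun τ hτ =>
    hCT τ ((le_max_left _ _).trans_lt hτ)⟩
  by_contra! hlt
  have hT := (le_max_left T 1).trans_lt hlt
  have h1 := (tendsto_cobounded_iff_meromorphicOrderAt_neg (hf hp.1).meromorphicAt).2 hp.2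
  rw [← tendsto_norm_atTop_iff_cobounded] at h1
  have h2 := h1.eventually_gt_atTop C
  have h3 : ∀ᶠ τ : ℂ in 𝓝[≠] p, T < τ.im :=
    mem_nhdsWithin_of_mem_nhds (continuous_im.continuousAt.eventually (lt_mem_nhds hT))
  obtain ⟨τ, h4, h5⟩ := (h2.and h3).exists
  exact absurd (hCT τ h5) (not_le.2 h4)

end Meromorphic

/-- The Möbius transformation of an integral matrix, as a function on `ℂ`. -/
def mobius (M : SL(2, ℤ)) (z : ℂ) : ℂ :=
  ((M 0 0 : ℂ) * z + (M 0 1 : ℂ)) / ((M 1 0 : ℂ) * z + (M 1 1 : ℂ))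

theorem coe_smul_eq_mobius (M : SL(2, ℤ)) (τ : ℍ) : ((M • τ : ℍ) : ℂ) = mobius M τ := by
  rw [UpperHalfPlane.coe_specialLinearGroup_apply]
  simp [mobius]

theorem mobius_denom_ne_zero (M : SL(2, ℤ)) {z : ℂ} (hz : 0 < z.im) :
    (M 1 0 : ℂ) * z + (M 1 1 : ℂ) ≠ 0 :=
  UpperHalfPlane.denom_ne_zero (M : GL (Fin 2) ℝ) ⟨z, hz⟩

theorem mobius_im_pos (M : SL(2, ℤ)) {z : ℂ} (hz : 0 < z.im) : 0 < (mobius M z).im := by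
  have := (M • (⟨z, hz⟩ : ℍ)).im_pos
  rwa [← UpperHalfPlane.coe_im, coe_smul_eq_mobius] at this

theorem hasDerivAt_mobius (M : SL(2, ℤ)) {z : ℂ} (hz : 0 < z.im) :
    HasDerivAt (mobius M) (((M 1 0 : ℂ) * z + (M 1 1 : ℂ)) ^ 2)⁻¹ z := by
  have h0 := mobius_denom_ne_zero M hz
  have hdet : (M 0 0 : ℂ) * M 1 1 - (M 0 1 : ℂ) * M 1 0 = 1 := by
    have := M.det_coe
    rw [Matrix.det_fin_two] at this
    exact_mod_cast this
  have h1 : HasDerivAt (fun z : ℂ => (M 0 0 : ℂ) * z + (M 0 1 : ℂ)) (M 0 0 : ℂ) z := by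
    simpa using ((hasDerivAt_id z).const_mul (M 0 0 : ℂ)).add_const (M 0 1 : ℂ)
  have h2 : HasDerivAt (fun z : ℂ => (M 1 0 : ℂ) * z + (M 1 1 : ℂ)) (M 1 0 : ℂ) z := by
    simpa using ((hasDerivAt_id z).const_mul (M 1 0 : ℂ)).add_const (M 1 1 : ℂ)
  refine (h1.fun_div h2 h0).congr_deriv ?_
  rw [show (M 0 0 : ℂ) * ((M 1 0 : ℂ) * z + (M 1 1 : ℂ)) -
    ((M 0 0 : ℂ) * z + (M 0 1 : ℂ)) * (M 1 0 : ℂ) = 1 by linear_combination hdet, one_div]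

theorem analyticAt_mobius (M : SL(2, ℤ)) {z : ℂ} (hz : 0 < z.im) : AnalyticAt ℂ (mobius M) z := by
  have h0 := mobius_denom_ne_zero M hz
  exact AnalyticAt.div (by fun_prop) (by fun_prop) h0

theorem slash_mobius {k : ℤ} (f : ModularForm 𝒮ℒ k) (M : SL(2, ℤ)) (τ : ℍ) :
    f (M • τ) = ((M 1 0 : ℂ) * τ + (M 1 1 : ℂ)) ^ k * f τ := by
  have : f (Matrix.SpecialLinearGroup.mapGL ℝ M • τ) =
      ((M 1 0 : ℂ) * τ + (M 1 1 : ℂ)) ^ k * f τ := by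
    simpa using SlashInvariantForm.slash_action_eqn' f
      (γ := Matrix.SpecialLinearGroup.mapGL ℝ M) (MonoidHom.mem_range.2 ⟨M, rfl⟩) τ
  exact this

/-! ### Transformation law, invariance of the pole set, heights of poles -/

namespace IsMeromorphicModularForm

variable {k : ℤ} {f : ℂ → ℂ}

/-- The quotient formula is available only where `f₂` does not vanish, which the identity theorem
guarantees on a punctured neighbourhood. That suffices to compare orders and then, by continuity,
values. -/
theorem eventually_mobius (hf : IsMeromorphicModularForm k f) (M : SL(2, ℤ)) {z : ℂ}
    (hz : 0 < z.im) :
    ∀ᶠ w in 𝓝[≠] z, f (mobius M w) = ((M 1 0 : ℂ) * w + (M 1 1 : ℂ)) ^ k * f w := by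
  obtain ⟨-, k₁, k₂, f₁, f₂, hf₂, rfl, hq⟩ := hf
  have hne : ∀ᶠ τ : ℍ in 𝓝[≠] (⟨z, hz⟩ : ℍ), f₂ τ ≠ 0 := by
    by_contra h
    refine hf₂ (DFunLike.coe_injective ?_)
    exact UpperHalfPlane.eq_zero_of_frequently f₂.holo' (τ := ⟨z, hz⟩) h
  have hne' : ∀ᶠ w : ℂ in 𝓝[≠] z, ∀ hw : 0 < w.im, f₂ ⟨w, hw⟩ ≠ 0 := by
    rw [eventually_nhdsWithin_iff] at hne ⊢
    have h1 : Tendsto UpperHalfPlane.ofComplex (𝓝 z) (𝓝 (⟨z, hz⟩ : ℍ)) := by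
      have := UpperHalfPlane.isOpenEmbedding_coe.map_nhds_eq ⟨z, hz⟩
      rw [show ((⟨z, hz⟩ : ℍ) : ℂ) = z from rfl] at this
      rw [← this, tendsto_map'_iff]
      refine tendsto_id.congr fun τ => ?_
      simp
    filter_upwards [h1.eventually hne] with w h2 hwz hw
    rw [UpperHalfPlane.ofComplex_apply_of_im_pos hw] at h2
    refine h2 fun h => hwz ?_
    exact congrArg UpperHalfPlane.coe h
  filter_upwards [hne', mem_nhdsWithin_of_mem_nhds (isOpen_im_pos.mem_nhds hz)] with w h1 h2
  have h3 := h1 h2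
  set τ : ℍ := ⟨w, h2⟩ with hτ
  have hw : (τ : ℂ) = w := rfl
  have hd := mobius_denom_ne_zero M h2
  have h4 := slash_mobius f₂ M τ
  have h5 : f₂ (M • τ) ≠ 0 := by
    rw [h4]; exact mul_ne_zero (zpow_ne_zero _ hd) h3
  have e1 := hq τ h3
  have e2 := hq (M • τ) h5
  rw [coe_smul_eq_mobius, h4, slash_mobius f₁] at e2
  rw [hw] at e1 e2
  rw [e1, e2, zpow_sub₀ hd]
  field_simp

/-- Orders are preserved because a Möbius map has nonzero derivative and the automorphy factor is
analytic without zeros. -/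
theorem mobius_mem_poles_iff (hf : IsMeromorphicModularForm k f) (M : SL(2, ℤ)) {z : ℂ}
    (hz : 0 < z.im) : mobius M z ∈ poles f ↔ z ∈ poles f := by
  have hd := mobius_denom_ne_zero M hz
  have h0 : meromorphicOrderAt (f ∘ mobius M) z =
      meromorphicOrderAt ((fun w => ((M 1 0 : ℂ) * w + (M 1 1 : ℂ)) ^ k) * f) z :=
    meromorphicOrderAt_congr (hf.eventually_mobius M hz)
  have h1 : meromorphicOrderAt f (mobius M z) = meromorphicOrderAt f z := by
    rw [← meromorphicOrderAt_comp_of_deriv_ne_zero (analyticAt_mobius M hz)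
      (by rw [(hasDerivAt_mobius M hz).deriv]; positivity), h0]
    have h2 : AnalyticAt ℂ (fun w : ℂ => ((M 1 0 : ℂ) * w + (M 1 1 : ℂ)) ^ k) z :=
      AnalyticAt.zpow (by fun_prop) hd
    rw [meromorphicOrderAt_mul h2.meromorphicAt (hf.1 hz).meromorphicAt,
      (tendsto_ne_zero_iff_meromorphicOrderAt_eq_zero h2.meromorphicAt).1
        ⟨_, zpow_ne_zero k hd, h2.continuousAt.continuousWithinAt⟩, zero_add]
  simp only [poles, mem_ofPred_eq, h1, hz, mobius_im_pos M hz]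

theorem mobius_eq (hf : IsMeromorphicModularForm k f) (M : SL(2, ℤ)) {z : ℂ}
    (hz : 0 < z.im) (hP : z ∉ poles f) :
    f (mobius M z) = ((M 1 0 : ℂ) * z + (M 1 1 : ℂ)) ^ k * f z := by
  have hd := mobius_denom_ne_zero M hz
  have h1 : ContinuousAt (fun w => f (mobius M w)) z :=
    ContinuousAt.comp (analyticAt_of_notMem_poles hf.1 (mobius_im_pos M hz)
      fun h => hP ((hf.mobius_mem_poles_iff M hz).1 h)).continuousAt
      (analyticAt_mobius M hz).continuousAt
  have h2 : ContinuousAt (fun w => ((M 1 0 : ℂ) * w + (M 1 1 : ℂ)) ^ k * f w) z :=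
    ((show ContinuousAt (fun w : ℂ => (M 1 0 : ℂ) * w + (M 1 1 : ℂ)) z by fun_prop).zpow₀ k
      (Or.inl hd)).mul
      (analyticAt_of_notMem_poles hf.1 hz hP).continuousAt
  exact tendsto_nhds_unique_of_eventuallyEq (h1.tendsto.mono_left nhdsWithin_le_nhds)
    (h2.tendsto.mono_left nhdsWithin_le_nhds) (hf.eventually_mobius M hz)

theorem mobius_T (z : ℂ) : mobius ModularGroup.T z = z + 1 := by
  simp [mobius, ModularGroup.T]

theorem mobius_S (z : ℂ) : mobius ModularGroup.S z = -z⁻¹ := by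
  simp [mobius, ModularGroup.S, neg_div]

theorem add_one_mem_poles_iff (hf : IsMeromorphicModularForm k f) {z : ℂ} :
    z + 1 ∈ poles f ↔ z ∈ poles f := by
  by_cases hz : 0 < z.im
  · simpa [mobius_T] using hf.mobius_mem_poles_iff ModularGroup.T hz
  · simp [poles, hz]

theorem add_int_mem_poles_iff (hf : IsMeromorphicModularForm k f) {z : ℂ} (n : ℤ) :
    z + n ∈ poles f ↔ z ∈ poles f := by
  induction n using Int.induction_on with
  | zero => simp
  | succ n ih => rw [← ih, ← hf.add_one_mem_poles_iff (z := z + (n : ℤ))]; push_cast; ring_nf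
  | pred n ih =>
    rw [← ih, ← hf.add_one_mem_poles_iff (z := z + ((-n - 1 : ℤ) : ℂ))]
    push_cast
    rw [add_assoc, sub_add_cancel]

theorem neg_inv_mem_poles_iff (hf : IsMeromorphicModularForm k f) {z : ℂ} (hz : 0 < z.im) :
    -z⁻¹ ∈ poles f ↔ z ∈ poles f := by
  simpa [mobius_S] using hf.mobius_mem_poles_iff ModularGroup.S hz

theorem add_one_eq (hf : IsMeromorphicModularForm k f) {z : ℂ} (hz : 0 < z.im)
    (hP : z ∉ poles f) : f (z + 1) = f z := by
  have := hf.mobius_eq ModularGroup.T hz hP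
  rw [mobius_T] at this
  simpa [ModularGroup.T] using this

theorem neg_inv_eq (hf : IsMeromorphicModularForm k f) {z : ℂ} (hz : 0 < z.im)
    (hP : z ∉ poles f) : f (-z⁻¹) = z ^ k * f z := by
  have := hf.mobius_eq ModularGroup.S hz hP
  rw [mobius_S] at this
  simpa [ModularGroup.S] using this

/-- In odd weight there are no nonzero forms. -/
theorem eq_zero_of_odd (hf : IsMeromorphicModularForm k f) (hk : Odd k) {z : ℂ} (hz : 0 < z.im)
    (hP : z ∉ poles f) : f z = 0 := by
  have := hf.mobius_eq (-1) hz hP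
  simp only [mobius, Matrix.SpecialLinearGroup.coe_neg, Matrix.SpecialLinearGroup.coe_one,
    Matrix.neg_apply, Matrix.one_apply_eq, Int.cast_neg, Int.cast_one] at this
  simp [hk.neg_one_zpow] at this
  exact self_eq_neg.1 this

/-- Every pole of imaginary part less than `√3/2` lies below the inverse of the imaginary part of a
pole of imaginary part at least `√3/2`. -/
theorem exists_high_pole (hf : IsMeromorphicModularForm k f) {p : ℂ} (hp : p ∈ poles f)
    (hlow : p.im < √3 / 2) : ∃ q ∈ poles f, √3 / 2 ≤ q.im ∧ p.im * q.im ≤ 1 := by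
  obtain ⟨M, hM⟩ := ModularGroup.exists_smul_mem_fd ⟨p, hp.1⟩
  set τ : ℍ := ⟨p, hp.1⟩ with hτ
  have h1 := ModularGroup.three_le_four_mul_im_sq_of_mem_fd hM
  have him : (M • τ).im = (mobius M p).im := by
    rw [← UpperHalfPlane.coe_im, coe_smul_eq_mobius]
  have hq : √3 / 2 ≤ (mobius M p).im := by
    rw [him] at h1
    have : √3 ≤ 2 * (mobius M p).im := by
      apply Real.sqrt_le_iff.2
      constructor
      · have := mobius_im_pos M hp.1; positivity
      · nlinarith
    linarith
  refine ⟨mobius M p, (hf.mobius_mem_poles_iff M hp.1).2 hp, hq, ?_⟩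
  rw [← him, ModularGroup.im_smul_eq_div_normSq]
  have hn := UpperHalfPlane.normSq_denom_pos (M : GL (Fin 2) ℝ) (z := τ) τ.im_ne_zero
  have hpi : τ.im = p.im := rfl
  -- If `c = 0` then `d = ±1` and the height does not change, against `p.im < √3/2`.
  have hc : M 1 0 ≠ 0 := by
    intro h0
    have hdet : M 0 0 * M 1 1 = 1 := by
      have := M.det_coe
      rw [Matrix.det_fin_two, h0] at this
      simpa using this
    have hd : M 1 1 = 1 ∨ M 1 1 = -1 := Int.isUnit_iff.1 (IsUnit.of_mul_eq_one _ (by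
      rw [mul_comm]; exact hdet))
    have : Complex.normSq (UpperHalfPlane.denom (M : GL (Fin 2) ℝ) τ) = 1 := by
      rw [ModularGroup.denom_apply]
      rcases hd with hd | hd <;> simp [h0, hd]
    rw [← him, ModularGroup.im_smul_eq_div_normSq, this, div_one, hpi] at hq
    linarith
  -- With `y = p.im`, `|cτ + d|² ≥ c²y² ≥ y²`, so the new height `y / |cτ + d|²` is at most `1/y`.
  have h2 := UpperHalfPlane.c_mul_im_sq_le_normSq_denom (M : GL (Fin 2) ℝ) τ
  have h3 : τ.im ^ 2 ≤ Complex.normSq (UpperHalfPlane.denom (M : GL (Fin 2) ℝ) τ) := by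
    refine le_trans ?_ h2
    rw [mul_pow]
    have : (1 : ℝ) ≤ ((M 1 0 : ℤ) : ℝ) ^ 2 := by
      have : (1 : ℤ) ≤ (M 1 0) ^ 2 := Int.one_le_abs (pow_ne_zero 2 hc) |>.trans (by simp)
      exact_mod_cast this
    have h4 : ((M : GL (Fin 2) ℝ) 1 0 : ℝ) = ((M 1 0 : ℤ) : ℝ) := by simp
    rw [h4]
    nlinarith [sq_nonneg τ.im]
  rw [← hpi, ← mul_div_assoc, div_le_one hn]
  nlinarith

end IsMeromorphicModularForm

/-! ### Fourier expansions -/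

theorem e_eq_qParam (z : ℂ) : e z = Function.Periodic.qParam 1 z := by
  simp [e, Function.Periodic.qParam, mul_assoc]

theorem norm_e (z : ℂ) : ‖e z‖ = Real.exp (-(2 * Real.pi) * z.im) := by
  rw [e_eq_qParam, Function.Periodic.norm_qParam]
  congr 1; ring

theorem e_add (z w : ℂ) : e (z + w) = e z * e w := by
  rw [e, e, e, ← exp_add, mul_add]

theorem e_nat_mul (n : ℕ) (z : ℂ) : e (n * z) = e z ^ n := by
  rw [e, e, ← exp_nat_mul]; congr 1; ring

theorem e_int (n : ℤ) : e n = 1 := by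
  rw [e, exp_eq_one_iff]
  exact ⟨n, by ring⟩

theorem e_add_int (z : ℂ) (n : ℤ) : e (z + n) = e z := by
  rw [e_add, e_int, mul_one]

theorem e_eq_one_iff {z : ℂ} : e z = 1 ↔ ∃ n : ℤ, z = n := by
  rw [e, exp_eq_one_iff]
  have h2 : (2 * Real.pi * I : ℂ) ≠ 0 := two_pi_I_ne_zero
  constructor
  · rintro ⟨n, hn⟩
    exact ⟨n, mul_left_cancel₀ h2 (by rw [hn]; ring)⟩
  · rintro ⟨n, rfl⟩
    exact ⟨n, by ring⟩

theorem differentiable_e : Differentiable ℂ e := by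
  unfold e; fun_prop

theorem hasDerivAt_e (z : ℂ) : HasDerivAt e (2 * Real.pi * I * e z) z := by
  have := ((hasDerivAt_id z).const_mul (2 * Real.pi * I : ℂ)).cexp
  refine HasDerivAt.congr_deriv (show HasDerivAt e _ z from this) ?_
  simp only [e, id, mul_one]
  ring

/-- A function that is holomorphic and `1`-periodic on a half-plane and bounded at `i∞` has a
Fourier expansion without negative powers there. -/
theorem exists_hasSum_e {g : ℂ → ℂ} {T : ℝ} (hd : ∀ τ : ℂ, T < τ.im → DifferentiableAt ℂ g τ)
    (hper : ∀ τ : ℂ, T < τ.im → g (τ + 1) = g τ)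
    (hbd : ∃ C T' : ℝ, ∀ τ : ℂ, T' < τ.im → ‖g τ‖ ≤ C) :
    ∃ c : ℕ → ℂ, ∀ τ : ℂ, T < τ.im → HasSum (fun n : ℕ => c n * e (n * τ)) (g τ) := by
  -- Extension by zero makes the function periodic on all of `ℂ`; holomorphy is needed only above
  -- `T`, that is, on a disc around `q = 0`.
  set G : ℂ → ℂ := fun τ => if T < τ.im then g τ else 0 with hG
  have hG1 : ∀ τ : ℂ, T < τ.im → G τ = g τ := fun τ hτ => if_pos hτ
  have hGper : Function.Periodic G ((1 : ℝ) : ℂ) := by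
    intro τ
    by_cases hτ : T < τ.im
    · rw [hG1 τ hτ, hG1 _ (by simpa using hτ)]
      simpa using hper τ hτ
    · simp [hG, hτ]
  have hopen : IsOpen {τ : ℂ | T < τ.im} := isOpen_lt continuous_const continuous_im
  have hGd : ∀ τ : ℂ, T < τ.im → DifferentiableAt ℂ G τ := fun τ hτ =>
    (hd τ hτ).congr_of_eventuallyEq
      (Filter.eventuallyEq_of_mem (hopen.mem_nhds hτ) fun z hz => hG1 z hz)
  have hGb : Filter.BoundedAtFilter (comap Complex.im atTop) G := by
    obtain ⟨C, T', hC⟩ := hbd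
    refine Asymptotics.IsBigO.of_bound C ?_
    filter_upwards [tendsto_comap.eventually (eventually_gt_atTop T),
      tendsto_comap.eventually (eventually_gt_atTop T')] with τ h1 h2
    rw [hG1 τ h1]
    simpa using hC τ h2
  set Φ := Function.Periodic.cuspFunction 1 G with hΦ
  have hΦe : ∀ τ, Φ (e τ) = G τ := fun τ => by
    rw [e_eq_qParam]
    exact Function.Periodic.eq_cuspFunction one_ne_zero hGper τ
  have hball : ∀ τ : ℂ, e τ ∈ Metric.ball (0 : ℂ) (Real.exp (-2 * Real.pi * T / 1)) ↔ T < τ.im := by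
    intro τ
    rw [mem_ball_zero_iff, e_eq_qParam]
    exact Function.Periodic.norm_qParam_lt_iff one_pos T τ
  have hΦd : DifferentiableOn ℂ Φ (Metric.ball 0 (Real.exp (-2 * Real.pi * T / 1))) := by
    intro q hq
    refine DifferentiableAt.differentiableWithinAt ?_
    by_cases h0 : q = 0
    · rw [h0]
      exact Function.Periodic.differentiableAt_cuspFunction_zero one_pos hGper
        ((tendsto_comap.eventually (eventually_gt_atTop T)).mono hGd) hGb
    · have hq' := Function.Periodic.qParam_right_inv (h := 1) one_ne_zero h0
      rw [← hq', ← e_eq_qParam] at hq ⊢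
      rw [e_eq_qParam]
      exact Function.Periodic.differentiableAt_cuspFunction one_ne_zero hGper
        (hGd _ ((hball _).1 hq))
  refine ⟨fun n => (n.factorial : ℂ)⁻¹ * iteratedDeriv n Φ 0, fun τ hτ => ?_⟩
  have := hasSum_taylorSeries_on_ball hΦd ((hball τ).2 hτ)
  rw [hΦe, hG1 τ hτ] at this
  refine this.congr_fun fun n => ?_
  simp only [sub_zero, smul_eq_mul, e_nat_mul]
  ring

/-- Extension by zero of a sequence of Fourier coefficients to all integers. -/
def extendZero (c : ℕ → ℂ) (n : ℤ) : ℂ := if 0 ≤ n then c n.toNat else 0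

theorem hasSum_extendZero {c : ℕ → ℂ} {τ v : ℂ} (h : HasSum (fun n : ℕ => c n * e (n * τ)) v) :
    HasSum (fun n : ℤ => extendZero c n * e (n * τ)) v := by
  refine (Function.Injective.hasSum_iff (g := ((↑) : ℕ → ℤ)) Nat.cast_injective ?_).1 ?_
  · intro n hn
    have : ¬ 0 ≤ n := fun h => hn ⟨n.toNat, by simp [h]⟩
    simp [extendZero, this]
  · refine h.congr_fun fun n => ?_
    simp [extendZero, Function.comp]

theorem integral_e (j : ℤ) (y : ℝ) :
    ∫ x in (0 : ℝ)..1, e (j * (x + y * I)) = if j = 0 then 1 else 0 := by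
  by_cases hj : j = 0
  · simp [hj, e]
  · have hc : (2 * Real.pi * I * j : ℂ) ≠ 0 := mul_ne_zero two_pi_I_ne_zero (by exact_mod_cast hj)
    have h1 : ∀ x : ℝ, e (j * (x + y * I)) =
        e (j * (y * I)) * Complex.exp ((2 * Real.pi * I * j) * x) := by
      intro x
      rw [mul_add, e_add, mul_comm, e, e]
      congr 2; ring
    have h2 : Complex.exp (2 * Real.pi * I * j) = 1 := e_int j
    simp only [h1, intervalIntegral.integral_const_mul, integral_exp_mul_complex hc]
    simp [hj, h2]

/-- Multiply by `e(-mτ)` and integrate over a horizontal period. Termwise integration is allowed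
because the norm of each term is constant along the line. -/
theorem IsFourierExpansion.unique {g : ℂ → ℂ} {c c' : ℤ → ℂ} (h : IsFourierExpansion g c)
    (h' : IsFourierExpansion g c') : c = c' := by
  obtain ⟨T, hT⟩ := h
  obtain ⟨T', hT'⟩ := h'
  set y := max T T' + 1 with hy
  have hy1 : T < y := by rw [hy]; linarith [le_max_left T T']
  have hy2 : T' < y := by rw [hy]; linarith [le_max_right T T']
  ext m
  have hsum : ∀ x : ℝ, HasSum (fun n : ℤ => (c n - c' n) * e ((n - m : ℤ) * (x + y * I))) 0 := by
    intro x
    have h1 := ((hT (x + y * I) (by simpa using hy1)).sub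
      (hT' (x + y * I) (by simpa using hy2))).mul_right (e (((-m : ℤ) : ℂ) * (x + y * I)))
    rw [sub_self, zero_mul] at h1
    refine h1.congr_fun fun n => ?_
    rw [← sub_mul, mul_assoc, ← e_add, ← add_mul]
    push_cast
    rw [sub_eq_add_neg (n : ℂ)]
  have hnorm : ∀ (n : ℤ) (x : ℝ), ‖(c n - c' n) * e ((n - m : ℤ) * (x + y * I))‖ =
      ‖(c n - c' n) * e ((n - m : ℤ) * ((0 : ℝ) + y * I))‖ := by
    intro n x
    rw [norm_mul, norm_mul, norm_e, norm_e]
    congr 2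
    simp
  have hcont : ∀ n : ℤ, Continuous fun x : ℝ => (c n - c' n) * e ((n - m : ℤ) * (x + y * I)) :=
    fun n => by
      have := differentiable_e.continuous
      fun_prop
  have key := hasSum_integral_of_summable_integral_norm
    (μ := volume.restrict (Ioc (0 : ℝ) 1))
    (F := fun (n : ℤ) (x : ℝ) => (c n - c' n) * e ((n - m : ℤ) * (x + y * I)))
    (fun n => ((hcont n).integrableOn_Ioc))
    (by
      simp only [hnorm]
      simpa using (hsum 0).summable.norm)
  have e0 : ∀ x : ℝ, ∑' n : ℤ, (c n - c' n) * e ((n - m : ℤ) * (x + y * I)) = 0 := fun x =>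
    (hsum x).tsum_eq
  simp only [e0, intervalIntegral.integral_zero, ← intervalIntegral.integral_of_le zero_le_one,
    intervalIntegral.integral_const_mul, integral_e, sub_eq_zero, mul_ite, mul_one,
    mul_zero] at key
  have := key.unique (hasSum_ite_eq m (c m - c' m) |>.congr_fun fun n => by
    by_cases hn : n = m <;> simp [hn])
  exact (sub_eq_zero.1 this.symm)

theorem fourierCoeff_eq {g : ℂ → ℂ} {c : ℤ → ℂ} (h : IsFourierExpansion g c) :
    fourierCoeff g = c := by
  have hex : ∃ c, IsFourierExpansion g c := ⟨c, h⟩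
  rw [fourierCoeff, dif_pos hex]
  exact hex.choose_spec.unique h

theorem summable_norm_of_hasSum_e {g : ℂ → ℂ} {c : ℕ → ℂ} {T : ℝ}
    (h : ∀ τ : ℂ, T < τ.im → HasSum (fun n : ℕ => c n * e (n * τ)) (g τ)) {y : ℝ} (hy : T < y) :
    Summable fun n : ℕ => ‖c n‖ * Real.exp (-(2 * Real.pi) * (n * y)) := by
  have := (h (y * I) (by simpa using hy)).summable.norm
  simpa [norm_e] using this

/-- Between the heights `y` and `Im τ` every term with `n ≥ 1` shrinks at least by `exp(-2π(Im τ -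
y))`, so the convergent series at height `y` is a majorant. -/
theorem exists_exp_decay {g : ℂ → ℂ} {c : ℕ → ℂ} {T : ℝ}
    (h : ∀ τ : ℂ, T < τ.im → HasSum (fun n : ℕ => c n * e (n * τ)) (g τ)) {y : ℝ} (hy : T < y) :
    ∃ C : ℝ, ∀ τ : ℂ, y ≤ τ.im → ‖g τ - c 0‖ ≤ C * Real.exp (-(2 * Real.pi) * τ.im) := by
  have hs := summable_norm_of_hasSum_e h hy
  have hs1 := (summable_nat_add_iff 1).2 hs
  refine ⟨(∑' n : ℕ, ‖c (n + 1)‖ * Real.exp (-(2 * Real.pi) * ((n + 1 : ℕ) * y))) *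
    Real.exp (2 * Real.pi * y), fun τ hτ => ?_⟩
  have h1 := (hasSum_nat_add_iff' 1).2 (h τ (hy.trans_le hτ))
  simp only [Finset.range_one, Finset.sum_singleton, Nat.cast_zero, zero_mul,
    show e 0 = 1 by simp [e], mul_one] at h1
  have hle : ∀ n : ℕ, ‖c (n + 1) * e ((n + 1 : ℕ) * τ)‖ ≤
      ‖c (n + 1)‖ * Real.exp (-(2 * Real.pi) * ((n + 1 : ℕ) * y)) *
        Real.exp (2 * Real.pi * y + -(2 * Real.pi) * τ.im) := by
    intro n
    rw [norm_mul, norm_e, mul_assoc, ← Real.exp_add]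
    refine mul_le_mul_of_nonneg_left (Real.exp_le_exp.2 ?_) (norm_nonneg _)
    have him : (((n + 1 : ℕ) : ℂ) * τ).im = ((n + 1 : ℕ) : ℝ) * τ.im := by
      simp
    rw [him]
    have : 0 ≤ Real.pi * ((n : ℝ) * (τ.im - y)) :=
      mul_nonneg Real.pi_pos.le (mul_nonneg (Nat.cast_nonneg n) (by linarith))
    push_cast
    nlinarith
  rw [← h1.tsum_eq]
  refine (tsum_of_norm_bounded ((hs1.mul_right _).hasSum) hle).trans_eq ?_
  rw [tsum_mul_right, Real.exp_add]
  ring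

/-! ### The regularized L-integral -/

/-! ### The polar term as a function of `s` and of `B` -/

section PolarTerm

variable (f : ℂ → ℂ) (k : ℤ) {B : ℝ}

theorem polarTerm_eq_zero (h : fourierCoeff f 0 = 0 ∨ k = 0) (B : ℝ) (s : ℂ) :
    polarTerm f k B s = 0 := by
  rcases h with h | rfl
  · simp [polarTerm, h]
  · simp [polarTerm, div_neg]

theorem notMem_exceptional {s : ℂ} (hs : s ∉ exceptional f k) :
    (fourierCoeff f 0 = 0 ∨ k = 0) ∨ (s ≠ 0 ∧ s ≠ k) := by
  simp only [exceptional, mem_ofPred_eq] at hs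
  tauto

theorem differentiable_cpow_ofReal (hB : 0 < B) : Differentiable ℂ fun s : ℂ => (B : ℂ) ^ s :=
  fun _ => differentiableAt_id.const_cpow (Or.inl (by exact_mod_cast hB.ne'))

theorem differentiableAt_polarTerm (hB : 0 < B) {s : ℂ} (h0 : s ≠ 0) (hk : s ≠ k) :
    DifferentiableAt ℂ (polarTerm f k B) s := by
  have h1 := differentiable_cpow_ofReal hB
  have h2 : DifferentiableAt ℂ (fun s : ℂ => (B : ℂ) ^ (s - (k : ℂ))) s :=
    (h1 _).comp (f := fun s : ℂ => s - (k : ℂ)) s (by fun_prop)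
  exact (((h1 s).div differentiableAt_id h0).add ((h2.const_mul (I ^ k)).div (by fun_prop)
    (sub_ne_zero.2 hk.symm))).const_mul _

theorem finite_exceptional : (exceptional f k).Finite :=
  (Set.toFinite {0, (k : ℂ)}).subset fun _ hs => by simpa using hs.2.2

theorem differentiableOn_polarTerm (hB : 0 < B) :
    DifferentiableOn ℂ (polarTerm f k B) (exceptional f k)ᶜ := by
  intro s hs
  rcases notMem_exceptional f k hs with h | h
  · have : polarTerm f k B = fun _ => 0 := funext (polarTerm_eq_zero f k h B)
    rw [this]
    exact differentiableWithinAt_const 0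
  · exact (differentiableAt_polarTerm f k hB h.1 h.2).differentiableWithinAt

/-- Polar terms for different heights differ by an entire function. -/
theorem exists_differentiable_polarTerm_sub {B' : ℝ} (hB : 0 < B) (hB' : 0 < B') :
    ∃ D : ℂ → ℂ, Differentiable ℂ D ∧
      ∀ s ∉ exceptional f k, polarTerm f k B' s = polarTerm f k B s + D s := by
  -- Since `u` vanishes at `0`, `dslope u 0` continues `u(s)/s` to an entire function; the other
  -- quotient is its shift by `k`.
  set u : ℂ → ℂ := fun s => (B' : ℂ) ^ s - (B : ℂ) ^ s with hu
  have hud : Differentiable ℂ u :=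
    (differentiable_cpow_ofReal hB').sub (differentiable_cpow_ofReal hB)
  have hd : Differentiable ℂ (dslope u 0) := by
    rw [← differentiableOn_univ] at hud ⊢
    exact (differentiableOn_dslope univ_mem).2 hud
  have hu0 : u 0 = 0 := by simp [hu]
  have hds : ∀ s : ℂ, s ≠ 0 → dslope u 0 s = u s / s := by
    intro s hs
    rw [dslope_of_ne _ hs, slope_def_field, hu0, sub_zero, sub_zero]
  refine ⟨fun s => -fourierCoeff f 0 * (dslope u 0 s - I ^ k * dslope u 0 (s - k)), ?_, ?_⟩
  · exact (hd.sub ((hd.comp (differentiable_id.sub_const _)).const_mul _)).const_mul _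
  · intro s hs
    rcases notMem_exceptional f k hs with h | ⟨h0, hk⟩
    · rw [polarTerm_eq_zero f k h, polarTerm_eq_zero f k h]
      rcases h with h | h <;> simp [h]
    · have hk' : s - (k : ℂ) ≠ 0 := sub_ne_zero.2 hk
      have hk'' : (k : ℂ) - s ≠ 0 := sub_ne_zero.2 hk.symm
      beta_reduce
      rw [hds s h0, hds _ hk', polarTerm, polarTerm, ← neg_sub s (k : ℂ)]
      simp only [hu]
      field_simp
      ring

theorem inv_ofReal_cpow (hB : 0 < B) (s : ℂ) : ((B⁻¹ : ℝ) : ℂ) ^ s = (B : ℂ) ^ (-s) := by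
  rw [ofReal_inv, inv_cpow _ _ (by rw [arg_ofReal_of_nonneg hB.le]; exact Real.pi_pos.ne),
    cpow_neg]

theorem polarTerm_inv (hB : 0 < B) (hk : Even k) (s : ℂ) :
    I ^ k * polarTerm f k B⁻¹ ((k : ℂ) - s) = polarTerm f k B s := by
  have hI : I ^ k * I ^ k = 1 := by
    obtain ⟨m, rfl⟩ := hk
    rw [← mul_zpow, I_mul_I, ← two_mul, zpow_mul]
    norm_num
  rw [polarTerm, polarTerm, inv_ofReal_cpow hB, inv_ofReal_cpow hB]
  simp only [sub_sub_cancel, sub_sub_cancel_left, neg_neg, neg_sub]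
  linear_combination (-fourierCoeff f 0 * (B : ℂ) ^ s / s) * hI

end PolarTerm

/-! ### Splitting at `iB`: existence, continuation and functional equation -/

section RegularizedIntegral

variable {k : ℤ} {f : ℂ → ℂ}

theorem IsMeromorphicModularForm.exists_expansion (hf : IsMeromorphicModularForm k f)
    (hcusp : IsRegularAtCusp f) : ∃ T > 0, (∀ p ∈ poles f, p.im ≤ T) ∧ ∃ c : ℕ → ℂ,
      fourierCoeff f = extendZero c ∧
      (∀ τ : ℂ, T < τ.im → HasSum (fun n : ℕ => c n * e (n * τ)) (f τ)) ∧
      IsFourierExpansion f (fourierCoeff f) := by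
  obtain ⟨T, hT, C, hP, hC⟩ := exists_im_le_of_mem_poles hf.1 hcusp
  have hnot : ∀ τ : ℂ, T < τ.im → τ ∉ poles f := fun τ hτ h => absurd (hP τ h) (not_le.2 hτ)
  obtain ⟨c, hc⟩ := exists_hasSum_e (g := f) (T := T)
    (fun τ hτ => holOff_poles hf.1 τ (hT.trans hτ) (hnot τ hτ))
    (fun τ hτ => hf.add_one_eq (hT.trans hτ) (hnot τ hτ)) ⟨C, T, hC⟩
  have h1 : IsFourierExpansion f (extendZero c) := ⟨T, fun τ hτ => hasSum_extendZero (hc τ hτ)⟩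
  have h2 := fourierCoeff_eq h1
  exact ⟨T, hT, hP, c, h2, hc, h2 ▸ h1⟩

theorem IsMeromorphicModularForm.isFourierExpansion (hf : IsMeromorphicModularForm k f)
    (hcusp : IsRegularAtCusp f) : IsFourierExpansion f (fourierCoeff f) ∧
      ∀ n : ℤ, n < 0 → fourierCoeff f n = 0 := by
  obtain ⟨T, -, -, c, hc, -, h⟩ := hf.exists_expansion hcusp
  exact ⟨h, fun n hn => by simp [hc, extendZero, not_le.2 hn]⟩

theorem IsMeromorphicModularForm.decaying (hf : IsMeromorphicModularForm k f)
    (hcusp : IsRegularAtCusp f) : Decaying (poles f) fun τ => f τ - fourierCoeff f 0 := by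
  obtain ⟨T, hT, hP, c, hc, hs, h⟩ := hf.exists_expansion hcusp
  obtain ⟨C, hC⟩ := exists_exp_decay hs (lt_add_one T)
  refine ⟨locFin_poles hf.1, (holOff_poles hf.1).sub (holOff_const _ _), T + 1, C, by linarith,
    fun p hp => (hP p hp).trans (by linarith), fun τ hτ => ?_⟩
  have : fourierCoeff f 0 = c 0 := by simp [hc, extendZero]
  rw [this]
  exact hC τ hτ.le

theorem IsMeromorphicModularForm.inv_notMem (hf : IsMeromorphicModularForm k f) {B : ℝ}
    (hB : 0 < B) (hBP : (B * I : ℂ) ∉ poles f) : ((B⁻¹ : ℝ) * I : ℂ) ∉ poles f := by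
  rw [← neg_inv_mul_I, hf.neg_inv_mem_poles_iff (by simpa using hB)]
  exact hBP

theorem endpoints_empty {a b : ℝ} (ha : 0 < a) (hb : 0 < b) : Endpoints ∅ a b :=
  ⟨fun _ _ _ _ => by simp, ha, hb, by simp, by simp⟩

theorem axisIntegral_mellin_one {P : Set ℂ} {a b : ℝ} (h : Endpoints P a b) (s : ℂ) :
    axisIntegral P (mellinIntegrand s fun _ => 1) a b = ∫ t in a..b, (t : ℂ) ^ (s - 1) := by
  rw [axisIntegral_eq_intervalIntegral (g' := mellinIntegrand s fun _ => 1) (y₀ := 0) h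
    ((holOff_const P 1).mellinIntegrand s) h.left_pos h.right_pos
    (fun τ hτ => differentiableAt_mellinIntegrand s hτ (differentiableAt_const 1))
    (fun _ _ _ _ => rfl), I_mul_integral_mellinIntegrand s _ h.left_pos h.right_pos]
  simp

/-- The substitution `t ↦ 1/t`, read off from the inversion formula for the constant function in
weight `0`. -/
theorem integral_cpow_inv {a b : ℝ} (ha : 0 < a) (hb : 0 < b) (s : ℂ) :
    ∫ t in a⁻¹..b⁻¹, (t : ℂ) ^ (s - 1) = ∫ t in b..a, (t : ℂ) ^ (-s - 1) := by
  have h := endpoints_empty ha hb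
  have h1 := axisIntegral_mellin_inv (P := ∅) (by simp) (holOff_const ∅ 1) (k := 0) (by simp) s h
  rw [axisIntegral_mellin_one (endpoints_empty (inv_pos.2 ha) (inv_pos.2 hb)),
    axisIntegral_mellin_one h] at h1
  rw [h1, intervalIntegral.integral_symm b a]
  simp

theorem tendsto_integral_cpow_atTop {a : ℝ} (ha : 0 < a) {s : ℂ} (hs : s.re < 0) :
    Tendsto (fun Λ : ℝ => ∫ t in a..Λ, (t : ℂ) ^ (s - 1)) atTop (𝓝 (-(a : ℂ) ^ s / s)) := by
  have h1 : (s - 1).re < -1 := by simp; linarith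
  have h2 := intervalIntegral_tendsto_integral_Ioi a (integrableOn_Ioi_cpow_of_lt h1 ha) tendsto_id
  rw [integral_Ioi_cpow_of_lt h1 ha, sub_add_cancel] at h2
  exact h2

/-- The constant term contributes the polar part in the limit. -/
theorem tendsto_polarTerm {B : ℝ} (hB : 0 < B) {s : ℂ} (hs : s ∈ convergenceRegion f k) :
    Tendsto (fun Λ : ℝ => fourierCoeff f 0 * (I ^ k * (∫ t in B⁻¹..Λ, (t : ℂ) ^ ((k : ℂ) - s - 1))
      - ∫ t in Λ⁻¹..B, (t : ℂ) ^ (s - 1))) atTop (𝓝 (polarTerm f k B s)) := by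
  have hinv : ∀ᶠ Λ : ℝ in atTop,
      ∫ t in Λ⁻¹..B, (t : ℂ) ^ (s - 1) = ∫ t in B⁻¹..Λ, (t : ℂ) ^ (-s - 1) := by
    filter_upwards [eventually_gt_atTop 0] with Λ hΛ
    have := integral_cpow_inv hΛ (inv_pos.2 hB) s
    rwa [inv_inv] at this
  rcases hs with h | rfl | ⟨h0, hk⟩
  · simp [polarTerm_eq_zero f k (Or.inl h), h]
  -- In weight `0` the two integrals cancel for all large `Λ`, before any limit, so no condition on
  -- `s` is needed.
  · rw [polarTerm_eq_zero f 0 (Or.inr rfl)]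
    refine tendsto_const_nhds.congr' ?_
    filter_upwards [hinv] with Λ hΛ
    rw [hΛ]
    simp
  · have h1 := tendsto_integral_cpow_atTop (inv_pos.2 hB) (s := (k : ℂ) - s)
      (by simpa using hk)
    have h2 := tendsto_integral_cpow_atTop (inv_pos.2 hB) (s := -s) (by simpa using h0)
    have h3 := ((h1.const_mul (I ^ k)).sub h2).const_mul (fourierCoeff f 0)
    rw [inv_ofReal_cpow hB, inv_ofReal_cpow hB, neg_neg, neg_sub] at h3
    have h4 : polarTerm f k B s = fourierCoeff f 0 *
        (I ^ k * (-(B : ℂ) ^ (s - k) / (k - s)) - -(B : ℂ) ^ s / -s) := by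
      rw [polarTerm, neg_div_neg_eq]; ring
    rw [h4]
    refine h3.congr' ?_
    filter_upwards [hinv] with Λ hΛ
    rw [hΛ]

/-- The value of the regularized L-integral in terms of averaged integrals from `iB` and `i/B`. -/
def splitL (f : ℂ → ℂ) (k : ℤ) (B : ℝ) (s : ℂ) : ℂ :=
  polarTerm f k B s + (upperIntegral (poles f) (fun τ => f τ - fourierCoeff f 0) B s
    + I ^ k * upperIntegral (poles f) (fun τ => f τ - fourierCoeff f 0) B⁻¹ ((k : ℂ) - s))

theorem mellinIntegrand_sub_const (s : ℂ) (h : ℂ → ℂ) (c : ℂ) :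
    mellinIntegrand s (fun τ => h τ - c) =
      fun τ => mellinIntegrand s h τ - c * mellinIntegrand s (fun _ => 1) τ := by
  ext τ
  simp only [mellinIntegrand]
  ring

theorem axisIntegral_mellin_sub_const {P : Set ℂ} {h : ℂ → ℂ} (hh : HolOff P h) (s c : ℂ) {a b : ℝ}
    (hab : Endpoints P a b) : axisIntegral P (mellinIntegrand s fun τ => h τ - c) a b =
      axisIntegral P (mellinIntegrand s h) a b - c * ∫ t in a..b, (t : ℂ) ^ (s - 1) := by
  rw [mellinIntegrand_sub_const, axisIntegral_sub hab (hh.mellinIntegrand s)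
    (((holOff_const P 1).mellinIntegrand s).const_mul c), axisIntegral_const_mul,
    axisIntegral_mellin_one hab]

theorem IsMeromorphicModularForm.hasRegIntegral (hf : IsMeromorphicModularForm k f)
    (hcusp : IsRegularAtCusp f) {B : ℝ} (hB : 0 < B) (hBP : (B * I : ℂ) ∉ poles f) {s : ℂ}
    (hs : s ∈ convergenceRegion f k) :
    HasRegIntegral (poles f) (mellinIntegrand s fun τ => f τ - fourierCoeff f 0)
      (fun Λ => I / Λ) (splitL f k B s) := by
  have hdec := hf.decaying hcusp
  have hBP' := hf.inv_notMem hB hBP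
  have hB' := inv_pos.2 hB
  have hinv : ∀ p : ℂ, 0 < p.im → -p⁻¹ ∈ poles f → p ∈ poles f := fun p hp =>
    (hf.neg_inv_mem_poles_iff hp).1
  refine hasRegIntegral_of_tendsto hdec.locFin (hdec.holOff.mellinIntegrand s)
    (α := fun Λ => Λ⁻¹) ?_ hdec.eventually_notMem ?_
  · filter_upwards [eventually_gt_atTop 0, hdec.eventually_notMem] with Λ h1 h2
    refine ⟨?_, inv_pos.2 h1, hf.inv_notMem h1 h2⟩
    rw [div_eq_mul_inv, mul_comm, ofReal_inv]
  · have h1 := hdec.tendsto hB hBP s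
    have h2 := hdec.tendsto hB' hBP' ((k : ℂ) - s)
    refine ((tendsto_polarTerm hB hs).add (h1.add (h2.const_mul (I ^ k)))).congr' ?_
    filter_upwards [hdec.eventually_endpoints hB hBP, hdec.eventually_endpoints hB' hBP']
      with Λ e1 e2
    have e3 : Endpoints (poles f) Λ⁻¹ B := ⟨e1.locFin, inv_pos.2 e1.right_pos, hB,
      hf.inv_notMem e1.right_pos e1.right_notMem, hBP⟩
    have hhol := holOff_poles hf.1
    -- Inversion applies to `f` and not to `f - c_f(0)`, which is not modular in general. Removing
    -- the constant before and restoring it after leaves the two power integrals of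
    -- `tendsto_polarTerm`.
    have key := axisIntegral_mellin_inv hinv hhol
      (fun w h1 h2 => hf.neg_inv_eq h1 h2) s e2.symm
    rw [inv_inv, axisIntegral_swap e2 (hhol.mellinIntegrand _)] at key
    rw [← axisIntegral_trans e3 e1 (hdec.holOff.mellinIntegrand s),
      axisIntegral_mellin_sub_const hhol s _ e3, key,
      axisIntegral_mellin_sub_const hhol ((k : ℂ) - s) _ e2]
    ring

theorem IsMeromorphicModularForm.isRegLIntegral_splitL (hf : IsMeromorphicModularForm k f)
    (hcusp : IsRegularAtCusp f) {B : ℝ} (hB : 0 < B) (hBP : (B * I : ℂ) ∉ poles f) :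
    IsRegLIntegral f k (splitL f k B) where
  analytic := by
    have hdec := hf.decaying hcusp
    have h1 := hdec.differentiable_upperIntegral hB hBP
    have h2 := hdec.differentiable_upperIntegral (inv_pos.2 hB) (hf.inv_notMem hB hBP)
    exact (differentiableOn_polarTerm f k hB).add (h1.add ((h2.comp
      ((differentiable_const _).sub differentiable_id)).const_mul (I ^ k))).differentiableOn
  limit := fun _ hs => hf.hasRegIntegral hcusp hB hBP hs

/-- For `Re s > max(0, k)` both are the same limit, and the complement of a finite set in the plane
is connected, so the identity theorem applies. -/
theorem IsRegLIntegral.eqOn {L L' : ℂ → ℂ} (h : IsRegLIntegral f k L)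
    (h' : IsRegLIntegral f k L') : EqOn L L' (exceptional f k)ᶜ := by
  have hopen : IsOpen (exceptional f k)ᶜ := (finite_exceptional f k).isClosed.isOpen_compl
  have hconn : IsPreconnected (exceptional f k)ᶜ :=
    ((finite_exceptional f k).countable.isConnected_compl_of_one_lt_rank
      (by rw [Complex.rank_real_complex]; norm_num)).isPreconnected
  set z₀ : ℂ := ((max 0 (k : ℝ) + 1 : ℝ) : ℂ) with hz₀
  have hre : z₀.re = max 0 (k : ℝ) + 1 := by rw [hz₀, ofReal_re]
  have hz : ∀ᶠ z : ℂ in 𝓝 z₀, max 0 (k : ℝ) < z.re :=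
    continuous_re.continuousAt.eventually (lt_mem_nhds (by rw [hre]; linarith))
  have hmem : z₀ ∈ (exceptional f k)ᶜ := by
    rintro ⟨-, -, h0 | h0⟩
    · have := congrArg re h0
      rw [hre, zero_re] at this
      linarith [le_max_left 0 (k : ℝ)]
    · have := congrArg re h0
      rw [hre, intCast_re] at this
      linarith [le_max_right 0 (k : ℝ)]
  refine (h.analytic.analyticOnNhd hopen).eqOn_of_preconnected_of_eventuallyEq
    (h'.analytic.analyticOnNhd hopen) hconn hmem ?_
  filter_upwards [hz] with z hz
  have hzr : z ∈ convergenceRegion f k :=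
    Or.inr (Or.inr ⟨(le_max_left _ _).trans_lt hz, (le_max_right _ _).trans_lt hz⟩)
  exact (h.limit z hzr).unique (h'.limit z hzr)

theorem IsRegLIntegral.regL {L : ℂ → ℂ} (h : IsRegLIntegral f k L) :
    IsRegLIntegral f k (MeroL.regL f k) := by
  have hex : ∃ L, IsRegLIntegral f k L := ⟨L, h⟩
  rw [MeroL.regL, dif_pos hex]
  exact hex.choose_spec

theorem IsMeromorphicModularForm.exists_regular_height (hf : IsMeromorphicModularForm k f)
    (hcusp : IsRegularAtCusp f) : ∃ B : ℝ, 0 < B ∧ (B * I : ℂ) ∉ poles f := by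
  obtain ⟨B, h1, h2⟩ := ((hf.decaying hcusp).eventually_notMem.and (eventually_gt_atTop 0)).exists
  exact ⟨B, h2, h1⟩

theorem IsMeromorphicModularForm.isRegLIntegral_regL (hf : IsMeromorphicModularForm k f)
    (hcusp : IsRegularAtCusp f) : IsRegLIntegral f k (regL f k) := by
  obtain ⟨B, hB, hBP⟩ := hf.exists_regular_height hcusp
  exact (hf.isRegLIntegral_splitL hcusp hB hBP).regL

theorem IsMeromorphicModularForm.regL_eq (hf : IsMeromorphicModularForm k f)
    (hcusp : IsRegularAtCusp f) {B : ℝ} (hB : 0 < B) (hBP : (B * I : ℂ) ∉ poles f) {s : ℂ}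
    (hs : s ∉ exceptional f k) : regL f k s = splitL f k B s :=
  (hf.isRegLIntegral_regL hcusp).eqOn (hf.isRegLIntegral_splitL hcusp hB hBP) hs

/-- Here `iB` may be a pole. The path is split at another height `B'`, and the change of polar term
is absorbed in the entire part. -/
theorem IsMeromorphicModularForm.exists_entire_part (hf : IsMeromorphicModularForm k f)
    (hcusp : IsRegularAtCusp f) {B : ℝ} (hB : 0 < B) : ∃ R : ℂ → ℂ, Differentiable ℂ R ∧
      ∀ s ∉ exceptional f k, regL f k s = polarTerm f k B s + R s := by
  obtain ⟨B', hB', hBP'⟩ := hf.exists_regular_height hcusp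
  obtain ⟨D, hD, hDe⟩ := exists_differentiable_polarTerm_sub f k hB hB'
  have hdec := hf.decaying hcusp
  have h1 := hdec.differentiable_upperIntegral hB' hBP'
  have h2 := hdec.differentiable_upperIntegral (inv_pos.2 hB') (hf.inv_notMem hB' hBP')
  refine ⟨_, hD.add (h1.add ((h2.comp
      ((differentiable_const (k : ℂ)).sub differentiable_id)).const_mul (I ^ k))), fun s hs => ?_⟩
  rw [hf.regL_eq hcusp hB' hBP' hs, splitL, hDe s hs, add_assoc]
  rfl

theorem upperIntegral_eq_zero {P : Set ℂ} {h : ℂ → ℂ} (hh : Decaying P h)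
    (h0 : ∀ τ : ℂ, 0 < τ.im → τ ∉ P → h τ = 0) {a : ℝ} (ha : 0 < a) (haP : (a * I : ℂ) ∉ P)
    (s : ℂ) : upperIntegral P h a s = 0 := by
  refine tendsto_nhds_unique (hh.tendsto ha haP s) (tendsto_const_nhds.congr' ?_)
  filter_upwards [hh.eventually_endpoints ha haP] with Λ hΛ
  rw [axisIntegral_congr (g' := fun τ => 0 * mellinIntegrand s h τ) hΛ, axisIntegral_const_mul,
    zero_mul]
  intro τ h1 h2
  simp [mellinIntegrand, h0 τ h1 h2]

theorem IsMeromorphicModularForm.regL_functional_equation (hf : IsMeromorphicModularForm k f)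
    (hcusp : IsRegularAtCusp f) {s : ℂ} (hs : s ∉ exceptional f k) :
    regL f k s = I ^ k * regL f k ((k : ℂ) - s) := by
  obtain ⟨B, hB, hBP⟩ := hf.exists_regular_height hcusp
  have hBP' := hf.inv_notMem hB hBP
  have hB' := inv_pos.2 hB
  have hs' : (k : ℂ) - s ∉ exceptional f k := by
    rintro ⟨h1, h2, h3 | h3⟩
    · exact hs ⟨h1, h2, Or.inr (sub_eq_zero.1 h3).symm⟩
    · exact hs ⟨h1, h2, Or.inl (by linear_combination -h3)⟩
  -- Splitting at `1/B` with argument `k - s` gives the same two upper integrals as splitting at `B`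
  -- with argument `s`, exchanged.
  rw [hf.regL_eq hcusp hB hBP hs, hf.regL_eq hcusp hB' hBP' hs']
  rcases Int.even_or_odd k with hk | hk
  · have hI : I ^ k * I ^ k = 1 := by
      obtain ⟨m, rfl⟩ := hk
      rw [← mul_zpow, I_mul_I, ← two_mul, zpow_mul]
      norm_num
    rw [splitL, splitL, mul_add, polarTerm_inv f k hB hk, inv_inv, sub_sub_cancel]
    linear_combination -hI * upperIntegral (poles f) (fun τ => f τ - fourierCoeff f 0) B s
  -- For odd `k` one has `i^(2k) = -1` and the exchange fails formally, but both sides are zero.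
  · have h0 : ∀ τ : ℂ, 0 < τ.im → τ ∉ poles f → f τ = 0 := fun τ h1 h2 =>
      hf.eq_zero_of_odd hk h1 h2
    have hc : fourierCoeff f = 0 := by
      obtain ⟨T, hT, hP, -⟩ := hf.exists_expansion hcusp
      refine fourierCoeff_eq ⟨T, fun τ hτ => ?_⟩
      rw [h0 τ (hT.trans hτ) fun h => absurd (hP τ h) (not_le.2 hτ)]
      simp
    have hd := hf.decaying hcusp
    have h0' : ∀ τ : ℂ, 0 < τ.im → τ ∉ poles f → f τ - fourierCoeff f 0 = 0 := fun τ h1 h2 => by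
      simp [h0 τ h1 h2, hc]
    have hc0 : fourierCoeff f 0 = 0 := by simp [hc]
    rw [splitL, splitL, polarTerm_eq_zero f k (Or.inl hc0), polarTerm_eq_zero f k (Or.inl hc0),
      upperIntegral_eq_zero hd h0' hB hBP, inv_inv, upperIntegral_eq_zero hd h0' hB' hBP',
      upperIntegral_eq_zero hd h0' hB hBP]
    simp

end RegularizedIntegral

/-! ### Polylogarithms of non-positive order -/

theorem analyticAt_polylogNeg (N : ℕ) {x : ℂ} (hx : x ≠ 1) : AnalyticAt ℂ (polylogNeg N) x := by
  induction N generalizing x with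
  | zero => exact analyticAt_id.div (analyticAt_const.sub analyticAt_id) (sub_ne_zero.2 hx.symm)
  | succ N ih => exact analyticAt_id.mul (ih hx).deriv

theorem polylogNeg_zero_right (N : ℕ) : polylogNeg N 0 = 0 := by
  cases N <;> simp [polylogNeg]

theorem analyticAt_dslope {g : ℂ → ℂ} {p : ℂ} (hg : AnalyticAt ℂ g p) :
    AnalyticAt ℂ (dslope g p) p := by
  obtain ⟨q, hq⟩ := hg
  exact ⟨_, hq.has_fpower_series_dslope_fslope⟩

theorem hasDerivAt_inv_pow_succ (N : ℕ) {z : ℂ} (hz : z ≠ 0) :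
    HasDerivAt (fun z : ℂ => (z ^ (N + 1))⁻¹) (-(N + 1) * (z ^ (N + 2))⁻¹) z := by
  refine ((hasDerivAt_pow (N + 1) z).fun_inv (pow_ne_zero _ hz)).congr_deriv ?_
  push_cast
  field_simp
  ring

/-- The polar part of `Li_{-N}(e(z))` at `z = 0`. -/
theorem exists_polylogNeg_e_eq (N : ℕ) : ∃ φ : ℂ → ℂ, AnalyticAt ℂ φ 0 ∧
    ∀ᶠ z in 𝓝[≠] (0 : ℂ), polylogNeg N (e z) =
      (N.factorial : ℂ) / (-2 * Real.pi * I) ^ (N + 1) * (z ^ (N + 1))⁻¹ + φ z := by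
  have hpi : (2 * Real.pi * I : ℂ) ≠ 0 := two_pi_I_ne_zero
  induction N with
  | zero =>
    have hea : AnalyticAt ℂ e 0 := differentiable_e.analyticAt 0
    -- Writing `e(z) = 1 + z u(z)` gives `Li₀(e(z)) = -e(z) / (z u(z))`, with residue `-1/(2πi)`;
    -- the divided difference of `-e/u` is the regular part.
    set u := dslope e 0 with hu
    have hua : AnalyticAt ℂ u 0 := analyticAt_dslope hea
    have hu0 : u 0 = 2 * Real.pi * I := by
      rw [hu, dslope_same, (hasDerivAt_e 0).deriv]; simp [e]
    have hwa : AnalyticAt ℂ (fun z => -e z / u z) 0 := hea.neg.div hua (by rw [hu0]; exact hpi)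
    refine ⟨dslope (fun z => -e z / u z) 0, analyticAt_dslope hwa, ?_⟩
    have hune : ∀ᶠ z in 𝓝 (0 : ℂ), u z ≠ 0 :=
      hua.continuousAt.eventually_ne (by rw [hu0]; exact hpi)
    filter_upwards [self_mem_nhdsWithin, mem_nhdsWithin_of_mem_nhds hune] with z hz huz
    have hz0 : z ≠ 0 := hz
    have h1 : e z = 1 + z * u z := by
      rw [hu, dslope_of_ne _ hz0, slope_def_field]
      simp [e]
      field_simp
      ring
    have h2 : 1 - e z ≠ 0 := by
      rw [h1]; simp only [sub_add_cancel_left]; exact neg_ne_zero.2 (mul_ne_zero hz0 huz)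
    rw [dslope_of_ne _ hz0, slope_def_field, hu0, polylogNeg]
    have h3 : 1 - e z = -(z * u z) := by rw [h1]; ring
    have h4 : e 0 = 1 := by simp [e]
    beta_reduce
    rw [h3, h4]
    have hne : (-2 * Real.pi * I : ℂ) ≠ 0 := by simp
    simp only [Nat.factorial_zero, Nat.cast_one, zero_add, pow_one, sub_zero]
    have hpi' : (Real.pi : ℂ) ≠ 0 := by exact_mod_cast Real.pi_ne_zero
    field_simp
    ring
  | succ N ih =>
    obtain ⟨φ, hφ, hev⟩ := ih
    refine ⟨fun z => (2 * Real.pi * I)⁻¹ * deriv φ z, analyticAt_const.mul hφ.deriv, ?_⟩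
    have h1 : ∀ᶠ z in 𝓝[≠] (0 : ℂ), e z ≠ 1 := by
      have : ∀ᶠ z : ℂ in 𝓝 0, ‖z‖ < 1 := by
        filter_upwards [Metric.ball_mem_nhds (0 : ℂ) one_pos] with z hz
        simpa using hz
      filter_upwards [self_mem_nhdsWithin, mem_nhdsWithin_of_mem_nhds this] with z hz hz1 he
      obtain ⟨n, rfl⟩ := e_eq_one_iff.1 he
      rw [norm_intCast] at hz1
      have : n = 0 := by
        have : |n| < 1 := by exact_mod_cast hz1
        exact Int.abs_lt_one_iff.1 this
      exact hz (by simp [this])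
    have h2 := (eventually_eventually_nhdsWithin).2 hev
    have h3 := eventually_nhdsWithin_of_eventually_nhds (s := {0}ᶜ) hφ.eventually_analyticAt
    filter_upwards [h1, h2, h3, self_mem_nhdsWithin] with z hz1 hz2 hz3 hz0
    have hz0' : z ≠ 0 := hz0
    rw [IsOpen.nhdsWithin_eq isOpen_compl_singleton hz0] at hz2
    have hd1 : HasDerivAt (fun z => polylogNeg N (e z))
        (deriv (polylogNeg N) (e z) * (2 * Real.pi * I * e z)) z :=
      (analyticAt_polylogNeg N hz1).differentiableAt.hasDerivAt.comp z (hasDerivAt_e z)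
    have hd2 := ((hasDerivAt_inv_pow_succ N hz0').const_mul
      ((N.factorial : ℂ) / (-2 * Real.pi * I) ^ (N + 1))).add hz3.differentiableAt.hasDerivAt
    have hd3 := hd1.unique (hd2.congr_of_eventuallyEq hz2)
    -- In the variable `x = e(z)`, `x d/dx` is `(2πi)⁻¹ d/dz`, and differentiating a single power of
    -- `z` creates no poles of lower order.
    have h4 : polylogNeg (N + 1) (e z) = (2 * Real.pi * I)⁻¹ *
        (deriv (polylogNeg N) (e z) * (2 * Real.pi * I * e z)) := by
      rw [polylogNeg]
      field_simp
    have hpi' : (Real.pi : ℂ) ≠ 0 := by exact_mod_cast Real.pi_ne_zero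
    rw [h4, hd3, mul_add, Nat.factorial_succ, pow_succ _ (N + 1)]
    push_cast
    congr 1
    rw [show (-2 * Real.pi * I : ℂ) = -(2 * Real.pi * I) by ring]
    have h5 : (-(2 * Real.pi * I : ℂ)) ^ (N + 1) ≠ 0 := pow_ne_zero _ (neg_ne_zero.2 hpi)
    field_simp
    ring

theorem e_sub_eq_one_iff {τ p : ℂ} : e (τ - p) = 1 ↔ τ ∈ translates p := by
  rw [e_eq_one_iff]
  constructor
  · rintro ⟨n, hn⟩; exact ⟨n, by linear_combination hn⟩
  · rintro ⟨n, hn⟩; exact ⟨n, by rw [hn]; ring⟩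

theorem analyticAt_polylogNeg_e (N : ℕ) {p τ : ℂ} (h : τ ∉ translates p) :
    AnalyticAt ℂ (fun τ => polylogNeg N (e (τ - p))) τ := by
  have h1 : AnalyticAt ℂ (fun τ => e (τ - p)) τ :=
    (differentiable_e.analyticAt _).fun_comp (f := fun τ => τ - p) (by fun_prop)
  exact (analyticAt_polylogNeg N fun h' => h (e_sub_eq_one_iff.1 h')).fun_comp
    (f := fun τ => e (τ - p)) h1

theorem holOff_polylogNeg (N : ℕ) (p : ℂ) :
    HolOff (translates p) fun τ => polylogNeg N (e (τ - p)) := fun _ _ h =>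
  (analyticAt_polylogNeg_e N h).differentiableAt

theorem locFin_translates (p : ℂ) : LocFin (translates p) := by
  intro X y₀ y₁ _
  have hf : (Set.Icc (⌊-X - p.re⌋) (⌈X - p.re⌉)).Finite := Set.finite_Icc _ _
  refine (hf.image fun n : ℤ => p + n).subset ?_
  rintro τ ⟨⟨n, rfl⟩, h, -⟩
  refine ⟨n, ?_, rfl⟩
  rw [abs_le] at h
  simp only [add_re, intCast_re] at h
  constructor
  · have : (⌊-X - p.re⌋ : ℝ) ≤ n := (Int.floor_le _).trans (by linarith)
    exact_mod_cast this
  · have : (n : ℝ) ≤ ⌈X - p.re⌉ := le_trans (by linarith) (Int.le_ceil _)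
    exact_mod_cast this

theorem decaying_polylogNeg (N : ℕ) (p : ℂ) :
    Decaying (translates p) fun τ => polylogNeg N (e (τ - p)) := by
  refine ⟨locFin_translates p, holOff_polylogNeg N p, ?_⟩
  -- `Li_{-N}` vanishes at `0`, hence is `O(x)` there, and `|e(τ - p)|` decays like `exp(-2π Im τ)`.
  have h1 := (analyticAt_polylogNeg N (x := 0) zero_ne_one).differentiableAt.isBigO_sub
  simp only [polylogNeg_zero_right, sub_zero] at h1
  obtain ⟨C, hC⟩ := h1.bound
  obtain ⟨r, hr, hball⟩ := Metric.eventually_nhds_iff_ball.1 hC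
  have hlim : Tendsto (fun y : ℝ => Real.exp (-(2 * Real.pi) * (y - p.im))) atTop (𝓝 0) := by
    refine Real.tendsto_exp_atBot.comp ?_
    refine Tendsto.const_mul_atTop_of_neg (by linarith [Real.pi_pos]) ?_
    exact tendsto_atTop_add_const_right _ _ tendsto_id
  obtain ⟨T, hT⟩ := (hlim.eventually (gt_mem_nhds hr)).exists_forall_of_atTop
  refine ⟨max T (max 1 p.im), C * Real.exp (2 * Real.pi * p.im), by positivity, ?_, ?_⟩
  · rintro τ ⟨n, rfl⟩
    simp
  · intro τ hτ
    have h2 : ‖e (τ - p)‖ = Real.exp (-(2 * Real.pi) * (τ.im - p.im)) := by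
      rw [norm_e, sub_im]
    have h3 := hball (e (τ - p)) (by
      rw [mem_ball_zero_iff, h2]
      exact hT _ ((le_max_left _ _).trans hτ.le))
    refine h3.trans_eq ?_
    rw [h2, mul_assoc, ← Real.exp_add]
    congr 2; ring

/-! ### Principal parts -/

/-- Each induction step peels off the term of highest order, by `g(z) = g(p) + (z - p) · dslope g p
z`. -/
theorem exists_principal_part {g : ℂ → ℂ} {p : ℂ} (hg : AnalyticAt ℂ g p) (N : ℕ) :
    ∃ (a : ℕ → ℂ) (φ : ℂ → ℂ), AnalyticAt ℂ φ p ∧ ∀ z ≠ p,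
      ((z - p) ^ N)⁻¹ * g z = ∑ m ∈ Finset.Icc 1 N, a m * ((z - p) ^ m)⁻¹ + φ z := by
  induction N generalizing g with
  | zero => exact ⟨0, g, hg, fun z _ => by simp⟩
  | succ N ih =>
    obtain ⟨a, φ, hφ, h⟩ := ih (analyticAt_dslope hg)
    refine ⟨fun m => if m = N + 1 then g p else a m, φ, hφ, fun z hz => ?_⟩
    rw [Finset.sum_Icc_succ_top (by omega)]
    beta_reduce
    rw [if_pos rfl, Finset.sum_congr rfl (g := fun m =>
      a m * ((z - p) ^ m)⁻¹) fun m hm => by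
        rw [if_neg]; have := (Finset.mem_Icc.1 hm).2; omega]
    have h1 := h z hz
    have hzp : z - p ≠ 0 := sub_ne_zero.2 hz
    rw [dslope_of_ne _ hz, slope_def_field] at h1
    have h2 : ((z - p) ^ (N + 1))⁻¹ * g z =
        ((z - p) ^ N)⁻¹ * ((g z - g p) / (z - p)) + g p * ((z - p) ^ (N + 1))⁻¹ := by
      field_simp
      ring
    rw [h2, h1]
    ring

/-- On every small circle only the power `(τ - p)⁻¹` contributes, so the limit defining the
coefficient is that of an eventually constant function. -/
theorem laurentCoeff_eq {f φ : ℂ → ℂ} {p : ℂ} (hφ : AnalyticAt ℂ φ p) {N : ℕ} {a : ℕ → ℂ}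
    (h : ∀ᶠ z in 𝓝[≠] p, f z = ∑ m ∈ Finset.Icc 1 N, a m * ((z - p) ^ m)⁻¹ + φ z) {m : ℕ}
    (hm : m ∈ Finset.Icc 1 N) : laurentCoeff f p (-(m : ℤ)) = a m := by
  have hpi : (2 * Real.pi * I : ℂ) ≠ 0 := two_pi_I_ne_zero
  obtain ⟨h1m, hmN⟩ := Finset.mem_Icc.1 hm
  refine Tendsto.limUnder_eq (tendsto_const_nhds.congr' ?_)
  rw [eventually_nhdsWithin_iff] at h
  obtain ⟨r, hr, hball⟩ := Metric.eventually_nhds_iff_ball.1 (h.and hφ.eventually_analyticAt)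
  filter_upwards [self_mem_nhdsWithin, mem_nhdsWithin_of_mem_nhds (Iio_mem_nhds hr)]
    with ρ hρ0 hρr
  have hρ : 0 < ρ := hρ0
  have hsub : Metric.closedBall p ρ ⊆ Metric.ball p r := Metric.closedBall_subset_ball hρr
  have hne : ∀ z ∈ Metric.sphere p ρ, z - p ≠ 0 := by
    intro z hz h0
    rw [mem_sphere_iff_norm, h0, norm_zero] at hz
    exact hρ.ne hz
  have e1 : (∮ τ in C(p, ρ), f τ * (τ - p) ^ (-(-(m : ℤ)) - 1)) =
      ∮ τ in C(p, ρ), ((∑ j ∈ Finset.Icc 1 N, a j * (τ - p) ^ ((m : ℤ) - 1 - j)) +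
        φ τ * (τ - p) ^ (m - 1)) := by
    refine circleIntegral.integral_congr hρ.le fun z hz => ?_
    have hz0 := hne z hz
    have hf := (hball z (hsub (Metric.sphere_subset_closedBall hz))).1 (sub_ne_zero.1 hz0)
    rw [hf, add_mul, Finset.sum_mul]
    congr 1
    · refine Finset.sum_congr rfl fun j _ => ?_
      rw [mul_assoc]
      congr 1
      rw [← zpow_natCast, ← zpow_neg, ← zpow_add₀ hz0]
      congr 1; ring
    · rw [← zpow_natCast, Nat.cast_sub h1m]
      congr 2; push_cast; ring
  have hcont : ∀ j ∈ Finset.Icc 1 N,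
      CircleIntegrable (fun τ => a j * (τ - p) ^ ((m : ℤ) - 1 - j)) p ρ := fun j _ => by
    refine ContinuousOn.circleIntegrable hρ.le ?_
    exact continuousOn_const.mul ((by fun_prop : ContinuousOn (fun τ : ℂ => τ - p) _).zpow₀ _
      fun z hz => Or.inl (hne z hz))
  have hdφ : ∀ z ∈ Metric.closedBall p ρ, DifferentiableAt ℂ (fun τ => φ τ * (τ - p) ^ (m - 1)) z :=
    fun z hz => ((hball z (hsub hz)).2.differentiableAt).mul (by fun_prop)
  have hcφ : CircleIntegrable (fun τ => φ τ * (τ - p) ^ (m - 1)) p ρ :=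
    ContinuousOn.circleIntegrable hρ.le fun z hz =>
      (hdφ z (Metric.sphere_subset_closedBall hz)).continuousAt.continuousWithinAt
  have e2 : (∮ τ in C(p, ρ), φ τ * (τ - p) ^ (m - 1)) = 0 :=
    circleIntegral_eq_zero_of_differentiable_on_off_countable hρ.le countable_empty
      (fun z hz => (hdφ z hz).continuousAt.continuousWithinAt)
      fun z hz => hdφ z (Metric.ball_subset_closedBall hz.1)
  have e3 : ∀ j ∈ Finset.Icc 1 N, (∮ τ in C(p, ρ), a j * (τ - p) ^ ((m : ℤ) - 1 - j)) =
      if j = m then a m * (2 * Real.pi * I) else 0 := by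
    intro j _
    rw [circleIntegral.integral_const_mul]
    split_ifs with hj
    · subst hj
      have := circleIntegral.integral_sub_center_inv p hρ.ne'
      rw [← this]
      congr 2
      ext z
      rw [show (j : ℤ) - 1 - j = -1 by ring, zpow_neg_one]
    · rw [circleIntegral.integral_sub_zpow_of_ne (by omega), mul_zero]
  rw [e1, circleIntegral.integral_add (CircleIntegrable.fun_sum _ hcont) hcφ, e2, add_zero,
    circleIntegral.integral_fun_sum hcont, Finset.sum_congr rfl e3, Finset.sum_ite_eq' , if_pos hm]
  field_simp

/-- Subtracting the polylogarithms weighted by `r*` removes the pole of `f` at `p`. -/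
theorem exists_analytic_sub_polylog {f : ℂ → ℂ} {p : ℂ} (hf : MeromorphicAt f p)
    (hp : meromorphicOrderAt f p < 0) : ∃ φ : ℂ → ℂ, AnalyticAt ℂ φ p ∧
      ∀ᶠ z in 𝓝[≠] p, f z - ∑ m ∈ Finset.Icc 1 (poleOrder f p),
        rStar f p m * polylogNeg (m - 1) (e (z - p)) = φ z := by
  have hpi : (-2 * Real.pi * I : ℂ) ≠ 0 := by simp
  set N := poleOrder f p with hN
  have hord : meromorphicOrderAt f p = ((-(N : ℤ) : ℤ) : WithTop ℤ) := by
    obtain ⟨n, hn⟩ := WithTop.ne_top_iff_exists.1 hp.ne_top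
    rw [← hn] at hp
    have hn0 : n < 0 := by exact_mod_cast hp
    rw [hN, poleOrder, ← hn]
    congr 1
    simp only [WithTop.untop₀_coe]
    omega
  obtain ⟨g, hg, -, hfg⟩ := (meromorphicOrderAt_eq_int_iff hf).1 hord
  obtain ⟨a, φ, hφ, ha⟩ := exists_principal_part hg N
  have hfa : ∀ᶠ z in 𝓝[≠] p, f z = ∑ m ∈ Finset.Icc 1 N, a m * ((z - p) ^ m)⁻¹ + φ z := by
    filter_upwards [hfg, self_mem_nhdsWithin] with z hz hzp
    rw [hz, ← ha z hzp, zpow_neg, zpow_natCast, smul_eq_mul]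
  choose ψ hψ hpoly using exists_polylogNeg_e_eq
  have htend : Tendsto (fun z : ℂ => z - p) (𝓝[≠] p) (𝓝[≠] 0) := by
    refine tendsto_nhdsWithin_iff.2 ⟨?_, ?_⟩
    · have : Tendsto (fun z : ℂ => z - p) (𝓝 p) (𝓝 (p - p)) :=
        (continuous_id.sub continuous_const).tendsto p
      rw [sub_self] at this
      exact this.mono_left nhdsWithin_le_nhds
    · filter_upwards [self_mem_nhdsWithin] with z hz
      exact sub_ne_zero.2 hz
  have hpoly' : ∀ᶠ z in 𝓝[≠] p, ∀ m ∈ Finset.Icc 1 N, polylogNeg (m - 1) (e (z - p)) =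
      ((m - 1).factorial : ℂ) / (-2 * Real.pi * I) ^ m * ((z - p) ^ m)⁻¹ + ψ (m - 1) (z - p) := by
    rw [Filter.eventually_all_finset]
    intro m hm
    filter_upwards [htend.eventually (hpoly (m - 1))] with z hz
    rw [hz, Nat.sub_add_cancel (Finset.mem_Icc.1 hm).1]
  refine ⟨fun z => φ z - ∑ m ∈ Finset.Icc 1 N, rStar f p m * ψ (m - 1) (z - p), ?_, ?_⟩
  · refine hφ.sub (Finset.analyticAt_fun_sum _ fun m _ => analyticAt_const.mul ?_)
    exact AnalyticAt.fun_comp (f := fun z => z - p) (by simpa using hψ (m - 1)) (by fun_prop)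
  · filter_upwards [hfa, hpoly'] with z h1 h2
    have h3 : ∑ m ∈ Finset.Icc 1 N, rStar f p m * polylogNeg (m - 1) (e (z - p)) =
        ∑ m ∈ Finset.Icc 1 N, a m * ((z - p) ^ m)⁻¹ +
          ∑ m ∈ Finset.Icc 1 N, rStar f p m * ψ (m - 1) (z - p) := by
      rw [← Finset.sum_add_distrib]
      refine Finset.sum_congr rfl fun m hm => ?_
      -- The normalising factor in `rStar` is the reciprocal of the polar coefficient of
      -- `Li_{1-m}(e(z))`.
      rw [h2 m hm, rStar, laurentCoeff_eq hφ hfa hm]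
      have h4 : ((m - 1).factorial : ℂ) ≠ 0 := by exact_mod_cast (Nat.factorial_ne_zero _)
      have h5 := pow_ne_zero m hpi
      field_simp
    rw [h1, h3]
    ring

/-! ### Pole subtraction -/

/-- A function that agrees near each point of `U` with an analytic function, except possibly at the
point itself, has an analytic modification on `U`. -/
theorem exists_analytic_extension {R : ℂ → ℂ} {U : Set ℂ}
    (h : ∀ τ ∈ U, ∃ φ : ℂ → ℂ, AnalyticAt ℂ φ τ ∧ R =ᶠ[𝓝[≠] τ] φ) :
    ∃ g : ℂ → ℂ, ∀ τ ∈ U, AnalyticAt ℂ g τ ∧ g =ᶠ[𝓝[≠] τ] R := by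
  refine ⟨fun τ => limUnder (𝓝[≠] τ) R, fun τ hτ => ?_⟩
  have key : ∀ {φ : ℂ → ℂ} {z : ℂ}, AnalyticAt ℂ φ z → R =ᶠ[𝓝[≠] z] φ →
      limUnder (𝓝[≠] z) R = φ z := fun hφ hR =>
    Tendsto.limUnder_eq ((hφ.continuousAt.tendsto.mono_left nhdsWithin_le_nhds).congr' hR.symm)
  obtain ⟨φ, hφ, hR⟩ := h τ hτ
  have h1 : (fun τ => limUnder (𝓝[≠] τ) R) =ᶠ[𝓝[≠] τ] φ := by
    filter_upwards [eventually_eventually_nhdsWithin.2 hR, self_mem_nhdsWithin,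
      eventually_nhdsWithin_of_eventually_nhds hφ.eventually_analyticAt] with z hz hzτ hφz
    refine key hφz ?_
    rw [IsOpen.nhdsWithin_eq isOpen_compl_singleton hzτ] at hz
    exact hz.filter_mono nhdsWithin_le_nhds
  refine ⟨hφ.congr ?_, h1.trans hR.symm⟩
  rw [← nhdsNE_sup_pure, Filter.EventuallyEq, eventually_sup]
  exact ⟨h1.symm, by simpa using (key hφ hR).symm⟩

theorem tendsto_add_nhdsNE (τ c : ℂ) : Tendsto (fun z => z + c) (𝓝[≠] τ) (𝓝[≠] (τ + c)) := by
  refine tendsto_nhdsWithin_iff.2 ⟨?_, ?_⟩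
  · exact ((continuous_id.add continuous_const).tendsto τ).mono_left nhdsWithin_le_nhds
  · filter_upwards [self_mem_nhdsWithin] with z hz
    simpa using hz

theorem tendsto_zero_of_exp_decay {h : ℂ → ℂ} {T C : ℝ}
    (hC : ∀ τ : ℂ, T < τ.im → ‖h τ‖ ≤ C * Real.exp (-(2 * Real.pi) * τ.im)) :
    Tendsto h (comap im atTop) (𝓝 0) := by
  have h1 : Tendsto (fun y : ℝ => C * Real.exp (-(2 * Real.pi) * y)) atTop (𝓝 0) := by
    rw [← mul_zero C]
    refine (Real.tendsto_exp_atBot.comp ?_).const_mul C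
    exact tendsto_id.const_mul_atTop_of_neg (by linarith [Real.pi_pos])
  refine squeeze_zero_norm' ?_ (h1.comp tendsto_comap)
  filter_upwards [tendsto_comap.eventually (eventually_gt_atTop T)] with τ hτ
  exact hC τ hτ

theorem Decaying.tendsto_zero {P : Set ℂ} {h : ℂ → ℂ} (hh : Decaying P h) :
    Tendsto h (comap im atTop) (𝓝 0) := by
  obtain ⟨T, C, -, -, hC⟩ := hh.decay
  exact tendsto_zero_of_exp_decay hC

theorem exists_forall_im_of_eventually {p : ℂ → Prop} (h : ∀ᶠ τ in comap im atTop, p τ) :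
    ∃ T : ℝ, ∀ τ : ℂ, T < τ.im → p τ := by
  rw [eventually_comap] at h
  obtain ⟨T, hT⟩ := h.exists_forall_of_atTop
  exact ⟨T, fun τ hτ => hT _ hτ.le τ rfl⟩

instance comap_im_atTop_neBot : (comap im (atTop : Filter ℝ)).NeBot :=
  atTop_neBot.comap_of_surj im_surjective

theorem polarPart_add_int (f : ℂ → ℂ) (B : ℝ) (τ : ℂ) (n : ℤ) :
    polarPart f B (τ + n) = polarPart f B τ := by
  have : ∀ p, e (τ + n - p) = e (τ - p) := fun p => by
    rw [add_sub_right_comm, e_add_int]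
  simp only [polarPart, this]

theorem polarPart_eq_sum {f : ℂ → ℂ} {B : ℝ} (hfin : (polesAbove f B).Finite) (τ : ℂ) :
    polarPart f B τ = ∑ p ∈ hfin.toFinset, ∑ m ∈ Finset.Icc 1 (poleOrder f p),
      rStar f p m * polylogNeg (m - 1) (e (τ - p)) :=
  finsum_mem_eq_finite_toFinset_sum _ hfin

/-! ### Singularities and `q`-expansion of the pole-subtracted form -/

namespace IsMeromorphicModularForm

variable {k : ℤ} {f : ℂ → ℂ}

theorem finite_polesAbove (hf : IsMeromorphicModularForm k f) (hcusp : IsRegularAtCusp f) {B : ℝ}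
    (hB : 0 < B) : (polesAbove f B).Finite := by
  obtain ⟨T, -, -, hT, -⟩ := exists_im_le_of_mem_poles hf.1 hcusp
  refine (locFin_poles hf.1 1 B T hB).subset fun p hp => ⟨hp.1, ?_, hp.2.2.2, hT p hp.1⟩
  rw [abs_le]
  exact ⟨by linarith [hp.2.1], by linarith [hp.2.2.1]⟩

theorem translates_subset_poles (hf : IsMeromorphicModularForm k f) {p : ℂ} (hp : p ∈ poles f) :
    translates p ⊆ poles f := by
  rintro τ ⟨n, rfl⟩
  exact (hf.add_int_mem_poles_iff n).2 hp

theorem add_int_eq (hf : IsMeromorphicModularForm k f) {z : ℂ} (hz : 0 < z.im)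
    (hP : z ∉ poles f) (n : ℤ) : f (z + n) = f z := by
  induction n using Int.induction_on with
  | zero => simp
  | succ n ih =>
    rw [← ih, ← hf.add_one_eq (z := z + (n : ℤ)) (by simpa using hz)
      (by rwa [hf.add_int_mem_poles_iff])]
    push_cast; ring_nf
  | pred n ih =>
    rw [← ih, ← hf.add_one_eq (z := z + ((-n - 1 : ℤ) : ℂ)) (by simpa using hz)
      (by rwa [hf.add_int_mem_poles_iff])]
    push_cast; ring_nf

theorem regularized_add_int (hf : IsMeromorphicModularForm k f) (B : ℝ) {z : ℂ} (hz : 0 < z.im)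
    (hP : z ∉ poles f) (n : ℤ) : regularized f B (z + n) = regularized f B z := by
  rw [regularized, regularized, hf.add_int_eq hz hP, polarPart_add_int]

theorem tendsto_regularized (hf : IsMeromorphicModularForm k f) (hcusp : IsRegularAtCusp f)
    {B : ℝ} (hB : 0 < B) :
    Tendsto (regularized f B) (comap im atTop) (𝓝 (fourierCoeff f 0)) := by
  have h1 := (hf.decaying hcusp).tendsto_zero.add_const (fourierCoeff f 0)
  have h2 : Tendsto (polarPart f B) (comap im atTop) (𝓝 0) := by
    rw [show polarPart f B = _ from funext (polarPart_eq_sum (hf.finite_polesAbove hcusp hB))]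
    rw [← Finset.sum_const_zero (s := (hf.finite_polesAbove hcusp hB).toFinset)]
    refine tendsto_finsetSum _ fun p _ => ?_
    rw [← Finset.sum_const_zero (s := Finset.Icc 1 (poleOrder f p))]
    refine tendsto_finsetSum _ fun m _ => ?_
    simpa using (decaying_polylogNeg (m - 1) p).tendsto_zero.const_mul (rStar f p m)
  have h3 := h1.sub h2
  simp only [sub_add_cancel, zero_add, sub_zero] at h3
  exact h3

theorem analyticAt_regularized (hf : IsMeromorphicModularForm k f) (hcusp : IsRegularAtCusp f)
    {B : ℝ} (hB : 0 < B) {τ : ℂ} (hτ : 0 < τ.im) (hP : τ ∉ poles f) :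
    AnalyticAt ℂ (regularized f B) τ := by
  refine (analyticAt_of_notMem_poles hf.1 hτ hP).fun_sub ?_
  rw [show polarPart f B = _ from funext (polarPart_eq_sum (hf.finite_polesAbove hcusp hB))]
  refine Finset.analyticAt_fun_sum _ fun p hp => Finset.analyticAt_fun_sum _ fun m _ =>
    analyticAt_const.mul (analyticAt_polylogNeg_e _ fun h => hP ?_)
  exact hf.translates_subset_poles ((Set.Finite.mem_toFinset _).1 hp).1 h

/-- `V_B` is half-open of width one. Consequently the terms of `P_B f` for the other poles are
regular at a given pole in `V_B`. -/
theorem eq_of_mem_translates {f : ℂ → ℂ} {B : ℝ} {p q : ℂ} (hp : p ∈ polesAbove f B)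
    (hq : q ∈ polesAbove f B) (h : p ∈ translates q) : p = q := by
  obtain ⟨n, rfl⟩ := h
  have h1 := hp.2.1
  have h2 := hp.2.2.1
  simp only [add_re, intCast_re] at h1 h2
  have h3 : (n : ℝ) < 1 := by linarith [hq.2.1]
  have h4 : (-1 : ℝ) < n := by linarith [hq.2.2.1]
  have h5 : n < 1 := by exact_mod_cast h3
  have h6 : -1 < n := by exact_mod_cast h4
  have : n = 0 := by omega
  simp [this]

/-- `R_B f` has removable singularities at the poles of `f` in `V_B`. -/
theorem exists_analytic_regularized_polesAbove (hf : IsMeromorphicModularForm k f)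
    (hcusp : IsRegularAtCusp f) {B : ℝ} (hB : 0 < B) {p : ℂ} (hp : p ∈ polesAbove f B) :
    ∃ φ : ℂ → ℂ, AnalyticAt ℂ φ p ∧ regularized f B =ᶠ[𝓝[≠] p] φ := by
  have hfin := hf.finite_polesAbove hcusp hB
  obtain ⟨φ, hφ, h⟩ := exists_analytic_sub_polylog (hf.1 hp.1.1).meromorphicAt hp.1.2
  refine ⟨fun z => φ z - ∑ q ∈ hfin.toFinset.erase p, ∑ m ∈ Finset.Icc 1 (poleOrder f q),
    rStar f q m * polylogNeg (m - 1) (e (z - q)), ?_, ?_⟩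
  · refine hφ.fun_sub (Finset.analyticAt_fun_sum _ fun q hq => Finset.analyticAt_fun_sum _
      fun m _ => analyticAt_const.mul (analyticAt_polylogNeg_e _ fun hpq => ?_))
    obtain ⟨h1, h2⟩ := Finset.mem_erase.1 hq
    exact h1 (eq_of_mem_translates hp (hfin.mem_toFinset.1 h2) hpq).symm
  · filter_upwards [h] with z hz
    rw [regularized, polarPart_eq_sum hfin, ← hz,
      ← Finset.add_sum_erase _ _ (hfin.mem_toFinset.2 hp)]
    ring

theorem exists_analytic_regularized (hf : IsMeromorphicModularForm k f)
    (hcusp : IsRegularAtCusp f) {B : ℝ} (hB : 0 < B) {τ : ℂ} (hτ : 0 < τ.im)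
    (h : τ ∈ poles f → B ≤ τ.im) :
    ∃ φ : ℂ → ℂ, AnalyticAt ℂ φ τ ∧ regularized f B =ᶠ[𝓝[≠] τ] φ := by
  by_cases hP : τ ∈ poles f
  -- Translation by `-n` moves `τ` to `-1/2 ≤ re < 1/2`, and `R_B f` is periodic.
  · set n : ℤ := ⌊τ.re + 1 / 2⌋ with hn
    have hp : τ + ((-n : ℤ) : ℂ) ∈ polesAbove f B := by
      refine ⟨(hf.add_int_mem_poles_iff _).2 hP, ?_, ?_, ?_⟩
      · have := Int.floor_le (τ.re + 1 / 2)
        simp only [add_re, neg_re, intCast_re, Int.cast_neg]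
        linarith
      · have := Int.lt_floor_add_one (τ.re + 1 / 2)
        simp only [add_re, neg_re, intCast_re, Int.cast_neg]
        linarith
      · simpa using h hP
    obtain ⟨φ, hφ, hev⟩ := hf.exists_analytic_regularized_polesAbove hcusp hB hp
    refine ⟨fun z => φ (z + ((-n : ℤ) : ℂ)), hφ.fun_comp (f := fun z => z + ((-n : ℤ) : ℂ))
      (by fun_prop), ?_⟩
    filter_upwards [(tendsto_add_nhdsNE τ ((-n : ℤ) : ℂ)).eventually hev,
      eventually_notMem_poles hf.1 hτ, eventually_nhdsWithin_of_eventually_nhds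
        (isOpen_im_pos.mem_nhds hτ)] with z hz hzP hz0
    rw [← hz, hf.regularized_add_int B hz0 hzP]
  · exact ⟨_, hf.analyticAt_regularized hcusp hB hτ hP, EventuallyEq.rfl⟩

/-- An admissible height separates the high poles of `f` from the low ones, also after `B ↦ 1/B`. -/
theorem exists_gap (hf : IsMeromorphicModularForm k f) {B : ℝ} (hB : IsAdmissible f B) :
    ∃ y₀ > 0, y₀ < B ∧ y₀ < B⁻¹ ∧ ∀ p ∈ poles f, y₀ < p.im → B < p.im := by
  obtain ⟨hB0, hhigh, hne⟩ := hB
  -- By admissibility such a pole is below `√3/2`, so it has a high partner `q` with `p.im * q.im ≤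
  -- 1`; as `q.im > B`, this forces `p.im < 1/B`.
  have hlow : ∀ p ∈ poles f, p.im ≤ B → p.im < min B B⁻¹ := by
    intro p hp hle
    have h1 : p.im < √3 / 2 := by
      by_contra! h
      exact absurd (hhigh p hp h) (not_lt.2 hle)
    obtain ⟨q, hq, hq1, hq2⟩ := hf.exists_high_pole hp h1
    have h2 := hhigh q hq hq1
    refine lt_min (lt_of_le_of_ne hle (hne p hp)) ?_
    rw [← one_div, lt_div_iff₀ hB0]
    exact (mul_lt_mul_of_pos_left h2 hp.1).trans_le hq2
  set b := min B B⁻¹ with hb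
  have hb0 : 0 < b := lt_min hB0 (inv_pos.2 hB0)
  -- Modulo translation finitely many poles have height between `b/2` and `B`, all of them strictly
  -- below `b`, so some `y₀ < b` exceeds them all.
  have hfin := locFin_poles hf.1 1 (b / 2) B (half_pos hb0)
  have hev : ∀ᶠ y : ℝ in 𝓝[<] b, ∀ p ∈ {p ∈ poles f | |p.re| ≤ 1 ∧ b / 2 ≤ p.im ∧ p.im ≤ B},
      p.im < y := by
    rw [eventually_all_finite hfin]
    intro p hp
    exact mem_nhdsWithin_of_mem_nhds (Ioi_mem_nhds (hlow p hp.1 hp.2.2.2))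
  have hev2 : ∀ᶠ y : ℝ in 𝓝[<] b, b / 2 < y :=
    mem_nhdsWithin_of_mem_nhds (Ioi_mem_nhds (half_lt_self hb0))
  obtain ⟨y₀, h1, h2, h3⟩ := (hev.and (hev2.and self_mem_nhdsWithin)).exists
  refine ⟨y₀, (half_pos hb0).trans h2, lt_of_lt_of_le h3 (min_le_left _ _),
    lt_of_lt_of_le h3 (min_le_right _ _), fun p hp hy => ?_⟩
  by_contra! hle
  have h4 := h1 (p + ((-⌊p.re⌋ : ℤ) : ℂ)) ⟨(hf.add_int_mem_poles_iff _).2 hp, ?_, ?_, ?_⟩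
  · simp at h4
    linarith
  · have e1 := Int.floor_le p.re
    have e2 := Int.lt_floor_add_one p.re
    rw [abs_le]
    simp only [add_re, neg_re, intCast_re, Int.cast_neg]
    constructor <;> linarith
  · simp; linarith
  · simpa using hle

/-- The pole-subtracted form extends holomorphically to `Im τ > y₀`, with `q`-expansion given by
its Fourier coefficients. -/
theorem exists_regularized_expansion (hf : IsMeromorphicModularForm k f)
    (hcusp : IsRegularAtCusp f) {B y₀ : ℝ} (hB : 0 < B) (hy₀ : 0 < y₀)
    (hgap : ∀ p ∈ poles f, y₀ < p.im → B < p.im) :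
    ∃ (g : ℂ → ℂ) (c : ℕ → ℂ), (∀ τ : ℂ, y₀ < τ.im → DifferentiableAt ℂ g τ) ∧
      (∀ τ : ℂ, y₀ < τ.im → τ ∉ poles f → regularized f B τ = g τ) ∧
      (∀ τ : ℂ, y₀ < τ.im → HasSum (fun n : ℕ => c n * e (n * τ)) (g τ)) ∧
      c 0 = fourierCoeff f 0 ∧ coeffR f B = extendZero c ∧
      IsFourierExpansion (regularized f B) (coeffR f B) := by
  obtain ⟨g, hg⟩ := exists_analytic_extension (R := regularized f B) (U := {τ : ℂ | y₀ < τ.im})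
    fun τ hτ => hf.exists_analytic_regularized hcusp hB (hy₀.trans hτ)
      fun hP => (hgap τ hP hτ).le
  obtain ⟨T, hT0, -, hT, -⟩ := exists_im_le_of_mem_poles hf.1 hcusp
  have hd : ∀ τ : ℂ, y₀ < τ.im → DifferentiableAt ℂ g τ := fun τ hτ =>
    (hg τ hτ).1.differentiableAt
  have heq : ∀ τ : ℂ, y₀ < τ.im → τ ∉ poles f → regularized f B τ = g τ := fun τ hτ hP =>
    (((hf.analyticAt_regularized hcusp hB (hy₀.trans hτ)
      hP).continuousAt.eventuallyEq_nhds_iff_eventuallyEq_nhdsNE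
        (hg τ hτ).1.continuousAt).1 (hg τ hτ).2.symm).self_of_nhds
  have hper : ∀ τ : ℂ, y₀ < τ.im → g (τ + 1) = g τ := by
    intro τ hτ
    have hτ1 : y₀ < (τ + 1).im := by simpa using hτ
    have h1 : (fun z => g (z + 1)) =ᶠ[𝓝[≠] τ] g := by
      filter_upwards [(tendsto_add_nhdsNE τ 1).eventually (hg _ hτ1).2, (hg τ hτ).2,
        eventually_notMem_poles hf.1 (hy₀.trans hτ), eventually_nhdsWithin_of_eventually_nhds
          (isOpen_im_pos.mem_nhds (hy₀.trans hτ))] with z hz1 hz2 hz3 hz4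
      rw [hz1, hz2]
      simpa using hf.regularized_add_int B hz4 hz3 1
    refine ((ContinuousAt.eventuallyEq_nhds_iff_eventuallyEq_nhdsNE ?_
      (hg τ hτ).1.continuousAt).1 h1).self_of_nhds
    exact ContinuousAt.comp (f := fun z => z + 1) (hg _ hτ1).1.continuousAt (by fun_prop)
  have hlim : Tendsto g (comap im atTop) (𝓝 (fourierCoeff f 0)) := by
    refine (hf.tendsto_regularized hcusp hB).congr' ?_
    filter_upwards [tendsto_comap.eventually (eventually_gt_atTop T),
      tendsto_comap.eventually (eventually_gt_atTop y₀)] with τ h1 h2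
    exact heq τ h2 fun h => absurd (hT τ h) (not_le.2 h1)
  obtain ⟨c, hc⟩ := exists_hasSum_e hd hper (by
    obtain ⟨T', hT'⟩ := exists_forall_im_of_eventually
      (hlim.norm.eventually (gt_mem_nhds (lt_add_one _)))
    exact ⟨_, T', fun τ hτ => (hT' τ hτ).le⟩)
  -- The polylogarithms vanish at the cusp, so subtracting them does not change the constant term.
  have hc0 : c 0 = fourierCoeff f 0 := by
    refine tendsto_nhds_unique ?_ hlim
    obtain ⟨C, hC⟩ := exists_exp_decay hc (lt_add_one y₀)
    simpa using (tendsto_zero_of_exp_decay fun τ hτ => hC τ hτ.le).add_const (c 0)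
  have hexp : IsFourierExpansion (regularized f B) (extendZero c) := by
    refine ⟨max T y₀, fun τ hτ => hasSum_extendZero ?_⟩
    rw [heq τ ((le_max_right _ _).trans_lt hτ) fun h =>
      absurd (hT τ h) (not_le.2 ((le_max_left _ _).trans_lt hτ))]
    exact hc τ ((le_max_right _ _).trans_lt hτ)
  have hco : coeffR f B = extendZero c := fourierCoeff_eq hexp
  exact ⟨g, c, hd, heq, hc, hc0, hco, hco ▸ hexp⟩

end IsMeromorphicModularForm

/-! ### The explicit formula -/

theorem mellinIntegrand_add (s : ℂ) (h h' : ℂ → ℂ) (τ : ℂ) :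
    mellinIntegrand s (fun τ => h τ + h' τ) τ = mellinIntegrand s h τ + mellinIntegrand s h' τ := by
  simp only [mellinIntegrand]; ring

theorem mellinIntegrand_sum {ι : Type*} (s : ℂ) (S : Finset ι) (w : ι → ℂ) (h : ι → ℂ → ℂ) (τ : ℂ) :
    mellinIntegrand s (fun τ => ∑ i ∈ S, w i * h i τ) τ =
      ∑ i ∈ S, w i * mellinIntegrand s (h i) τ := by
  simp only [mellinIntegrand, Finset.mul_sum, Finset.sum_div]
  exact Finset.sum_congr rfl fun i _ => by ring

/-- Splitting `h`, above the height `a`, into a holomorphic function and functions with fewer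
poles. -/
theorem Decaying.upperIntegral_eq {P : Set ℂ} {h g : ℂ → ℂ} (hh : Decaying P h) {a y₀ C : ℝ}
    (hy₀ : 0 < y₀) (ha : y₀ < a) (haP : (a * I : ℂ) ∉ P) {ι : Type*} (S : Finset ι) (w : ι → ℂ)
    {Q : ι → Set ℂ} {ψ : ι → ℂ → ℂ} (hψ : ∀ i ∈ S, Decaying (Q i) (ψ i))
    (hQ : ∀ i ∈ S, Q i ⊆ P) (hg : ∀ τ : ℂ, y₀ < τ.im → DifferentiableAt ℂ g τ)
    (hC : ∀ τ : ℂ, a ≤ τ.im → ‖g τ‖ ≤ C * Real.exp (-(2 * Real.pi) * τ.im))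
    (hsplit : ∀ τ : ℂ, y₀ < τ.im → τ ∉ P → h τ = g τ + ∑ i ∈ S, w i * ψ i τ) (s : ℂ) :
    upperIntegral P h a s = (∫ t in Ioi a, (t : ℂ) ^ (s - 1) * g (t * I)) +
      ∑ i ∈ S, w i * upperIntegral (Q i) (ψ i) a s := by
  have ha0 := hy₀.trans ha
  have hint := (mellin_truncated (h := g) (C := C) ha0
    (fun t ht => (hg _ (by simpa using ha.trans_le ht)).continuousAt)
    fun t ht => by simpa using hC (t * I) (by simpa using ht)).1 s
  have hQa : ∀ i ∈ S, (a * I : ℂ) ∉ Q i := fun i hi h => haP (hQ i hi h)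
  refine tendsto_nhds_unique (hh.tendsto ha0 haP s) (Tendsto.congr' ?_
    ((intervalIntegral_tendsto_integral_Ioi a hint tendsto_id).add (tendsto_finsetSum S
      fun i hi => ((hψ i hi).tendsto ha0 (hQa i hi) s).const_mul (w i))))
  filter_upwards [hh.eventually_endpoints ha0 haP, eventually_gt_atTop y₀] with Λ hΛ hΛ0
  have hψP : ∀ i ∈ S, HolOff P (mellinIntegrand s (ψ i)) := fun i hi =>
    ((hψ i hi).holOff.mono (hQ i hi)).mellinIntegrand s
  have hsum : HolOff P fun τ => ∑ i ∈ S, w i * ψ i τ :=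
    HolOff.sum fun i hi => ((hψ i hi).holOff.mono (hQ i hi)).const_mul (w i)
  have hdiff := hh.holOff.sub hsum
  have h1 : axisIntegral P (mellinIntegrand s h) a Λ =
      axisIntegral P (mellinIntegrand s fun τ => h τ - ∑ i ∈ S, w i * ψ i τ) a Λ +
        axisIntegral P (mellinIntegrand s fun τ => ∑ i ∈ S, w i * ψ i τ) a Λ := by
    rw [← axisIntegral_add hΛ (hdiff.mellinIntegrand s) (hsum.mellinIntegrand s)]
    refine axisIntegral_congr hΛ fun τ _ _ => ?_
    rw [← mellinIntegrand_add]
    simp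
  have h2 : axisIntegral P (mellinIntegrand s fun τ => ∑ i ∈ S, w i * ψ i τ) a Λ =
      ∑ i ∈ S, w i * axisIntegral (Q i) (mellinIntegrand s (ψ i)) a Λ := by
    rw [funext (mellinIntegrand_sum s S w ψ), axisIntegral_sum hΛ S fun i hi =>
      (hψP i hi).const_mul (w i)]
    refine Finset.sum_congr rfl fun i hi => ?_
    rw [axisIntegral_const_mul, axisIntegral_mono hΛ (hQ i hi)
      ((hψ i hi).holOff.mellinIntegrand s)]
  have h3 : axisIntegral P (mellinIntegrand s fun τ => h τ - ∑ i ∈ S, w i * ψ i τ) a Λ =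
      ∫ t in a..Λ, (t : ℂ) ^ (s - 1) * g (t * I) := by
    rw [axisIntegral_eq_intervalIntegral (g' := mellinIntegrand s g) hΛ (hdiff.mellinIntegrand s)
      ha hΛ0 (fun τ hτ => differentiableAt_mellinIntegrand s (hy₀.trans hτ) (hg τ hτ)) ?_,
      I_mul_integral_mellinIntegrand s g ha0 hΛ.right_pos]
    intro τ _ h1 h2
    simp only [mellinIntegrand]
    rw [hsplit τ h1 h2, add_sub_cancel_right]
  rw [h1, h2, h3]
  rfl

theorem integral_cpow_mul_exp (s : ℂ) {r : ℝ} (hr : 0 < r) {a : ℝ} (ha : 0 < a) :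
    ∫ t in Ioi a, (t : ℂ) ^ (s - 1) * Complex.exp (-(r * t)) = upperGamma s (r * a) / (r : ℂ) ^ s := by
  have hr0 : (r : ℂ) ≠ 0 := by exact_mod_cast hr.ne'
  have h1 := integral_comp_mul_left_Ioi
    (fun u : ℝ => (u : ℂ) ^ (s - 1) * Complex.exp (-u)) a hr
  have h2 : ∫ t in Ioi a, (((r * t : ℝ) : ℂ) ^ (s - 1) * Complex.exp (-((r * t : ℝ) : ℂ))) =
      (r : ℂ) ^ (s - 1) * ∫ t in Ioi a, (t : ℂ) ^ (s - 1) * Complex.exp (-(r * t)) := by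
    rw [← integral_const_mul]
    refine setIntegral_congr_fun measurableSet_Ioi fun t ht => ?_
    have ht0 : 0 ≤ t := (ha.trans ht).le
    rw [ofReal_mul, mul_cpow_ofReal_nonneg hr.le ht0, mul_assoc]
  rw [h2, real_smul, cpow_sub _ _ hr0, cpow_one] at h1
  rw [upperGamma]
  have h3 : (r : ℂ) ^ s ≠ 0 := by simp [cpow_eq_zero_iff, hr0]
  push_cast at h1
  field_simp at h1 ⊢
  linear_combination h1

/-- Termwise Mellin integration; each term becomes an incomplete gamma value by the substitution in
`integral_cpow_mul_exp`. -/
theorem hasSum_upperGamma {g : ℂ → ℂ} {c : ℕ → ℂ} {y₀ a : ℝ}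
    (h : ∀ τ : ℂ, y₀ < τ.im → HasSum (fun n : ℕ => c n * e (n * τ)) (g τ)) (hy₀ : 0 < y₀)
    (ha : y₀ < a) (s : ℂ) :
    HasSum (fun n : ℕ => c (n + 1) * (upperGamma s (2 * Real.pi * (n + 1) * a) /
      (2 * Real.pi * (n + 1) : ℂ) ^ s)) (∫ t in Ioi a, (t : ℂ) ^ (s - 1) * (g (t * I) - c 0)) := by
  have ha0 := hy₀.trans ha
  set F : ℕ → ℝ → ℂ := fun n t => (t : ℂ) ^ (s - 1) * (c (n + 1) * e ((n + 1 : ℕ) * (t * I)))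
  have hnorm : ∀ (n : ℕ) (t : ℝ), ‖e ((n + 1 : ℕ) * (t * I))‖ =
      Real.exp (-(2 * Real.pi) * (n * t)) * Real.exp (-(2 * Real.pi) * t) := fun n t => by
    rw [norm_e, ← Real.exp_add]
    congr 1
    simp
    ring
  have hF : ∀ n, IntegrableOn (F n) (Ioi a) := fun n => by
    refine (mellin_truncated (h := fun τ => c (n + 1) * e ((n + 1 : ℕ) * τ)) (C := ‖c (n + 1)‖) ha0
      (fun t _ => ?_) fun t ht => ?_).1 s
    · exact (continuous_const.mul (differentiable_e.continuous.comp
        (continuous_const.mul continuous_id))).continuousAt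
    · rw [norm_mul, hnorm]
      refine mul_le_mul_of_nonneg_left ?_ (norm_nonneg _)
      refine mul_le_of_le_one_left (Real.exp_pos _).le (Real.exp_le_one_iff.2 ?_)
      have : 0 ≤ (n : ℝ) * t := mul_nonneg n.cast_nonneg (ha0.le.trans ht)
      nlinarith [Real.pi_pos]
  have hK : IntegrableOn (fun t : ℝ => (t : ℂ) ^ (s - 1) * e (t * I)) (Ioi a) :=
    (mellin_truncated (h := e) (C := 1) ha0 (fun t _ => differentiable_e.continuous.continuousAt)
      fun t _ => by rw [norm_e, one_mul]; simp).1 s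
  set K : ℝ := ∫ t in Ioi a, ‖(t : ℂ) ^ (s - 1) * e (t * I)‖
  -- One factor `exp(-2πt)` is kept to make `K` finite and the other `n` are bounded at `t = a`;
  -- what remains is the absolutely convergent series at height `a`.
  have hle : ∀ n, ∫ t in Ioi a, ‖F n t‖ ≤
      ‖c (n + 1)‖ * Real.exp (-(2 * Real.pi) * ((n + 1 : ℕ) * a)) * (Real.exp (2 * Real.pi * a) * K) := by
    intro n
    rw [← mul_assoc, ← integral_const_mul]
    refine setIntegral_mono_on (hF n).norm (hK.norm.const_mul _) measurableSet_Ioi fun t ht => ?_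
    have e1 : Real.exp (-(2 * Real.pi) * ((n + 1 : ℕ) * a)) * Real.exp (2 * Real.pi * a) =
        Real.exp (-(2 * Real.pi) * (n * a)) := by
      rw [← Real.exp_add]; congr 1; push_cast; ring
    have e2 : Real.exp (-(2 * Real.pi) * (n * t)) ≤ Real.exp (-(2 * Real.pi) * (n * a)) := by
      refine Real.exp_le_exp.2 ?_
      have : (n : ℝ) * a ≤ n * t := mul_le_mul_of_nonneg_left (le_of_lt ht) n.cast_nonneg
      nlinarith [Real.pi_pos]
    rw [mul_assoc ‖c (n + 1)‖, e1]
    simp only [F]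
    rw [norm_mul, norm_mul, hnorm, norm_mul, norm_e (t * I),
      show ((t : ℂ) * I).im = t by simp]
    calc _ = ‖(t : ℂ) ^ (s - 1)‖ * ‖c (n + 1)‖ * Real.exp (-(2 * Real.pi) * t) *
          Real.exp (-(2 * Real.pi) * (n * t)) := by ring
      _ ≤ ‖(t : ℂ) ^ (s - 1)‖ * ‖c (n + 1)‖ * Real.exp (-(2 * Real.pi) * t) *
          Real.exp (-(2 * Real.pi) * (n * a)) := mul_le_mul_of_nonneg_left e2 (by positivity)
      _ = _ := by ring
  have hsum : Summable fun n => ∫ t in Ioi a, ‖F n t‖ :=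
    Summable.of_nonneg_of_le (fun n => integral_nonneg fun t => norm_nonneg _) hle
      (((summable_nat_add_iff 1).2 (summable_norm_of_hasSum_e h ha)).mul_right _)
  have hmain := hasSum_integral_of_summable_integral_norm hF hsum
  have e3 : ∫ t in Ioi a, ∑' n, F n t = ∫ t in Ioi a, (t : ℂ) ^ (s - 1) * (g (t * I) - c 0) := by
    refine setIntegral_congr_fun measurableSet_Ioi fun t ht => ?_
    have h1 := (hasSum_nat_add_iff' 1).2 (h (t * I) (by simpa using ha.trans ht))
    have h2 := (h1.mul_left ((t : ℂ) ^ (s - 1))).tsum_eq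
    simp only [Finset.range_one, Finset.sum_singleton, Nat.cast_zero, zero_mul] at h2
    rw [show ∑' n, F n t = _ from h2]
    simp [e]
  rw [e3] at hmain
  refine hmain.congr_fun fun n => ?_
  have hr : 0 < 2 * Real.pi * ((n : ℝ) + 1) := by positivity
  have e4 := integral_cpow_mul_exp s hr ha0
  push_cast at e4
  rw [← e4, ← integral_const_mul]
  refine setIntegral_congr_fun measurableSet_Ioi fun t _ => ?_
  simp only [F, e]
  rw [mul_left_comm]
  congr 3
  push_cast
  linear_combination -(2 * Real.pi * (n + 1) * t : ℂ) * I_mul_I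

theorem hasSum_int_ne_zero {v : ℂ} {F : {n : ℤ // n ≠ 0} → ℂ} (hneg : ∀ n, n.1 < 0 → F n = 0)
    (h : HasSum (fun n : ℕ => F ⟨n + 1, by omega⟩) v) : HasSum F v := by
  refine (Function.Injective.hasSum_iff (g := fun n : ℕ => (⟨n + 1, by omega⟩ : {n : ℤ // n ≠ 0}))
    (fun m n hmn => ?_) fun n hn => hneg n ?_).1 h
  · simpa using hmn
  · by_contra! h0
    refine hn ⟨(n.1 - 1).toNat, Subtype.ext ?_⟩
    have := n.2
    show (((n.1 - 1).toNat : ℕ) : ℤ) + 1 = n.1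
    omega

theorem hasPolylogIntegral {N : ℕ} {p : ℂ} {A : ℝ} (hA : 0 < A) (hAp : (A * I : ℂ) ∉ translates p)
    (s : ℂ) : HasPolylogIntegral N s p A (polylogIntegral N s p A) ∧
      polylogIntegral N s p A =
        upperIntegral (translates p) (fun τ => polylogNeg N (e (τ - p))) A s := by
  have h := (decaying_polylogNeg N p).hasRegIntegral hA hAp s
  have h' : polylogIntegral N s p A = _ := h.regIntegral_eq
  exact ⟨by rw [h']; exact h, h'⟩

namespace IsMeromorphicModularForm

variable {k : ℤ} {f : ℂ → ℂ}

theorem explicit_formula (hf : IsMeromorphicModularForm k f) (hcusp : IsRegularAtCusp f) {B : ℝ}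
    (hB : IsAdmissible f B) :
    (polesAbove f B).Finite ∧
      (IsFourierExpansion (regularized f B) (coeffR f B) ∧ ∀ n : ℤ, n < 0 → coeffR f B n = 0) ∧
      (∀ s : ℂ, Summable fun n : {n : ℤ // n ≠ 0} => gammaTerm f k B s n) ∧
      (∀ p ∈ polesAbove f B, ∀ (N : ℕ) (s : ℂ),
        HasPolylogIntegral N s p B (polylogIntegral N s p B) ∧
        HasPolylogIntegral N s p (1 / B) (polylogIntegral N s p (1 / B))) ∧
      Differentiable ℂ (regularPart f k B) ∧
      ∀ s ∉ exceptional f k, regL f k s = polarTerm f k B s + regularPart f k B s := by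
  have hB0 := hB.1
  have hBi : 0 < B⁻¹ := inv_pos.2 hB0
  have hfin := hf.finite_polesAbove hcusp hB0
  obtain ⟨y₀, hy₀, hyB, hyBi, hgap⟩ := hf.exists_gap hB
  obtain ⟨g, c, hgd, hgR, hgs, hc0, hco, hexp⟩ := hf.exists_regularized_expansion hcusp hB0 hy₀ hgap
  have hneg : ∀ n : ℤ, n < 0 → coeffR f B n = 0 := fun n hn => by
    simp [hco, extendZero, not_le.2 hn]
  have hBP : (B * I : ℂ) ∉ poles f := fun h => hB.2.2 _ h (by simp)
  have hBiP := hf.inv_notMem hB0 hBP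
  have hsub : ∀ p ∈ polesAbove f B, translates p ⊆ poles f := fun p hp =>
    hf.translates_subset_poles hp.1
  have hpoly : ∀ p ∈ polesAbove f B, ∀ (N : ℕ) (s : ℂ),
      (HasPolylogIntegral N s p B (polylogIntegral N s p B) ∧ polylogIntegral N s p B =
        upperIntegral (translates p) (fun τ => polylogNeg N (e (τ - p))) B s) ∧
      HasPolylogIntegral N s p B⁻¹ (polylogIntegral N s p B⁻¹) ∧ polylogIntegral N s p B⁻¹ =
        upperIntegral (translates p) (fun τ => polylogNeg N (e (τ - p))) B⁻¹ s := fun p hp N s =>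
    ⟨hasPolylogIntegral hB0 (fun h => hBP (hsub p hp h)) s,
      hasPolylogIntegral hBi (fun h => hBiP (hsub p hp h)) s⟩
  set G : ℝ → ℂ → ℂ := fun A s => ∫ t in Ioi A, (t : ℂ) ^ (s - 1) * (g (t * I) - c 0) with hG
  -- This serves both `A = B` and `A = 1/B` with the same `P_B f`: up to translation, the poles in
  -- `V_B` are all the poles above `y₀`.
  have hupper : ∀ (A : ℝ) (s : ℂ), y₀ < A → (A * I : ℂ) ∉ poles f →
      upperIntegral (poles f) (fun τ => f τ - fourierCoeff f 0) A s = G A s +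
        ∑ p ∈ hfin.toFinset, ∑ m ∈ Finset.Icc 1 (poleOrder f p), rStar f p m *
          upperIntegral (translates p) (fun τ => polylogNeg (m - 1) (e (τ - p))) A s := by
    intro A s hA hAP
    obtain ⟨C, hC⟩ := exists_exp_decay hgs hA
    rw [Finset.sum_sigma']
    refine (hf.decaying hcusp).upperIntegral_eq hy₀ hA hAP
      (hfin.toFinset.sigma fun p => Finset.Icc 1 (poleOrder f p))
      (fun i => rStar f i.1 i.2) (Q := fun i => translates i.1)
      (ψ := fun i τ => polylogNeg (i.2 - 1) (e (τ - i.1)))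
      (fun i _ => decaying_polylogNeg _ _)
      (fun i hi => hsub _ (hfin.mem_toFinset.1 (Finset.mem_sigma.1 hi).1))
      (fun τ hτ => (hgd τ hτ).sub_const _) hC (fun τ hτ hP => ?_) s
    rw [← hgR τ hτ hP, regularized, polarPart_eq_sum hfin, hc0, Finset.sum_sigma']
    ring
  have hsum : ∀ s, HasSum (fun n : {n : ℤ // n ≠ 0} => gammaTerm f k B s n)
      (G B s + I ^ k * G B⁻¹ (k - s)) := by
    intro s
    refine hasSum_int_ne_zero (fun n hn => by simp [gammaTerm, hneg _ hn])
      (((hasSum_upperGamma hgs hy₀ hyB s).add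
        ((hasSum_upperGamma hgs hy₀ hyBi (k - s)).mul_left (I ^ k))).congr_fun fun n => ?_)
    have h1 : extendZero c ((n : ℤ) + 1) = c (n + 1) := by
      have : (0 : ℤ) ≤ n + 1 := by omega
      simp only [extendZero, if_pos this]
      congr 1
    simp only [gammaTerm, hco, h1]
    push_cast
    rw [div_eq_mul_inv (2 * Real.pi * ((n : ℝ) + 1)) B]
    ring
  -- The right-hand side is the entire part of `splitL`, so both the holomorphy of `regularPart` and
  -- the formula for `regL` follow.
  have hreg : ∀ s, regularPart f k B s =
      upperIntegral (poles f) (fun τ => f τ - fourierCoeff f 0) B s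
        + I ^ k * upperIntegral (poles f) (fun τ => f τ - fourierCoeff f 0) B⁻¹ ((k : ℂ) - s) := by
    intro s
    rw [regularPart, (hsum s).tsum_eq, hupper B s hyB hBP, hupper B⁻¹ _ hyBi hBiP, polylogPart,
      finsum_mem_eq_finite_toFinset_sum _ hfin]
    have : ∀ p ∈ hfin.toFinset, ∑ m ∈ Finset.Icc 1 (poleOrder f p),
        rStar f p m * (polylogIntegral (m - 1) s p B
          + I ^ k * polylogIntegral (m - 1) ((k : ℂ) - s) p (1 / B)) =
        (∑ m ∈ Finset.Icc 1 (poleOrder f p), rStar f p m *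
          upperIntegral (translates p) (fun τ => polylogNeg (m - 1) (e (τ - p))) B s) +
        I ^ k * ∑ m ∈ Finset.Icc 1 (poleOrder f p), rStar f p m *
          upperIntegral (translates p) (fun τ => polylogNeg (m - 1) (e (τ - p))) B⁻¹ (k - s) := by
      intro p hp
      have hp' := hfin.mem_toFinset.1 hp
      rw [Finset.mul_sum, ← Finset.sum_add_distrib]
      refine Finset.sum_congr rfl fun m _ => ?_
      rw [one_div, (hpoly p hp' _ _).1.2, (hpoly p hp' _ _).2.2]
      ring
    rw [Finset.sum_congr rfl this, Finset.sum_add_distrib, ← Finset.mul_sum]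
    ring
  refine ⟨hfin, ⟨hexp, hneg⟩, fun s => (hsum s).summable, fun p hp N s => ?_, ?_, fun s hs => ?_⟩
  · rw [one_div]
    exact ⟨(hpoly p hp N s).1.1, (hpoly p hp N s).2.1⟩
  · rw [show regularPart f k B = _ from funext hreg]
    have hD := hf.decaying hcusp
    exact (hD.differentiable_upperIntegral hB0 hBP).add
      (((hD.differentiable_upperIntegral hBi hBiP).comp
        (differentiable_id.const_sub (k : ℂ))).const_mul (I ^ k))
  · rw [hreg, hf.regL_eq hcusp hB0 hBP hs, splitL]

end IsMeromorphicModularForm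

end MeroL

end

/-! ### The main theorem -/

theorem theorem1 (k : ℤ) (f : ℂ → ℂ) (hf : MeroL.IsMeromorphicModularForm k f)
    (hcusp : MeroL.IsRegularAtCusp f) :
    -- the Fourier expansion of `f` has no negative powers of `q`
    (MeroL.IsFourierExpansion f (MeroL.fourierCoeff f) ∧
      ∀ n : ℤ, n < 0 → MeroL.fourierCoeff f n = 0) ∧
    -- the regularized L-integral exists
    MeroL.IsRegLIntegral f k (MeroL.regL f k) ∧
    -- its polar part, for any `B > 0`
    (∀ B : ℝ, 0 < B → ∃ R : ℂ → ℂ, Differentiable ℂ R ∧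
      ∀ s ∉ MeroL.exceptional f k, MeroL.regL f k s = MeroL.polarTerm f k B s + R s) ∧
    -- the explicit expression, for admissible `B`
    (∀ B : ℝ, MeroL.IsAdmissible f B →
      (MeroL.polesAbove f B).Finite ∧
      (MeroL.IsFourierExpansion (MeroL.regularized f B) (MeroL.coeffR f B) ∧
        ∀ n : ℤ, n < 0 → MeroL.coeffR f B n = 0) ∧
      (∀ s : ℂ, Summable fun n : {n : ℤ // n ≠ 0} => MeroL.gammaTerm f k B s n) ∧
      (∀ p ∈ MeroL.polesAbove f B, ∀ (N : ℕ) (s : ℂ),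
        MeroL.HasPolylogIntegral N s p B (MeroL.polylogIntegral N s p B) ∧
        MeroL.HasPolylogIntegral N s p (1 / B) (MeroL.polylogIntegral N s p (1 / B))) ∧
      Differentiable ℂ (MeroL.regularPart f k B) ∧
      ∀ s ∉ MeroL.exceptional f k,
        MeroL.regL f k s = MeroL.polarTerm f k B s + MeroL.regularPart f k B s) ∧
    -- the functional equation
    ∀ s ∉ MeroL.exceptional f k,
      MeroL.regL f k s = Complex.I ^ k * MeroL.regL f k ((k : ℂ) - s) := by
  exact ⟨hf.isFourierExpansion hcusp, hf.isRegLIntegral_regL hcusp,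
    fun B hB => hf.exists_entire_part hcusp hB, fun B hB => hf.explicit_formula hcusp hB,
    fun s hs => hf.regL_functional_equation hcusp hs⟩
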